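/- Let $F$ be a number field and $\ell$ a prime number. For a prime ideal $\mathfrak p$ of $F$ over the prime number $p$ let $F_{\mathfrak p}$ be the completion, $f_{\mathfrak p}$ the residue degree, $\widehat{\mathbb Q}_p^c$ the cyclotomic $\widehat{\mathbb Z}$-extension of $\mathbb Q_p$ (the compositum, over all primes $q$, of the cyclotomic $\mathbb Z_q$-extensions of $\mathbb Q_p$), $\widetilde f_{\mathfrak p}=[F_{\mathfrak p}\cap\widehat{\mathbb Q}_p^c:\mathbb Q_p]$, and $\lambda_{\mathfrak p}=f_{\mathfrak p}/\widetilde f_{\mathfrak p}$. Let $\operatorname{Log}_\ell$ be the Iwasawa logarithm on $\mathbb Q_\ell^\times$ (so $\operatorname{Log}_\ell\ell=0$). Put $\deg_\ell p=\operatorname{Log}_\ell p$ if $p\ne\ell$, $\deg_\ell\ell=\ell$ if $\ell\neq2$, $\deg_2 2=4$, and $\deg_F\mathfrak p=\widetilde f_{\mathfrak p}\deg_\ell p$. For $x\in F^\times$ put $$\widetilde v_{\mathfrak p}(x)=-\frac{\operatorname{Log}_\ell(N_{F_{\mathfrak p}/\mathbb Q_p}(x))}{\deg_F\mathfrak p},$$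 where for $p\ne\ell$ the expression $\operatorname{Log}_\ell(y)$, $y\in\mathbb Q_p^\times$, means $\operatorname{Log}_\ell(|y|_p)$ with $|y|_p=p^{-v_p(y)}$; extend $\widetilde v_{\mathfrak p}$ $\mathbb Z_\ell$-linearly to $\mathcal R=\mathbb Z_\ell\otimes_{\mathbb Z}F^\times$. Let $\mathcal D\ell=\bigoplus_{\mathfrak p}\mathbb Z_\ell\,\mathfrak p$, with degree $\deg(\sum n_{\mathfrak p}\mathfrak p)=\sum n_{\mathfrak p}\deg_F\mathfrak p$, let $\widetilde{\mathcal D\ell}$ be its submodule of divisors of degree $0$, $\operatorname{div}(x)=\sum_{\mathfrak p}\widetilde v_{\mathfrak p}(x)\,\mathfrak p$, $\widetilde{\mathcal P\ell}=\operatorname{div}(\mathcal R)$, and let $\widetilde{\mathcal Cl}=\widetilde{\mathcal D\ell}/\widetilde{\mathcal P\ell}$ be the $\ell$-group of logarithmic classes. Let $\widetilde{\mathcal Cl}(\ell)\subseteq\widetilde{\mathcal Cl}$ be the submodule of classes of divisors of degree $0$ supported on the primes above $\ell$. Let $\mathcal Cl'$ be the $\ell$-part $\mathbb Z_\ell\otimes_{\mathbb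 Z}\bigl(\mathcal Cl/\langle[\mathfrak p]:\mathfrak p\mid\ell\rangle\bigr)$ of the quotient of the ideal class group $\mathcal Cl$ of $F$ by the subgroup generated by the classes of the primes above $\ell$; the class in it of $\prod\mathfrak p^{a_{\mathfrak p}}$ with $a_{\mathfrak p}\in\mathbb Z_\ell$ is $\sum a_{\mathfrak p}\otimes[\mathfrak p]$. Then $\operatorname{div}$ maps $\mathcal R$ into $\widetilde{\mathcal D\ell}$ (the $\widetilde v_{\mathfrak p}$ take values in $\mathbb Z_\ell$, are almost all zero on a given element, and $\deg\circ\operatorname{div}=0$), each $\lambda_{\mathfrak p}$ with $\mathfrak p\nmid\ell$ is an $\ell$-adic unit, and the homomorphism $$\theta:\widetilde{\mathcal Cl}\longrightarrow\mathcal Cl',\qquad\Bigl[\sum_{\mathfrak p}m_{\mathfrak p}\mathfrak p\Bigr]\longmapsto\Bigl[\prod_{\mathfrak p\nmid\ell}\mathfrak p^{(1/\lambda_{\mathfrak p})m_{\mathfrak p}}\Bigr]$$ is well defined. Its kernel is $\widetilde{\mathcal Cl}(\ell)$, and the sequence $$0\longrightarrow\widetilde{\mathcal Cl}(\ell)\longrightarrow\widetilde{\mathcal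 Cl}\stackrel{\theta}{\longrightarrow}\mathcal Cl'\longrightarrow\operatorname{Coker}\theta\longrightarrow0$$ is exact. -/

import Mathlib

open IsDedekindDomain NumberField
open scoped TensorProduct

namespace LogClass

/-- The `ℓ`-adic logarithm series `log u = ∑ (-1)^n (u - 1)^(n + 1) / (n + 1)`, convergent
for `‖u - 1‖ < 1`. -/
noncomputable def logSeries (l : ℕ) [Fact l.Prime] (u : ℚ_[l]) : ℚ_[l] :=
  ∑' n : ℕ, (-1) ^ n * (u - 1) ^ (n + 1) / ((n : ℚ_[l]) + 1)

section log
variable (l : ℕ) [Fact l.Prime]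

lemma norm_natCast_inv_le (n : ℕ) : ‖((n : ℚ_[l]) + 1)⁻¹‖ ≤ (n : ℝ) + 1 := by
  have h : ((n : ℚ_[l]) + 1) = ((n + 1 : ℕ) : ℚ_[l]) := by push_cast; ring
  rw [h, norm_inv, Padic.norm_eq_zpow_neg_valuation (by exact_mod_cast Nat.succ_ne_zero n),
    zpow_neg, inv_inv, Padic.valuation_natCast, zpow_natCast]
  exact_mod_cast Nat.le_of_dvd (Nat.succ_pos n) pow_padicValNat_dvd

lemma summable_bound {r : ℝ} (h0 : 0 ≤ r) (h1 : r < 1) :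
    Summable fun n : ℕ => r ^ (n + 1) * ((n : ℝ) + 1) := by
  have h := (summable_nat_add_iff 1).2
    (summable_pow_mul_geometric_of_norm_lt_one 1 (r := r) (by rwa [Real.norm_of_nonneg h0]))
  refine h.congr fun n => ?_
  push_cast; ring

lemma choose_eq (m n : ℕ) (hm : m ≠ 0) :
    ((m.choose (n + 1) : ℕ) : ℚ_[l]) / m = ((m - 1).choose n : ℕ) / ((n : ℚ_[l]) + 1) := by
  obtain ⟨m, rfl⟩ := Nat.exists_eq_succ_of_ne_zero hm
  have h := Nat.add_one_mul_choose_eq m n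
  have h' : ((m.succ : ℕ) : ℚ_[l]) * (m.choose n : ℕ)
      = ((m.succ.choose n.succ : ℕ) : ℚ_[l]) * (n.succ : ℕ) := by exact_mod_cast h
  have h1 : ((m.succ : ℕ) : ℚ_[l]) ≠ 0 := by exact_mod_cast Nat.succ_ne_zero m
  have h2 : ((n.succ : ℕ) : ℚ_[l]) ≠ 0 := by exact_mod_cast Nat.succ_ne_zero n
  have h3 : ((n : ℚ_[l]) + 1) = ((n.succ : ℕ) : ℚ_[l]) := by push_cast; ring
  rw [h3, div_eq_div_iff h1 h2]
  simp only [Nat.succ_eq_add_one, Nat.add_sub_cancel] at *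
  rw [← h']; ring

lemma tendsto_pow_zero : Filter.Tendsto (fun k : ℕ => (l : ℚ_[l]) ^ k) Filter.atTop (nhds 0) :=
  tendsto_pow_atTop_nhds_zero_of_norm_lt_one Padic.norm_p_lt_one

lemma tendsto_choose (n : ℕ) :
    Filter.Tendsto (fun k : ℕ => (((l ^ k - 1).choose n : ℕ) : ℚ_[l])) Filter.atTop
      (nhds ((-1) ^ n)) := by
  induction n with
  | zero => simp
  | succ n ih =>
    have h2 : Filter.Tendsto (fun k : ℕ => (((l ^ k).choose (n + 1) : ℕ) : ℚ_[l]))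
        Filter.atTop (nhds 0) := by
      have e : ∀ k : ℕ, (((l ^ k).choose (n + 1) : ℕ) : ℚ_[l])
          = (l : ℚ_[l]) ^ k * ((((l ^ k - 1).choose n : ℕ) : ℚ_[l]) / ((n : ℚ_[l]) + 1)) := by
        intro k
        have hk : l ^ k ≠ 0 := pow_ne_zero _ (Fact.out : l.Prime).ne_zero
        rw [← choose_eq l _ n hk]
        have : ((l ^ k : ℕ) : ℚ_[l]) ≠ 0 := by exact_mod_cast hk
        push_cast at *
        field_simp
      simp_rw [e]
      simpa using (tendsto_pow_zero l).mul (ih.div_const ((n : ℚ_[l]) + 1))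
    have e : ∀ k : ℕ, (((l ^ k - 1).choose (n + 1) : ℕ) : ℚ_[l])
        = (((l ^ k).choose (n + 1) : ℕ) : ℚ_[l]) - (((l ^ k - 1).choose n : ℕ) : ℚ_[l]) := by
      intro k
      have hk : l ^ k = (l ^ k - 1) + 1 :=
        (Nat.sub_add_cancel (Nat.one_le_pow _ _ (Fact.out : l.Prime).pos)).symm
      have h := Nat.choose_succ_succ (l ^ k - 1) n
      rw [Nat.succ_eq_add_one, ← hk] at h
      rw [h]; push_cast; ring
    simp_rw [e]
    simpa [pow_succ] using h2.sub ih

/-- On `1`-units the series is the limit of `(u ^ (ℓ ^ k) - 1) / ℓ ^ k`. -/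
lemma tendsto_logSeries {u : ℚ_[l]} (hu : ‖u - 1‖ < 1) :
    Filter.Tendsto (fun k : ℕ => (u ^ l ^ k - 1) / (l : ℚ_[l]) ^ k) Filter.atTop
      (nhds (logSeries l u)) := by
  have key : ∀ k : ℕ, (u ^ l ^ k - 1) / (l : ℚ_[l]) ^ k
      = ∑' n : ℕ, (((l ^ k - 1).choose n : ℕ) : ℚ_[l]) * (u - 1) ^ (n + 1) / ((n : ℚ_[l]) + 1) := by
    intro k
    have hk : l ^ k ≠ 0 := pow_ne_zero _ (Fact.out : l.Prime).ne_zero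
    rw [tsum_eq_sum (s := Finset.range (l ^ k))]
    · have h : u ^ l ^ k = ((u - 1) + 1) ^ l ^ k := by rw [sub_add_cancel]
      rw [h, add_pow, Finset.sum_range_succ']
      simp only [one_pow, mul_one, pow_zero, Nat.choose_zero_right, Nat.cast_one,
        add_sub_cancel_right]
      rw [Finset.sum_div]
      refine Finset.sum_congr rfl fun n _ => ?_
      have := choose_eq l _ n hk
      push_cast at this
      rw [mul_div_assoc, this]; ring
    · intro n hn
      rw [Nat.choose_eq_zero_of_lt]
      · simp
      · simp only [Finset.mem_range, not_lt] at hn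
        omega
  simp_rw [key]
  refine tendsto_tsum_of_dominated_convergence
    (bound := fun n : ℕ => ‖u - 1‖ ^ (n + 1) * ((n : ℝ) + 1))
    (summable_bound (norm_nonneg _) hu) ?_ ?_
  · intro n
    exact ((tendsto_choose l n).mul_const _).div_const _
  · refine Filter.Eventually.of_forall fun k n => ?_
    rw [div_eq_mul_inv, norm_mul, norm_mul, norm_pow]
    have h1 : ‖(((l ^ k - 1).choose n : ℕ) : ℚ_[l])‖ ≤ 1 := by
      simpa using Padic.norm_int_le_one (p := l) (((l ^ k - 1).choose n : ℕ) : ℤ)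
    calc _ ≤ 1 * ‖u - 1‖ ^ (n + 1) * ((n : ℝ) + 1) := by
          gcongr
          exact norm_natCast_inv_le l n
      _ = _ := by ring

lemma logSeries_mul {u v : ℚ_[l]} (hu : ‖u - 1‖ < 1) (hv : ‖v - 1‖ < 1) :
    logSeries l (u * v) = logSeries l u + logSeries l v := by
  have huv : ‖u * v - 1‖ < 1 := by
    have hv1 : ‖v‖ ≤ 1 := by
      have : v = (v - 1) + 1 := by ring
      rw [this]
      exact (Padic.nonarchimedean _ _).trans (max_le hv.le (by simp))
    have : u * v - 1 = (u - 1) * v + (v - 1) := by ring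
    rw [this]
    refine (Padic.nonarchimedean _ _).trans_lt (max_lt ?_ hv)
    rw [norm_mul]
    exact (mul_le_of_le_one_right (norm_nonneg _) hv1).trans_lt hu
  have hl : ∀ k : ℕ, (l : ℚ_[l]) ^ k ≠ 0 := fun k =>
    pow_ne_zero _ (by exact_mod_cast (Fact.out : l.Prime).ne_zero)
  have hv' : Filter.Tendsto (fun k : ℕ => v ^ l ^ k) Filter.atTop (nhds 1) := by
    have h := ((tendsto_logSeries l hv).mul (tendsto_pow_zero l)).add_const 1
    simp only [mul_zero, zero_add] at h
    refine h.congr fun k => ?_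
    rw [div_mul_cancel₀ _ (hl k), sub_add_cancel]
  have h := ((tendsto_logSeries l hu).mul hv').add (tendsto_logSeries l hv)
  rw [mul_one] at h
  refine tendsto_nhds_unique (tendsto_logSeries l huv) (h.congr fun k => ?_)
  have := hl k
  rw [mul_pow]
  field_simp
  ring

/-- The unit part of a nonzero `ℓ`-adic number, raised to the power `ℓ - 1`, is a `1`-unit. -/
lemma norm_unitPart_pow_sub_one_lt (x : ℚ_[l]ˣ) :
    ‖((x : ℚ_[l]) * (l : ℚ_[l]) ^ (-(x : ℚ_[l]).valuation)) ^ (l - 1) - 1‖ < 1 := by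
  set y : ℚ_[l] := (x : ℚ_[l]) * (l : ℚ_[l]) ^ (-(x : ℚ_[l]).valuation) with hy
  have hl : (l : ℝ) ≠ 0 := by exact_mod_cast (Fact.out : l.Prime).ne_zero
  have hy1 : ‖y‖ = 1 := by
    rw [hy, norm_mul, Padic.norm_p_zpow, Padic.norm_eq_zpow_neg_valuation x.ne_zero,
      ← zpow_add₀ hl]
    simp
  obtain ⟨z, hz⟩ : ∃ z : ℤ_[l], (z : ℚ_[l]) = y := ⟨⟨y, hy1.le⟩, rfl⟩
  have hzu : IsUnit z := by rw [PadicInt.isUnit_iff, PadicInt.norm_def, hz, hy1]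
  have h0 : PadicInt.toZMod (z ^ (l - 1) - 1) = 0 := by
    rw [map_sub, map_pow, map_one, ZMod.pow_card_sub_one_eq_one, sub_self]
    exact (hzu.map PadicInt.toZMod).ne_zero
  have h1 : z ^ (l - 1) - 1 ∈ IsLocalRing.maximalIdeal ℤ_[l] := by
    rw [← PadicInt.ker_toZMod]; exact h0
  rw [PadicInt.maximalIdeal_eq_span_p, Ideal.mem_span_singleton,
    ← PadicInt.norm_lt_one_iff_dvd] at h1
  rw [← hz]
  simpa [PadicInt.norm_def] using h1


/-- The Iwasawa logarithm `Log_ℓ : ℚ_ℓ^× → ℚ_ℓ`: it is the logarithm series on `1`-units, and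
`Log_ℓ ℓ = 0`. For `x = ℓ^n y` with `y` a unit, `y^(ℓ-1)` is a `1`-unit and
`Log_ℓ x = log (y^(ℓ-1)) / (ℓ - 1)`. -/
noncomputable def iwasawaLog : Additive ℚ_[l]ˣ →+ ℚ_[l] where
  toFun x := logSeries l (((x.toMul : ℚ_[l]) *
    (l : ℚ_[l]) ^ (-(x.toMul : ℚ_[l]).valuation)) ^ (l - 1)) / ((l : ℚ_[l]) - 1)
  map_zero' := by
    simp [logSeries]
  map_add' x y := by
    have hl : (l : ℚ_[l]) ≠ 0 := by exact_mod_cast (Fact.out : l.Prime).ne_zero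
    rw [← add_div, ← logSeries_mul l (norm_unitPart_pow_sub_one_lt l _)
      (norm_unitPart_pow_sub_one_lt l _), ← mul_pow]
    congr 3
    rw [toMul_add, Units.val_mul, Padic.valuation_mul x.toMul.ne_zero y.toMul.ne_zero, neg_add,
      zpow_add₀ hl]
    ring

end log

section completion
variable {F : Type*} [Field F] [NumberField F] (v : HeightOneSpectrum (𝓞 F))

/-- The embedding of `ℚ` into the completion `F_v`, `ℚ` carrying its `p`-adic valuation. -/
noncomputable def ratToCompletion (p : ℕ) [Fact p.Prime] :
    WithVal (Rat.padicValuation p) →+* v.adicCompletion F :=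
  (algebraMap ℚ (v.adicCompletion F)).comp (WithVal.equiv (Rat.padicValuation p)).toRingHom

lemma continuous_ratToCompletion (p : ℕ) [Fact p.Prime] (hp : (p : 𝓞 F) ∈ v.asIdeal) :
    Continuous (ratToCompletion v p) := by
  have hnorm : ∀ x : 𝓞 F, ‖(algebraMap F (v.adicCompletion F) (algebraMap (𝓞 F) F x))‖ ≤ 1 :=
    fun x => FinitePlace.norm_le_one F v x
  have hcast : ∀ x : ℚ, algebraMap ℚ (v.adicCompletion F) x
      = algebraMap F (v.adicCompletion F) (x : F) := by
    intro x
    rw [IsScalarTower.algebraMap_apply ℚ F (v.adicCompletion F)]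
    simp
  have hint : ∀ n : ℤ, ‖algebraMap ℚ (v.adicCompletion F) (n : ℚ)‖ ≤ 1 := by
    intro n
    rw [hcast]
    simpa using hnorm (n : 𝓞 F)
  have hpn : ‖algebraMap ℚ (v.adicCompletion F) (p : ℚ)‖ < 1 := by
    rw [hcast]
    have := (FinitePlace.norm_lt_one_iff_mem F v (p : 𝓞 F)).2 hp
    have e : FinitePlace.embedding v (algebraMap (𝓞 F) F (p : 𝓞 F))
      = algebraMap F (v.adicCompletion F) ((p : ℚ) : F) := by
      rw [map_natCast]; simp
    rwa [e] at this
  have hden : ∀ d : ℕ, ¬ p ∣ d → ‖algebraMap ℚ (v.adicCompletion F) (d : ℚ)‖ = 1 := by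
    intro d hd
    rw [hcast]
    have hnot : (d : 𝓞 F) ∉ v.asIdeal := by
      intro hmem
      obtain ⟨a, b, hab⟩ := (Nat.isCoprime_iff_coprime.2
        (((Fact.out : p.Prime).coprime_iff_not_dvd).2 hd))
      apply v.isPrime.ne_top
      rw [Ideal.eq_top_iff_one]
      have h1 : (1 : 𝓞 F) = (a : 𝓞 F) * (p : 𝓞 F) + (b : 𝓞 F) * (d : 𝓞 F) := by
        exact_mod_cast congrArg (Int.cast : ℤ → 𝓞 F) hab.symm
      rw [h1]
      exact add_mem (Ideal.mul_mem_left _ _ hp) (Ideal.mul_mem_left _ _ hmem)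
    have := (FinitePlace.norm_eq_one_iff_notMem F v (d : 𝓞 F)).2 hnot
    have e : FinitePlace.embedding v (algebraMap (𝓞 F) F (d : 𝓞 F))
      = algebraMap F (v.adicCompletion F) ((d : ℚ) : F) := by
      rw [map_natCast]; simp
    rwa [e] at this
  have hle : ∀ r : ℚ, ‖(r : ℚ_[p])‖ ≤ 1 → ‖algebraMap ℚ (v.adicCompletion F) r‖ ≤ 1 := by
    intro r hr
    have hd : ¬ p ∣ r.den := Rat.padicValuation_le_one_iff.1
      ((Padic.norm_rat_le_one_iff_padicValuation_le_one p).1 hr)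
    conv_lhs => rw [← Rat.num_div_den r]
    rw [map_div₀, norm_div, hden _ hd, div_one]
    exact hint _
  have hind := Padic.isUniformInducing_cast_withVal (p := p)
  refine continuous_of_continuousAt_zero (ratToCompletion v p) ?_
  rw [ContinuousAt, map_zero, hind.isInducing.nhds_eq_comap, map_zero,
    (Metric.nhds_basis_ball.comap _).tendsto_iff Metric.nhds_basis_ball]
  intro ε hε
  obtain ⟨n, hn⟩ := exists_pow_lt_of_lt_one hε hpn
  have hp0 : (p : ℝ) ≠ 0 := by exact_mod_cast (Fact.out : p.Prime).ne_zero
  have hp0' : (0 : ℝ) < (p : ℝ) := by exact_mod_cast (Fact.out : p.Prime).pos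
  refine ⟨(p : ℝ) ^ (-(n : ℤ)), by positivity, fun x hx => ?_⟩
  set q : ℚ := x.ofVal with hq
  have hx' : ‖(q : ℚ_[p])‖ < (p : ℝ) ^ (-(n : ℤ)) := by simpa using hx
  have hq' : ‖((q / (p : ℚ) ^ n : ℚ) : ℚ_[p])‖ ≤ 1 := by
    push_cast
    rw [norm_div, norm_pow, Padic.norm_p, inv_pow, div_inv_eq_mul]
    rw [zpow_neg, zpow_natCast] at hx'
    calc _ ≤ ((p : ℝ) ^ n)⁻¹ * (p : ℝ) ^ n := by gcongr
      _ = 1 := inv_mul_cancel₀ (pow_ne_zero _ hp0)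
  have e : algebraMap ℚ (v.adicCompletion F) q
      = algebraMap ℚ (v.adicCompletion F) (q / (p : ℚ) ^ n)
        * algebraMap ℚ (v.adicCompletion F) p ^ n := by
    rw [← map_pow, ← map_mul, div_mul_cancel₀]
    exact pow_ne_zero _ (by exact_mod_cast (Fact.out : p.Prime).ne_zero)
  have : ‖algebraMap ℚ (v.adicCompletion F) q‖ < ε := by
    rw [e, norm_mul, norm_pow]
    exact (mul_le_of_le_one_left (by positivity) (hle _ hq')).trans_lt hn
  simpa [ratToCompletion] using this

/-- The continuous embedding `ℚ_p → F_v` into the completion of `F` at a prime `v ∣ p`: the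
extension by continuity of `ℚ → F_v`. -/
noncomputable def padicToCompletion (p : ℕ) [Fact p.Prime] (hp : (p : 𝓞 F) ∈ v.asIdeal) :
    ℚ_[p] →+* v.adicCompletion F :=
  (UniformSpace.Completion.extensionHom (ratToCompletion v p)
    (continuous_ratToCompletion v p hp)).comp Padic.withValRingEquiv.symm.toRingHom

end completion

section cyclotomic
variable (k Ω : Type*) [Field k] [Field Ω] [Algebra k Ω]

/-- `k(μ_{q^∞})` inside the extension `Ω` of `k` (used with `Ω` algebraically closed). -/
noncomputable def primePowerCyclotomic (q : ℕ) : IntermediateField k Ω :=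
  IntermediateField.adjoin k {z : Ω | ∃ n : ℕ, z ^ q ^ n = 1}

/-- The cyclotomic `ℤ_q`-extension of `k`: the subfield of `k(μ_{q^∞})` fixed by the
torsion of its (abelian) Galois group over `k`. -/
noncomputable def cyclotomicZqExtension (q : ℕ) : IntermediateField k Ω :=
  IntermediateField.lift (IntermediateField.fixedField (Subgroup.closure
    {s : (primePowerCyclotomic k Ω q) ≃ₐ[k] (primePowerCyclotomic k Ω q) | IsOfFinOrder s}))

/-- The cyclotomic `Ẑ`-extension `k^c` of `k`: the compositum of the cyclotomic `ℤ_q`-extensions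
of `k` over all primes `q`. -/
noncomputable def cyclotomicZHatExtension : IntermediateField k Ω :=
  ⨆ q : Nat.Primes, cyclotomicZqExtension k Ω q

/-- The degree `[E ∩ k^c : k]`, the intersection being taken in an algebraic closure of `E`. -/
noncomputable def cyclotomicInertiaDegree (E : Type*) [Field E] [Algebra k E] : ℕ :=
  Module.finrank k ↥((IsScalarTower.toAlgHom k E (AlgebraicClosure E)).fieldRange ⊓
    cyclotomicZHatExtension k (AlgebraicClosure E))

end cyclotomic

section places
variable {F : Type*} [Field F] [NumberField F] (v : HeightOneSpectrum (𝓞 F))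

/-- The prime number below `v`. -/
noncomputable def residueChar : ℕ := ringChar (𝓞 F ⧸ v.asIdeal)

instance factResidueCharPrime : Fact (residueChar v).Prime := by
  have : Finite (𝓞 F ⧸ v.asIdeal) := v.asIdeal.finiteQuotientOfFreeOfNeBot v.ne_bot
  have := v.isPrime
  exact ⟨(CharP.char_is_prime_or_zero (𝓞 F ⧸ v.asIdeal) _).resolve_right
    (CharP.char_ne_zero_of_finite (𝓞 F ⧸ v.asIdeal) _)⟩

lemma residueChar_mem : (residueChar v : 𝓞 F) ∈ v.asIdeal := by
  rw [← Ideal.Quotient.eq_zero_iff_mem, map_natCast]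
  exact CharP.cast_eq_zero _ _

variable (p : ℕ) [Fact p.Prime] (hp : (p : 𝓞 F) ∈ v.asIdeal)

/-- `F_v` as a `ℚ_p`-algebra. -/
@[reducible] noncomputable def completionAlgebra : Algebra ℚ_[p] (v.adicCompletion F) :=
  (padicToCompletion v p hp).toAlgebra

/-- The local norm `N_{F_v/ℚ_p}` on `F^×`, for a prime `v ∣ p`. -/
noncomputable def localNorm : Fˣ →* ℚ_[p]ˣ :=
  letI := completionAlgebra v p hp
  (Units.map (Algebra.norm ℚ_[p])).comp
    (Units.map (algebraMap F (v.adicCompletion F)).toMonoidHom)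

/-- The absolute logarithmic inertia degree `f̃_v = [F_v ∩ ℚ_p^c : ℚ_p]`, where `p` is the prime
below `v` and `ℚ_p^c` is the cyclotomic `Ẑ`-extension of `ℚ_p`. -/
noncomputable def logInertiaDegree : ℕ :=
  letI := completionAlgebra v (residueChar v) (residueChar_mem v)
  cyclotomicInertiaDegree ℚ_[residueChar v] (v.adicCompletion F)

variable (l : ℕ) [Fact l.Prime]

/-- The prime `p` as an element of `ℚ_ℓ^×`. -/
noncomputable def primeUnit : ℚ_[l]ˣ :=
  Units.mk0 (p : ℚ_[l]) (by exact_mod_cast (Fact.out : p.Prime).ne_zero)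

/-- The `p`-adic absolute value `|y|_p = p^(-v_p(y))`, a rational number seen in `ℚ_ℓ^×`. -/
noncomputable def padicAbs : ℚ_[p]ˣ →* ℚ_[l]ˣ where
  toFun y := primeUnit p l ^ (-(y : ℚ_[p]).valuation)
  map_one' := by simp
  map_mul' y z := by
    rw [Units.val_mul, Padic.valuation_mul y.ne_zero z.ne_zero, neg_add, zpow_add]

open Classical in
/-- `deg_ℓ p`: `Log_ℓ p` for `p ≠ ℓ`, `ℓ` for `p = ℓ ≠ 2`, and `4` for `p = ℓ = 2`. -/
noncomputable def primeDegree : ℚ_[l] :=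
  if p = l then (if l = 2 then 4 else (l : ℚ_[l]))
  else iwasawaLog l (Additive.ofMul (primeUnit p l))

/-- The `ℓ`-adic degree `deg_F v = f̃_v · deg_ℓ p`, where `p` is the prime below `v`. -/
noncomputable def placeDegree : ℚ_[l] :=
  (logInertiaDegree v : ℚ_[l]) * primeDegree (residueChar v) l

open Classical in
/-- The homomorphism `x ↦ Log_ℓ (N_{F_v/ℚ_p} x)` on `F^×`. For `v ∣ ℓ` it is the Iwasawa logarithm
of the local norm. For `v ∤ ℓ` the norm lies in `ℚ_p` with `p ≠ ℓ`, and its `ℓ`-adic logarithm is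
that of its absolute value `p^(-v_p(N x))`. -/
noncomputable def logLocalNorm : Additive Fˣ →+ ℚ_[l] :=
  (iwasawaLog l).comp (MonoidHom.toAdditive
    (if h : (l : 𝓞 F) ∈ v.asIdeal then localNorm v l h
      else (padicAbs (residueChar v) l).comp (localNorm v (residueChar v) (residueChar_mem v))))

/-- The logarithmic valuation `ṽ_v(x) = - Log_ℓ (N_{F_v/ℚ_p} x) / deg_F v`, extended
`ℤ_ℓ`-linearly from `F^×` to `ℤ_ℓ ⊗ F^×`. -/
noncomputable def logValuation : ℤ_[l] ⊗[ℤ] Additive Fˣ →ₗ[ℤ_[l]] ℚ_[l] :=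
  LinearMap.liftBaseChange ℤ_[l]
    ((AddMonoidHom.mulLeft (-(placeDegree v l)⁻¹)).comp (logLocalNorm v l)).toIntLinearMap

/-- The ratio `λ_v = f_v / f̃_v` of the classical and the logarithmic inertia degrees. -/
noncomputable def indexRatio : ℚ_[l] :=
  (v.asIdeal.inertiaDeg ℤ : ℚ_[l]) / (logInertiaDegree v : ℚ_[l])

end places

section groups
variable (F : Type*) [Field F] [NumberField F] (l : ℕ) [Fact l.Prime]

/-- Logarithmic divisors: the free `ℤ_ℓ`-module on the prime ideals of `F`. -/
abbrev LogDivisor : Type _ := HeightOneSpectrum (𝓞 F) →₀ ℤ_[l]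

/-- The degree of a logarithmic divisor, `∑ n_v v ↦ ∑ n_v deg_F v`. -/
noncomputable def logDegree : LogDivisor F l →ₗ[ℤ_[l]] ℚ_[l] :=
  Finsupp.linearCombination ℤ_[l] fun v => placeDegree v l

/-- Logarithmic divisors of degree zero. -/
noncomputable def degreeZero : Submodule ℤ_[l] (LogDivisor F l) := LinearMap.ker (logDegree F l)

noncomputable instance addCommGroupDegreeZero : AddCommGroup (degreeZero F l) := Submodule.addCommGroup _

/-- The map `div_F : ℤ_ℓ ⊗ F^× → ∏_v ℚ_ℓ`, `x ↦ (ṽ_v(x))_v`. -/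
noncomputable def logDiv :
    ℤ_[l] ⊗[ℤ] Additive Fˣ →ₗ[ℤ_[l]] (HeightOneSpectrum (𝓞 F) → ℚ_[l]) :=
  LinearMap.pi fun v => logValuation v l

/-- The family of coefficients of a logarithmic divisor, read in `ℚ_ℓ`. -/
noncomputable def divisorCoeffs :
    LogDivisor F l →ₗ[ℤ_[l]] (HeightOneSpectrum (𝓞 F) → ℚ_[l]) :=
  LinearMap.pi fun v => (Algebra.linearMap ℤ_[l] ℚ_[l]).comp (Finsupp.lapply v)

/-- Principal logarithmic divisors: the divisors `∑ ṽ_v(x) v` with `x ∈ ℤ_ℓ ⊗ F^×`. -/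
noncomputable def principal : Submodule ℤ_[l] (LogDivisor F l) :=
  (LinearMap.range (logDiv F l)).comap (divisorCoeffs F l)

/-- The `ℓ`-group of logarithmic classes: degree-zero divisors modulo principal divisors. -/
abbrev LogClassGroup : Type _ :=
  degreeZero F l ⧸ (principal F l).comap (degreeZero F l).subtype

/-- The classes of the degree-zero logarithmic divisors supported on the primes above `ℓ`. -/
noncomputable def ladicPart : Submodule ℤ_[l] (LogClassGroup F l) :=
  ((Finsupp.supported ℤ_[l] ℤ_[l]
      {v : HeightOneSpectrum (𝓞 F) | (l : 𝓞 F) ∈ v.asIdeal}).comap (degreeZero F l).subtype).map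
    ((principal F l).comap (degreeZero F l).subtype).mkQ

/-- The class of the prime ideal `v` in the ideal class group. -/
noncomputable def placeClass {F : Type*} [Field F] [NumberField F]
    (v : HeightOneSpectrum (𝓞 F)) : ClassGroup (𝓞 F) :=
  ClassGroup.mk0 ⟨v.asIdeal, mem_nonZeroDivisors_of_ne_zero v.ne_bot⟩

/-- The subgroup of the ideal class group generated by the primes above `ℓ`. -/
noncomputable def ladicClasses : Subgroup (ClassGroup (𝓞 F)) :=
  Subgroup.closure {c | ∃ v : HeightOneSpectrum (𝓞 F), (l : 𝓞 F) ∈ v.asIdeal ∧ c = placeClass v}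

/-- The `ℓ`-part of the finite abelian group `Cl / ⟨[v] : v ∣ ℓ⟩`, as the `ℤ_ℓ`-module
`ℤ_ℓ ⊗ (Cl / ⟨[v] : v ∣ ℓ⟩)`. -/
abbrev LIdealClassGroup : Type _ :=
  ℤ_[l] ⊗[ℤ] Additive (ClassGroup (𝓞 F) ⧸ ladicClasses F l)

/-- The class in the `ℓ`-part of `Cl / ⟨[v] : v ∣ ℓ⟩` of an ideal `∏ v^(a_v)` with exponents
in `ℤ_ℓ`. -/
noncomputable def idealClass :
    LogDivisor F l →ₗ[ℤ_[l]] LIdealClassGroup F l :=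
  Finsupp.linearCombination ℤ_[l] fun v =>
    1 ⊗ₜ[ℤ] Additive.ofMul (placeClass v : ClassGroup (𝓞 F) ⧸ ladicClasses F l)

end groups
end LogClass

open LogClass

set_option linter.unusedSectionVars false

/-! Away from ℓ the logarithmic valuation is the ordinary one up to a unit. If v ∤ ℓ lies over p,
both Log_ℓ N(x) and deg_F v are multiples of Log_ℓ p, and ṽ_v = λ_v ord_v. Dividing the coefficient
at v by λ_v and dropping the primes above ℓ therefore turns div(x) into the prime-to-ℓ part of the
ordinary divisor of x, whose class in Cl' is trivial. This makes θ well defined (`scale_divisor`).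
For the kernel, Cl/⟨[v] : v ∣ ℓ⟩ is presented by the divisors modulo those of F^× and those above ℓ,
and tensoring with ℤ_ℓ is right exact. Hence if θ[D] = 0, some div(x) agrees with D away from ℓ, and
D - div(x) is supported above ℓ (`exists_primeToDivisor_eq`, `ker_logClassToIdealClass`). The exact
sequence is then formal.

That div(x) has degree 0 is a product formula (`sum_logLocalNorm`). Since ℚ_ℓ ⊗ F is the product of
the F_v with v ∣ ℓ, the local norms above ℓ multiply to the global norm. The latter is up to sign
the product of the (N v)^(ord_v x), and Log_ℓ kills -1 and ℓ, so the terms above ℓ cancel the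
others.

Two local facts carry the weight.

The first is that λ_v is an ℓ-adic unit for v ∤ ℓ (`norm_indexRatio`). For p ≠ ℓ the cyclotomic
ℤ_ℓ-extension of ℚ_p is the unramified one, because automorphisms act on roots of unity of order
prime to p through powers of Frobenius. Both f_v and f̃_v are then divisible by ℓ^b exactly when F_v
contains the roots of unity of order p^(ℓ^b) - 1.

The second is that Log_ℓ N(x) is divisible by f̃_v deg_ℓ ℓ for v ∣ ℓ (`norm_logLocalNorm_le`). Local
class field theory would give this; a global argument replaces it. A norm from F_v is a norm from
the ℓ-part M of F_v ∩ ℚ_ℓ^c, and M lies in ℚ_ℓ(ζ + ζ⁻¹) for some ζ of order ℓ^n. This field is the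
scalar extension of ℚ(ζ + ζ⁻¹), where primes not above ℓ have norm ± 1 modulo ℓ^n. So logarithms of
global norms, and by density those of local norms, are divisible by ℓ^n. Comparing the degrees of M
and of the real field gives the bound. -/

namespace LogClass

/-! ### The ℓ-adic logarithm near 1 and the kernel of Log_ℓ. -/

section logSeries
variable (l : ℕ) [Fact l.Prime]

/-- The radius of the disc around `1` on which the logarithm series is an isometry: `1 / ℓ`
for odd `ℓ` and `1 / 4` for `ℓ = 2`. -/
noncomputable def logRadius : ℝ := if l = 2 then 1 / 4 else (l : ℝ)⁻¹

lemma logRadius_lt_one : logRadius l < 1 := by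
  unfold logRadius
  split_ifs
  · norm_num
  · exact inv_lt_one_of_one_lt₀ (by exact_mod_cast (Fact.out : l.Prime).one_lt)

lemma logRadius_pos : 0 < logRadius l := by
  have : (0 : ℝ) < l := by exact_mod_cast (Fact.out : l.Prime).pos
  unfold logRadius
  split_ifs <;> positivity

lemma logRadius_pow_lt : logRadius l ^ (l - 1) < (l : ℝ)⁻¹ := by
  have hl := (Fact.out : l.Prime)
  unfold logRadius
  split_ifs with h
  · subst h; norm_num
  · have h3 : 1 < l - 1 := by have := hl.two_le; omega
    have h0 : (0 : ℝ) < (l : ℝ)⁻¹ := by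
      have : (0 : ℝ) < l := by exact_mod_cast hl.pos
      positivity
    have h1 : (l : ℝ)⁻¹ < 1 := inv_lt_one_of_one_lt₀ (by exact_mod_cast hl.one_lt)
    exact pow_lt_self_of_lt_one₀ h0 h1 h3

/-- In the expansion of (1 + t)^ℓ - 1 the linear term ℓt strictly dominates: the middle binomial
coefficients are divisible by ℓ, and t^ℓ is smaller because the radius r satisfies r^(ℓ-1) < 1/ℓ. -/
lemma norm_pow_prime_sub_one {w : ℚ_[l]} (hw : ‖w - 1‖ ≤ logRadius l) :
    ‖w ^ l - 1‖ = (l : ℝ)⁻¹ * ‖w - 1‖ := by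
  have hl := (Fact.out : l.Prime)
  obtain ⟨t, rfl⟩ : ∃ t, w = 1 + t := ⟨w - 1, by ring⟩
  rw [add_sub_cancel_left] at hw ⊢
  rcases eq_or_ne t 0 with rfl | ht
  · simp
  have ht0 : 0 < ‖t‖ := norm_pos_iff.2 ht
  have ht1 : ‖t‖ < 1 := hw.trans_lt (logRadius_lt_one l)
  have hl0 : (0 : ℝ) < (l : ℝ)⁻¹ := by
    have : (0 : ℝ) < l := by exact_mod_cast hl.pos
    positivity
  have hsum : (1 + t) ^ l - 1 = (∑ i ∈ Finset.Ico 2 (l + 1), t ^ i * (l.choose i : ℚ_[l])) + l * t := by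
    rw [add_comm 1 t, add_pow, Finset.range_eq_Ico, Finset.sum_eq_sum_Ico_succ_bot (by omega),
      Finset.sum_eq_sum_Ico_succ_bot (by have := hl.two_le; omega)]
    simp
    ring
  have hlt : ‖∑ i ∈ Finset.Ico 2 (l + 1), t ^ i * (l.choose i : ℚ_[l])‖ < ‖(l : ℚ_[l]) * t‖ := by
    rw [norm_mul, Padic.norm_p]
    refine (IsUltrametricDist.norm_sum_le_of_forall_le_of_nonneg
      (C := max ((l : ℝ)⁻¹ * ‖t‖ ^ 2) (‖t‖ ^ l)) (by positivity) ?_).trans_lt (max_lt ?_ ?_)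
    · intro i hi
      rw [Finset.mem_Ico] at hi
      rw [norm_mul, norm_pow]
      by_cases hil : i = l
      · subst hil
        simp
      · have hd : l ∣ l.choose i := hl.dvd_choose_self (by omega) (by omega)
        have : ‖(l.choose i : ℚ_[l])‖ ≤ (l : ℝ)⁻¹ := by
          obtain ⟨c, hc⟩ := hd
          rw [hc, Nat.cast_mul, norm_mul, Padic.norm_p]
          exact mul_le_of_le_one_right hl0.le (by simpa using Padic.norm_int_le_one (p := l) c)
        refine le_trans ?_ (le_max_left _ _)
        rw [mul_comm]
        gcongr ?_ * ?_
        exact pow_le_pow_of_le_one ht0.le ht1.le hi.1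
    · gcongr
      rw [pow_two]
      exact mul_lt_of_lt_one_left ht0 ht1
    · obtain ⟨m, hm⟩ := Nat.exists_eq_add_of_le' hl.one_le
      have h := logRadius_pow_lt l
      have hlm : l - 1 = m := by omega
      have hpow : ‖t‖ ^ l = ‖t‖ ^ m * ‖t‖ := by
        rw [← pow_succ]
        exact congrArg (‖t‖ ^ ·) hm
      rw [hlm] at h
      rw [hpow]
      gcongr
      exact (pow_le_pow_left₀ ht0.le hw m).trans_lt h
  rw [hsum, IsUltrametricDist.norm_add_eq_max_of_norm_ne_norm hlt.ne, max_eq_right hlt.le,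
    norm_mul, Padic.norm_p]

/-- Close to `1` the logarithm series is norm preserving. -/
lemma norm_logSeries {w : ℚ_[l]} (hw : ‖w - 1‖ ≤ logRadius l) : ‖logSeries l w‖ = ‖w - 1‖ := by
  have hl := (Fact.out : l.Prime)
  have hl0 : (0 : ℝ) < l := by exact_mod_cast hl.pos
  have hpow : ∀ k : ℕ, ‖w ^ l ^ k - 1‖ = ((l : ℝ)⁻¹) ^ k * ‖w - 1‖ := by
    intro k
    induction k with
    | zero => simp
    | succ k ih =>
      rw [pow_succ, pow_mul, norm_pow_prime_sub_one, ih]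
      · ring
      · rw [ih]
        refine (mul_le_of_le_one_left (norm_nonneg _) ?_).trans hw
        exact pow_le_one₀ (by positivity)
          (inv_le_one_of_one_le₀ (by exact_mod_cast hl.one_le))
  have h := (tendsto_logSeries l (hw.trans_lt (logRadius_lt_one l))).norm
  -- The norm of (w^(ℓ^k) - 1)/ℓ^k does not depend on k, so it is the norm of the limit.
  refine tendsto_nhds_unique h (tendsto_const_nhds.congr fun k => ?_)
  rw [norm_div, hpow, norm_pow, Padic.norm_p]
  field_simp

lemma norm_pow_sub_one_le {u : ℚ_[l]} (hu : ‖u‖ ≤ 1) (n : ℕ) : ‖u ^ n - 1‖ ≤ ‖u - 1‖ := by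
  rw [← mul_geom_sum, norm_mul]
  refine mul_le_of_le_one_right (norm_nonneg _) ?_
  refine IsUltrametricDist.norm_sum_le_of_forall_le_of_nonneg zero_le_one fun i _ => ?_
  rw [norm_pow]
  exact pow_le_one₀ (norm_nonneg _) hu

lemma norm_prime_sub_one : ‖(l : ℚ_[l]) - 1‖ = 1 := by
  have h : ‖(l : ℚ_[l])‖ < ‖(-1 : ℚ_[l])‖ := by simpa using Padic.norm_p_lt_one (p := l)
  rw [sub_eq_add_neg, IsUltrametricDist.norm_add_eq_max_of_norm_ne_norm h.ne, max_eq_right h.le]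
  simp

lemma norm_iwasawaLog_le {u : ℚ_[l]ˣ} (hu : ‖(u : ℚ_[l]) - 1‖ ≤ logRadius l) :
    ‖iwasawaLog l (Additive.ofMul u)‖ ≤ ‖(u : ℚ_[l]) - 1‖ := by
  have h1 : ‖(u : ℚ_[l])‖ = 1 := by
    have h : ‖(u : ℚ_[l]) - 1‖ < ‖(1 : ℚ_[l])‖ := by
      simpa using hu.trans_lt (logRadius_lt_one l)
    have := IsUltrametricDist.norm_add_eq_max_of_norm_ne_norm h.ne
    rwa [sub_add_cancel, max_eq_right h.le, norm_one] at this
  have hv : (u : ℚ_[l]).valuation = 0 := by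
    have := Padic.norm_eq_zpow_neg_valuation u.ne_zero
    rw [h1, eq_comm, zpow_eq_one_iff_right₀ (by positivity)
      (by exact_mod_cast (Fact.out : l.Prime).ne_one)] at this
    omega
  have h2 := norm_pow_sub_one_le l h1.le (l - 1)
  simp only [iwasawaLog, AddMonoidHom.coe_mk, ZeroHom.coe_mk, toMul_ofMul, hv, neg_zero, zpow_zero,
    mul_one]
  rw [norm_div, norm_prime_sub_one, div_one, norm_logSeries l (h2.trans hu)]
  exact h2

lemma iwasawaLog_neg_one : iwasawaLog l (Additive.ofMul (-1)) = 0 := by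
  have h : (2 : ℕ) • iwasawaLog l (Additive.ofMul (-1)) = 0 := by
    rw [← map_nsmul, ← ofMul_pow]
    simp
  simpa using h

lemma iwasawaLog_prime : iwasawaLog l (Additive.ofMul (primeUnit l l)) = 0 := by
  have : (l : ℚ_[l]) ≠ 0 := by exact_mod_cast (Fact.out : l.Prime).ne_zero
  simp [iwasawaLog, primeUnit, logSeries, this]

/-- The kernel of the Iwasawa logarithm. -/
lemma exists_pow_eq_of_iwasawaLog_eq_zero {x : ℚ_[l]ˣ} (hx : iwasawaLog l (Additive.ofMul x) = 0) :
    ∃ n : ℕ, n ≠ 0 ∧ ((x : ℚ_[l]) * (l : ℚ_[l]) ^ (-(x : ℚ_[l]).valuation)) ^ n = 1 := by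
  have hl := (Fact.out : l.Prime)
  have hlt := norm_unitPart_pow_sub_one_lt l x
  set w : ℚ_[l] := ((x : ℚ_[l]) * (l : ℚ_[l]) ^ (-(x : ℚ_[l]).valuation)) ^ (l - 1) with hw
  have h0 : logSeries l w = 0 := by
    rw [iwasawaLog] at hx
    simp only [AddMonoidHom.coe_mk, ZeroHom.coe_mk, toMul_ofMul, div_eq_zero_iff] at hx
    refine hx.resolve_right fun h => ?_
    have := norm_prime_sub_one l
    rw [h] at this
    simp at this
  have hk : ∀ k : ℕ, ‖w ^ k - 1‖ < 1 ∧ logSeries l (w ^ k) = 0 := by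
    intro k
    induction k with
    | zero => simp [logSeries]
    | succ k ih =>
      have h1 : ‖w ^ (k + 1) - 1‖ < 1 := by
        have : w ^ (k + 1) - 1 = (w ^ k - 1) * (w - 1) + (w ^ k - 1) + (w - 1) := by ring
        rw [this]
        refine (IsUltrametricDist.norm_add_le_max _ _).trans_lt (max_lt ?_ hlt)
        refine (IsUltrametricDist.norm_add_le_max _ _).trans_lt (max_lt ?_ ih.1)
        rw [norm_mul]
        exact mul_lt_one_of_nonneg_of_lt_one_left (norm_nonneg _) ih.1 hlt.le
      refine ⟨h1, ?_⟩
      rw [pow_succ, logSeries_mul l ih.1 hlt, ih.2, h0, add_zero]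
  have hlim : Filter.Tendsto (fun k : ℕ => w ^ l ^ k - 1) Filter.atTop (nhds 0) := by
    have h := (tendsto_logSeries l hlt).mul (tendsto_pow_zero l)
    rw [mul_zero] at h
    refine h.congr fun k => ?_
    have : (l : ℚ_[l]) ^ k ≠ 0 := pow_ne_zero _ (by exact_mod_cast hl.ne_zero)
    field_simp
  -- Some power w^(ℓ^k) enters the disc where the logarithm preserves norms; its logarithm being 0,
  -- it equals 1.
  obtain ⟨k, hk'⟩ := ((Metric.tendsto_nhds.1 hlim) _ (logRadius_pos l)).exists
  rw [dist_zero_right] at hk'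
  have h1 := norm_logSeries l hk'.le
  rw [(hk _).2, norm_zero, eq_comm, norm_eq_zero, sub_eq_zero] at h1
  refine ⟨(l - 1) * l ^ k, ?_, ?_⟩
  · have := hl.two_le
    exact mul_ne_zero (by omega) (pow_ne_zero _ hl.ne_zero)
  · rw [pow_mul, ← hw, h1]

/-- A vanishing logarithm would make the ℓ-adic unit p a root of unity, impossible for an integer p
> 1. This keeps the degrees deg_F v nonzero. -/
lemma iwasawaLog_primeUnit_ne_zero (p : ℕ) [Fact p.Prime] (hp : p ≠ l) :
    iwasawaLog l (Additive.ofMul (primeUnit p l)) ≠ 0 := by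
  intro h
  obtain ⟨n, hn, h1⟩ := exists_pow_eq_of_iwasawaLog_eq_zero l h
  have hv : ((primeUnit p l : ℚ_[l]ˣ) : ℚ_[l]).valuation = 0 := by
    simp only [primeUnit, Units.val_mk0, Padic.valuation_natCast, Nat.cast_eq_zero]
    exact padicValNat_primes hp.symm
  rw [hv, neg_zero, zpow_zero, mul_one] at h1
  simp only [primeUnit, Units.val_mk0] at h1
  have h2 : p ^ n = 1 := by exact_mod_cast h1
  have := (Fact.out : p.Prime).one_lt
  have := Nat.one_lt_pow hn this
  omega

end logSeries

/-! ### Norms of algebras, and multiplicative maps continuous at 0. -/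

section algebra

/-- Left multiplication on a product of algebras is block diagonal in the concatenated bases. -/
lemma norm_pi_dependent {ι k : Type*} [Field k] {A : ι → Type*} [∀ i, CommRing (A i)]
    [∀ i, Algebra k (A i)] [∀ i, Module.Finite k (A i)] [Fintype ι] (x : ∀ i, A i) :
    Algebra.norm k x = ∏ i, Algebra.norm k (x i) := by
  classical
  let : LinearOrder ι := LinearOrder.lift' (Fintype.equivFin ι) (Fintype.equivFin ι).injective
  let b : ∀ i, Module.Basis (Module.Free.ChooseBasisIndex k (A i)) k (A i) :=
    fun i => Module.Free.chooseBasis k (A i)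
  have hM : Algebra.leftMulMatrix (Pi.basis b) x
      = Matrix.blockDiagonal' fun i => Algebra.leftMulMatrix (b i) (x i) := by
    ext ⟨i, a⟩ ⟨j, c⟩
    rw [Algebra.leftMulMatrix_eq_repr_mul, Matrix.blockDiagonal'_apply, Pi.basis_apply]
    simp only [Pi.basis_repr, Pi.mul_apply]
    split_ifs with h
    · subst h
      simp [Algebra.leftMulMatrix_eq_repr_mul]
    · simp [Pi.single_eq_of_ne h]
  rw [Algebra.norm_eq_matrix_det (Pi.basis b), hM,
    (Matrix.blockTriangular_blockDiagonal' _).det_fintype]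
  refine Finset.prod_congr rfl fun i _ => ?_
  rw [Algebra.norm_eq_matrix_det (b i)]
  let e : Module.Free.ChooseBasisIndex k (A i) ≃
      {a : Σ i, Module.Free.ChooseBasisIndex k (A i) // a.1 = i} :=
    { toFun := fun a => ⟨⟨i, a⟩, rfl⟩
      invFun := fun a => a.2 ▸ a.1.2
      left_inv := fun a => rfl
      right_inv := by rintro ⟨⟨j, a⟩, rfl⟩; rfl }
  rw [← Matrix.det_submatrix_equiv_self e]
  congr 1
  ext a c
  simp [e, Matrix.toSquareBlock_def, Matrix.blockDiagonal'_apply]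

lemma norm_baseChange {k K L : Type*} [Field k] [Field K] [Field L] [Algebra k K] [Algebra k L]
    [FiniteDimensional k L] (x : L) :
    Algebra.norm K ((1 : K) ⊗ₜ[k] x) = algebraMap k K (Algebra.norm k x) := by
  rw [Algebra.norm_apply, Algebra.norm_apply, ← LinearMap.det_baseChange]
  congr 1
  ext y
  simp

/-- If ‖f x‖ > 1, the elements x^k c^n stay in a small ball for fixed n while their images grow with
k. This serves both ℚ_p → F_v and the norm F_v → ℚ_p, without comparing absolute values. -/
lemma norm_map_le_one_of_continuousAt {A B : Type*} [NormedField A] [NormedField B]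
    (f : A →*₀ B) (hf : ContinuousAt f 0) {c : A} (hc0 : c ≠ 0) (hc1 : ‖c‖ < 1)
    {x : A} (hx : ‖x‖ ≤ 1) : ‖f x‖ ≤ 1 := by
  obtain ⟨δ, hδ, h⟩ := Metric.continuousAt_iff.1 hf 1 one_pos
  obtain ⟨n, hn⟩ := exists_pow_lt_of_lt_one hδ hc1
  have hfc : 0 < ‖f (c ^ n)‖ := norm_pos_iff.2 ((map_ne_zero f).2 (pow_ne_zero n hc0))
  by_contra! hlt
  obtain ⟨k, hk⟩ := pow_unbounded_of_one_lt (‖f (c ^ n)‖⁻¹) hlt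
  have := h (x := x ^ k * c ^ n) (by
    rw [dist_zero_right, norm_mul, norm_pow, norm_pow]
    exact (mul_le_of_le_one_left (by positivity) (pow_le_one₀ (norm_nonneg _) hx)).trans_lt hn)
  rw [map_zero, dist_zero_right, map_mul, map_pow, norm_mul, norm_pow] at this
  rw [inv_lt_iff_one_lt_mul₀ hfc] at hk
  linarith

lemma norm_map_eq_one_of_continuousAt {A B : Type*} [NormedField A] [NormedField B]
    (f : A →*₀ B) (hf : ContinuousAt f 0) {c : A} (hc0 : c ≠ 0) (hc1 : ‖c‖ < 1)
    {x : A} (hx : ‖x‖ = 1) : ‖f x‖ = 1 := by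
  refine le_antisymm (norm_map_le_one_of_continuousAt f hf hc0 hc1 hx.le) ?_
  have h := norm_map_le_one_of_continuousAt f hf hc0 hc1 (x := x⁻¹) (by rw [norm_inv, hx, inv_one])
  have h0 : f x ≠ 0 := (map_ne_zero f).2 (by rintro rfl; simp at hx)
  rw [map_inv₀, norm_inv] at h
  exact (inv_le_one₀ (norm_pos_iff.2 h0)).1 h

/-- The norm of a finite extension is continuous for any topology making it a
topological vector space. -/
lemma continuous_algebraNorm {k L : Type*} [NontriviallyNormedField k] [CompleteSpace k] [Field L]
    [Algebra k L] [FiniteDimensional k L] [TopologicalSpace L] [IsTopologicalAddGroup L]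
    [ContinuousSMul k L] [T2Space L] : Continuous (Algebra.norm k : L → k) := by
  let b := Module.finBasis k L
  have : (Algebra.norm k : L → k) = fun x => (Algebra.leftMulMatrix b x).det := by
    ext x; rw [Algebra.norm_eq_matrix_det b]
  rw [this]
  exact Continuous.matrix_det
    (LinearMap.continuous_of_finiteDimensional (Algebra.leftMulMatrix b).toLinearMap)

end algebra

/-! ### The map from ℚ_p ⊗ F to the completions above p, and its injectivity. -/

section localGlobal
variable {F : Type*} [Field F] [NumberField F]

lemma continuous_padicToCompletion (v : HeightOneSpectrum (𝓞 F)) (p : ℕ) [Fact p.Prime]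
    (hp : (p : 𝓞 F) ∈ v.asIdeal) : Continuous (padicToCompletion v p hp) :=
  UniformSpace.Completion.continuous_extension.comp
    (Padic.withValUniformEquiv (p := p)).symm.continuous

lemma norm_algebraMap_intCast_le (v : HeightOneSpectrum (𝓞 F)) (x : 𝓞 F) :
    ‖algebraMap F (v.adicCompletion F) x‖ ≤ 1 :=
  FinitePlace.norm_le_one F v x

variable (F) in
/-- The primes of `F` above `p`. -/
abbrev PlaceAbove (p : ℕ) := {v : HeightOneSpectrum (𝓞 F) // (p : 𝓞 F) ∈ v.asIdeal}

variable (p : ℕ) [Fact p.Prime]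

instance finite_placeAbove : Finite (PlaceAbove F p) := by
  have hp : (p : 𝓞 F) ≠ 0 := by exact_mod_cast (Fact.out : p.Prime).ne_zero
  have := (Ring.HasFiniteQuotients.finite_setOfPred_mem (p : 𝓞 F) hp).to_subtype
  refine Finite.of_injective
    (fun w : PlaceAbove F p => (⟨w.1.asIdeal, w.2⟩ : {I : Ideal (𝓞 F) | (p : 𝓞 F) ∈ I})) ?_
  intro w w' h
  exact Subtype.ext (HeightOneSpectrum.ext (congrArg Subtype.val h))

noncomputable instance fintype_placeAbove : Fintype (PlaceAbove F p) := Fintype.ofFinite _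

/-- The completion at a prime above `p`. -/
abbrev CompletionAbove (w : PlaceAbove F p) := w.1.adicCompletion F

noncomputable instance algebraCompletionAbove (w : PlaceAbove F p) :
    Algebra ℚ_[p] (CompletionAbove p w) := completionAlgebra w.1 p w.2

instance continuousSMul_completionAbove (w : PlaceAbove F p) :
    ContinuousSMul ℚ_[p] (CompletionAbove p w) :=
  continuousSMul_of_algebraMap _ _ (continuous_padicToCompletion w.1 p w.2)

/-- The map `ℚ_p ⊗ F → ∏_{v ∣ p} F_v`. -/
noncomputable def tensorToProd : ℚ_[p] ⊗[ℚ] F →ₐ[ℚ_[p]] ∀ w : PlaceAbove F p, CompletionAbove p w :=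
  Algebra.TensorProduct.lift (Algebra.ofId _ _)
    (RingHom.toRatAlgHom (RingHom.pi fun w => algebraMap F (w.1.adicCompletion F)))
    (fun _ _ => Commute.all _ _)

lemma tensorToProd_tmul (c : ℚ_[p]) (x : F) (w : PlaceAbove F p) :
    tensorToProd p (c ⊗ₜ[ℚ] x) w
      = algebraMap ℚ_[p] (CompletionAbove p w) c * algebraMap F (w.1.adicCompletion F) x := by
  simp only [tensorToProd, Algebra.TensorProduct.lift_tmul, Algebra.ofId_apply, Pi.mul_apply]
  rfl

lemma norm_algebraMap_padic_le (w : PlaceAbove F p) {c : ℚ_[p]} (hc : ‖c‖ ≤ 1) :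
    ‖algebraMap ℚ_[p] (CompletionAbove p w) c‖ ≤ 1 :=
  norm_map_le_one_of_continuousAt (algebraMap ℚ_[p] (CompletionAbove p w)).toMonoidWithZeroHom
    (continuous_padicToCompletion w.1 p w.2).continuousAt
    (c := (p : ℚ_[p])) (by exact_mod_cast (Fact.out : p.Prime).ne_zero) Padic.norm_p_lt_one hc

lemma exists_int_sub_eq_mul {c : ℚ_[p]} (hc : ‖c‖ ≤ 1) :
    ∃ (n : ℤ) (e : ℚ_[p]), ‖e‖ ≤ 1 ∧ c = n + p * e := by
  obtain ⟨c, rfl⟩ : ∃ c' : ℤ_[p], (c' : ℚ_[p]) = c := ⟨⟨c, hc⟩, rfl⟩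
  obtain ⟨n, -, hn⟩ := PadicInt.exists_mem_range c
  rw [PadicInt.maximalIdeal_eq_span_p, Ideal.mem_span_singleton] at hn
  obtain ⟨e, he⟩ := hn
  refine ⟨n, e, PadicInt.norm_le_one e, ?_⟩
  have := congrArg (Subtype.val : ℤ_[p] → ℚ_[p]) he
  push_cast at this ⊢
  linear_combination this

/-- The quotient x/p is integral above p by hypothesis and elsewhere because p is a unit there. -/
lemma dvd_of_forall_norm_le (x : 𝓞 F)
    (hx : ∀ w : PlaceAbove F p, ‖algebraMap F (w.1.adicCompletion F) x‖
      ≤ ‖algebraMap F (w.1.adicCompletion F) (p : F)‖) : (p : 𝓞 F) ∣ x := by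
  have hp0 : (p : F) ≠ 0 := by exact_mod_cast (Fact.out : p.Prime).ne_zero
  obtain ⟨y, hy⟩ := HeightOneSpectrum.mem_integers_of_valuation_le_one (R := 𝓞 F) F
    ((x : F) / (p : F)) (fun v => by
      have key : ‖algebraMap F (v.adicCompletion F) ((x : F) / (p : F))‖ ≤ 1 := by
        rw [map_div₀, norm_div]
        by_cases hv : (p : 𝓞 F) ∈ v.asIdeal
        · exact div_le_one_of_le₀ (hx ⟨v, hv⟩) (norm_nonneg _)
        · have : ‖algebraMap F (v.adicCompletion F) (p : F)‖ = 1 := by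
            have := (FinitePlace.norm_eq_one_iff_notMem F v (p : 𝓞 F)).2 hv
            rwa [map_natCast] at this
          rw [this, div_one]
          exact norm_algebraMap_intCast_le v x
      have h2 := FinitePlace.norm_embedding' v ((x : F) / (p : F))
      rw [show FinitePlace.embedding v ((x : F) / (p : F))
        = algebraMap F (v.adicCompletion F) ((x : F) / (p : F)) from rfl] at h2
      rw [h2] at key
      have key' : WithZeroMulInt.toNNReal (HeightOneSpectrum.absNorm_ne_zero v) (v.valuation F ((x : F) / (p : F))) ≤ 1 := by exact_mod_cast key
      exact (WithZeroMulInt.toNNReal_le_one_iff (HeightOneSpectrum.one_lt_absNorm_nnreal v)).1 key')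
  refine ⟨y, RingOfIntegers.ext ?_⟩
  rw [eq_div_iff hp0] at hy
  simp [← hy, mul_comm]

/-- Write a nonzero kernel element in an integral basis, divide by its largest coordinate, and
replace the coordinates by integers n_i congruent to them modulo p. Vanishing in every F_v makes Σ
n_i ω_i divisible by p locally, hence in 𝓞 F, so p divides every n_i; but the largest coordinate has
become 1. -/
lemma tensorToProd_injective : Function.Injective (tensorToProd (F := F) p) := by
  classical
  rw [injective_iff_map_eq_zero]
  intro z hz
  let ω := RingOfIntegers.basis F
  let b := (integralBasis F).baseChange ℚ_[p]
  have hΨ : ∀ w : PlaceAbove F p, ∑ i, algebraMap ℚ_[p] (CompletionAbove p w) (b.repr z i)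
      * algebraMap F (w.1.adicCompletion F) (ω i) = 0 := by
    intro w
    have h := congrFun hz w
    rw [← b.sum_repr z, map_sum, Finset.sum_apply] at h
    refine Eq.trans ?_ h
    refine Finset.sum_congr rfl fun i _ => ?_
    rw [map_smul, Pi.smul_apply, Algebra.smul_def, Module.Basis.baseChange_apply, tensorToProd_tmul, map_one, one_mul,
      integralBasis_apply]
  by_contra hne
  have hex : ∃ i, b.repr z i ≠ 0 := by
    by_contra! h
    exact hne (b.repr.map_eq_zero_iff.1 (Finsupp.ext h))
  obtain ⟨j, hj⟩ := hex
  obtain ⟨i0, -, hmax⟩ := Finset.exists_max_image Finset.univ (fun i => ‖b.repr z i‖) ⟨j, Finset.mem_univ _⟩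
  set c0 := b.repr z i0 with hc0
  have h0 : c0 ≠ 0 := norm_pos_iff.1 ((norm_pos_iff.2 hj).trans_le (hmax j (Finset.mem_univ _)))
  have hd : ∀ i, ∃ (n : ℤ) (e : ℚ_[p]), ‖e‖ ≤ 1 ∧ b.repr z i / c0 = n + p * e := fun i =>
    exists_int_sub_eq_mul p (by
      rw [norm_div]; exact div_le_one_of_le₀ (hmax i (Finset.mem_univ _)) (norm_nonneg _))
  choose n e he hne' using hd
  have hdvd : (p : 𝓞 F) ∣ ∑ i, n i • ω i := by
    refine dvd_of_forall_norm_le p _ fun w => ?_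
    have h1 : algebraMap F (w.1.adicCompletion F) ((∑ i, n i • ω i : 𝓞 F) : F)
        = - (algebraMap F (w.1.adicCompletion F) (p : F) *
          ∑ i, algebraMap ℚ_[p] (CompletionAbove p w) (e i) * algebraMap F (w.1.adicCompletion F) (ω i)) := by
      have h2 : ∑ i, algebraMap ℚ_[p] (CompletionAbove p w) (b.repr z i / c0)
          * algebraMap F (w.1.adicCompletion F) (ω i) = 0 := by
        simp_rw [map_div₀, div_mul_eq_mul_div]
        rw [← Finset.sum_div, hΨ w, zero_div]
      rw [eq_neg_iff_add_eq_zero, ← h2, Finset.mul_sum]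
      simp only [map_sum, ← Finset.sum_add_distrib]
      refine Finset.sum_congr rfl fun i _ => ?_
      rw [hne' i]
      simp only [map_add, map_mul, map_intCast, map_natCast, zsmul_eq_mul]
      ring
    rw [h1, norm_neg, norm_mul]
    refine mul_le_of_le_one_right (norm_nonneg _) ?_
    refine IsUltrametricDist.norm_sum_le_of_forall_le_of_nonneg zero_le_one fun i _ => ?_
    rw [norm_mul]
    exact mul_le_one₀ (norm_algebraMap_padic_le p w (he i)) (norm_nonneg _)
      (norm_algebraMap_intCast_le w.1 _)
  obtain ⟨y, hy⟩ := hdvd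
  have hy' := congrArg (fun x => ω.repr x i0) hy
  have hpy : (p : 𝓞 F) * y = (p : ℤ) • y := by simp
  simp only [Module.Basis.repr_sum_self, hpy, map_zsmul, Finsupp.smul_apply, smul_eq_mul] at hy'
  have h3 := hne' i0
  rw [← hc0, div_self h0, hy'] at h3
  have h4 : (1 : ℚ_[p]) = p * ((ω.repr y i0 : ℤ) + e i0) := by
    rw [h3]; push_cast; ring
  have h5 := congrArg norm h4
  rw [norm_one, norm_mul] at h5
  have h6 : ‖((ω.repr y i0 : ℤ) : ℚ_[p]) + e i0‖ ≤ 1 :=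
    (Padic.nonarchimedean _ _).trans (max_le (Padic.norm_int_le_one _) (he i0))
  have h7 := Padic.norm_p_lt_one (p := p)
  have h8 := mul_le_of_le_one_right (norm_nonneg (p : ℚ_[p])) h6
  linarith

end localGlobal

/-! ### Weak approximation and the product of the local norms. -/

section localGlobal
variable {F : Type*} [Field F] [NumberField F] (p : ℕ) [Fact p.Prime]

lemma norm_algebraMap_lt_one_of_mem {v : HeightOneSpectrum (𝓞 F)} {x : 𝓞 F} {n : ℕ}
    (hx : x ∈ v.asIdeal ^ n) :
    ‖algebraMap F (v.adicCompletion F) x‖ ≤ ((Ideal.absNorm v.asIdeal : ℝ)⁻¹) ^ n := by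
  have h := FinitePlace.norm_embedding_int F v x
  rw [show FinitePlace.embedding v (algebraMap (𝓞 F) F x)
        = algebraMap F (v.adicCompletion F) (x : F) from rfl] at h
  rw [h]
  have h1 := (v.intValuation_le_pow_iff_mem x n).2 hx
  have h2 := (WithZeroMulInt.toNNReal_strictMono
    (HeightOneSpectrum.one_lt_absNorm_nnreal v)).monotone h1
  have h3 : WithZeroMulInt.toNNReal (HeightOneSpectrum.absNorm_ne_zero v) (WithZero.exp (-(n : ℤ)))
      = ((Ideal.absNorm v.asIdeal : NNReal)⁻¹) ^ n := by
    rw [WithZeroMulInt.toNNReal_neg_apply _ (by simp)]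
    change (Ideal.absNorm v.asIdeal : NNReal) ^ (-(n : ℤ)) = _
    simp
  rw [h3] at h2
  exact_mod_cast h2

variable (F) in
-- Weak approximation: each component is approximated separately, a common denominator d is cleared,
-- and the resulting congruences are solved by the Chinese remainder theorem.
lemma denseRange_algebraMap_pi :
    DenseRange fun (x : F) (w : PlaceAbove F p) => algebraMap F (w.1.adicCompletion F) x := by
  classical
  intro y
  rw [Metric.mem_closure_iff]
  intro ε hε
  have h1 : ∀ w : PlaceAbove F p, ∃ x : F, ‖y w - algebraMap F (w.1.adicCompletion F) x‖ < ε := by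
    intro w
    have := HeightOneSpectrum.denseRange_algebraMap F w.1 (y w)
    rw [Metric.mem_closure_iff] at this
    obtain ⟨_, ⟨x, rfl⟩, hx⟩ := this ε hε
    exact ⟨x, by rwa [← dist_eq_norm]⟩
  choose x hx using h1
  obtain ⟨d, hd⟩ := IsLocalization.exist_integer_multiples (nonZeroDivisors (𝓞 F)) Finset.univ x
  choose a ha using fun w => hd w (Finset.mem_univ w)
  have hd0 : ((d : 𝓞 F) : F) ≠ 0 := by
    have := nonZeroDivisors.coe_ne_zero d
    exact_mod_cast this
  have hdw : ∀ w : PlaceAbove F p, 0 < ‖algebraMap F (w.1.adicCompletion F) (d : 𝓞 F)‖ :=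
    fun w => norm_pos_iff.2 ((map_ne_zero _).2 hd0)
  have hq : ∀ w : PlaceAbove F p, (Ideal.absNorm w.1.asIdeal : ℝ)⁻¹ < 1 := fun w =>
    inv_lt_one_of_one_lt₀ (by exact_mod_cast HeightOneSpectrum.one_lt_absNorm w.1)
  -- The factor ‖d‖ in the target precision absorbs the later division by d.
  choose n hn using fun w => exists_pow_lt_of_lt_one (mul_pos hε (hdw w)) (hq w)
  obtain ⟨b, hb⟩ := IsDedekindDomain.exists_forall_sub_mem_ideal (s := Finset.univ)
    (fun w : PlaceAbove F p => w.1.asIdeal) n (fun w _ => w.1.prime)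
    (fun w _ w' _ h h' => h (Subtype.ext (HeightOneSpectrum.ext h'))) (fun w => a w)
  refine ⟨_, ⟨(b : F) / (d : 𝓞 F), rfl⟩, ?_⟩
  rw [dist_pi_lt_iff hε]
  intro w
  have h2 : ‖algebraMap F (w.1.adicCompletion F) (x w)
      - algebraMap F (w.1.adicCompletion F) ((b : F) / (d : 𝓞 F))‖ < ε := by
    have e : x w - (b : F) / (d : 𝓞 F) = - (((b - a w : 𝓞 F) : F) / (d : 𝓞 F)) := by
      have := ha w
      change (a w : F) = ((d : 𝓞 F) : F) * x w at this
      push_cast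
      field_simp
      linear_combination -this
    rw [← map_sub, e, map_neg, norm_neg, map_div₀, norm_div, div_lt_iff₀ (hdw w)]
    exact (norm_algebraMap_lt_one_of_mem (hb w (Finset.mem_univ w))).trans_lt (hn w)
  rw [dist_eq_norm, ← sub_add_sub_cancel]
  exact (IsUltrametricDist.norm_add_le_max _ _).trans_lt (max_lt (hx w) h2)

/-- The image is a finite-dimensional subspace, hence closed, and it contains the dense image of F.
Finiteness of F_v over ℚ_p is a consequence, not an ingredient. -/
lemma tensorToProd_surjective : Function.Surjective (tensorToProd (F := F) p) := by
  have hc : IsClosed ((LinearMap.range (tensorToProd (F := F) p).toLinearMap :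
      Submodule ℚ_[p] (∀ w : PlaceAbove F p, CompletionAbove p w)) : Set (∀ w : PlaceAbove F p, CompletionAbove p w)) :=
    Submodule.closed_of_finiteDimensional (LinearMap.range (tensorToProd (F := F) p).toLinearMap)
  have hd : Dense ((LinearMap.range (tensorToProd (F := F) p).toLinearMap :
      Submodule ℚ_[p] (∀ w : PlaceAbove F p, CompletionAbove p w)) : Set (∀ w : PlaceAbove F p, CompletionAbove p w)) := by
    refine (denseRange_algebraMap_pi F p).mono ?_
    rintro _ ⟨x, rfl⟩
    refine ⟨1 ⊗ₜ x, ?_⟩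
    ext w
    simp [tensorToProd_tmul]
  intro y
  have := hd.closure_eq ▸ Set.mem_univ y
  rw [hc.closure_eq] at this
  exact this

/-- `ℚ_p ⊗ F` is the product of the completions of `F` above `p`. -/
noncomputable def tensorEquivProd :
    ℚ_[p] ⊗[ℚ] F ≃ₐ[ℚ_[p]] ∀ w : PlaceAbove F p, CompletionAbove p w :=
  AlgEquiv.ofBijective (tensorToProd p) ⟨tensorToProd_injective p, tensorToProd_surjective p⟩

instance finiteDimensional_completionAbove (w : PlaceAbove F p) :
    FiniteDimensional ℚ_[p] (CompletionAbove p w) := by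
  have : FiniteDimensional ℚ_[p] (∀ w : PlaceAbove F p, CompletionAbove p w) :=
    (tensorEquivProd p).toLinearEquiv.finiteDimensional
  exact Module.Finite.of_surjective (LinearMap.proj (R := ℚ_[p]) (φ := CompletionAbove p) w)
    (Function.surjective_eval w)

lemma localNorm_val (w : PlaceAbove F p) (x : Fˣ) :
    ((localNorm w.1 p w.2 x : ℚ_[p]ˣ) : ℚ_[p])
      = Algebra.norm ℚ_[p] (algebraMap F (CompletionAbove p w) x) := rfl

/-- The global norm is the product of the local norms. -/
lemma prod_localNorm (x : Fˣ) :
    ∏ w : PlaceAbove F p, ((localNorm w.1 p w.2 x : ℚ_[p]ˣ) : ℚ_[p]) = (Algebra.norm ℚ (x : F) : ℚ) := by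
  have h := Algebra.norm_eq_of_algEquiv (tensorEquivProd (F := F) p) ((1 : ℚ_[p]) ⊗ₜ[ℚ] (x : F))
  rw [norm_baseChange, norm_pi_dependent] at h
  rw [← eq_ratCast (algebraMap ℚ ℚ_[p]), ← h]
  refine Finset.prod_congr rfl fun w _ => ?_
  rw [localNorm_val]
  congr 1
  exact ((tensorToProd_tmul p 1 (x : F) w).trans (by simp)).symm

lemma natCast_completion_ne_zero (w : PlaceAbove F p) : (p : CompletionAbove p w) ≠ 0 := by
  rw [← map_natCast (algebraMap F (CompletionAbove p w))]
  exact (map_ne_zero _).2 (by exact_mod_cast (Fact.out : p.Prime).ne_zero)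

lemma norm_natCast_completion_lt_one (w : PlaceAbove F p) : ‖(p : CompletionAbove p w)‖ < 1 := by
  have := (FinitePlace.norm_lt_one_iff_mem F w.1 (p : 𝓞 F)).2 w.2
  rwa [map_natCast, map_natCast] at this

/-- The norm map is multiplicative and continuous, so `norm_map_eq_one_of_continuousAt` applies to
it. -/
lemma norm_localNorm_eq_one (w : PlaceAbove F p) (x : Fˣ)
    (hx : ‖algebraMap F (CompletionAbove p w) x‖ = 1) :
    ‖((localNorm w.1 p w.2 x : ℚ_[p]ˣ) : ℚ_[p])‖ = 1 :=
  norm_map_eq_one_of_continuousAt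
    ({ (Algebra.norm ℚ_[p] : CompletionAbove p w →* ℚ_[p]) with map_zero' := Algebra.norm_zero } :
      CompletionAbove p w →*₀ ℚ_[p])
    continuous_algebraNorm.continuousAt
    (c := (p : CompletionAbove p w)) (natCast_completion_ne_zero p w) (norm_natCast_completion_lt_one p w) hx

end localGlobal

/-! ### Divisors, fractional ideals and ideal norms. -/

section divisors
variable {F : Type*} [Field F] [NumberField F]

/-- A prime ideal as an invertible fractional ideal. -/
noncomputable def primeFractionalIdeal (v : HeightOneSpectrum (𝓞 F)) :
    (FractionalIdeal (nonZeroDivisors (𝓞 F)) F)ˣ :=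
  FractionalIdeal.mk0 F ⟨v.asIdeal, mem_nonZeroDivisors_of_ne_zero v.ne_bot⟩

variable (F) in
/-- The invertible fractional ideal `∏ v ^ (n_v)`. -/
noncomputable def idealOfDivisor :
    (HeightOneSpectrum (𝓞 F) →₀ ℤ) →+ Additive (FractionalIdeal (nonZeroDivisors (𝓞 F)) F)ˣ :=
  Finsupp.liftAddHom fun v => (zmultiplesHom _) (Additive.ofMul (primeFractionalIdeal v))

lemma idealOfDivisor_single (v : HeightOneSpectrum (𝓞 F)) (n : ℤ) :
    idealOfDivisor F (Finsupp.single v n) = n • Additive.ofMul (primeFractionalIdeal v) := by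
  simp [idealOfDivisor]

variable (F) in
/-- The divisor of an invertible fractional ideal. -/
noncomputable def divisorOfIdeal :
    Additive (FractionalIdeal (nonZeroDivisors (𝓞 F)) F)ˣ →+ (HeightOneSpectrum (𝓞 F) →₀ ℤ) where
  toFun I := Finsupp.ofSupportFinite
    (fun v => FractionalIdeal.count F v (I.toMul : FractionalIdeal (nonZeroDivisors (𝓞 F)) F))
    (FractionalIdeal.finite_factors _)
  map_zero' := by
    ext v
    simp [Finsupp.ofSupportFinite_coe, FractionalIdeal.count_one]
  map_add' I J := by
    ext v
    simp [Finsupp.ofSupportFinite_coe,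
      FractionalIdeal.count_mul F v I.toMul.ne_zero J.toMul.ne_zero]
    rfl

lemma divisorOfIdeal_apply (I : (FractionalIdeal (nonZeroDivisors (𝓞 F)) F)ˣ)
    (v : HeightOneSpectrum (𝓞 F)) : divisorOfIdeal F (Additive.ofMul I) v
      = FractionalIdeal.count F v (I : FractionalIdeal (nonZeroDivisors (𝓞 F)) F) := rfl

lemma divisorOfIdeal_idealOfDivisor (D : HeightOneSpectrum (𝓞 F) →₀ ℤ) :
    divisorOfIdeal F (idealOfDivisor F D) = D := by
  classical
  have : (divisorOfIdeal F).comp (idealOfDivisor F) = AddMonoidHom.id _ := by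
    refine Finsupp.addHom_ext fun v n => ?_
    ext w
    rw [AddMonoidHom.comp_apply, idealOfDivisor_single, map_zsmul, Finsupp.smul_apply,
      divisorOfIdeal_apply, primeFractionalIdeal, FractionalIdeal.coe_mk0,
      FractionalIdeal.count_maximal]
    simp [Finsupp.single_apply]
  exact DFunLike.congr_fun this D

lemma idealOfDivisor_divisorOfIdeal (I : Additive (FractionalIdeal (nonZeroDivisors (𝓞 F)) F)ˣ) :
    idealOfDivisor F (divisorOfIdeal F I) = I := by
  apply Additive.toMul.injective
  apply Units.ext
  conv_rhs => rw [← FractionalIdeal.finprod_heightOneSpectrum_factorization' F I.toMul.ne_zero]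
  rw [finprod_eq_prod_of_mulSupport_subset (s := (divisorOfIdeal F I).support)]
  · simp [idealOfDivisor, Finsupp.sum, primeFractionalIdeal, toMul_sum]
    rfl
  · intro v hv
    simp only [Finset.mem_coe, Finsupp.mem_support_iff]
    intro h
    refine hv ?_
    change FractionalIdeal.count F v _ = 0 at h
    simp [h]

variable (F) in
/-- The divisor of an element of `F^×`. -/
noncomputable def ordDivisor : Additive Fˣ →+ (HeightOneSpectrum (𝓞 F) →₀ ℤ) :=
  (divisorOfIdeal F).comp (MonoidHom.toAdditive (toPrincipalIdeal (𝓞 F) F))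

lemma idealOfDivisor_ordDivisor (x : Additive Fˣ) :
    idealOfDivisor F (ordDivisor F x) = Additive.ofMul (toPrincipalIdeal (𝓞 F) F x.toMul) :=
  idealOfDivisor_divisorOfIdeal _

/-- A homomorphism on ideals is determined by its values on primes. -/
lemma map_toPrincipalIdeal {A : Type*} [AddCommGroup A]
    (g : Additive (FractionalIdeal (nonZeroDivisors (𝓞 F)) F)ˣ →+ A) (x : Fˣ) :
    g (Additive.ofMul (toPrincipalIdeal (𝓞 F) F x))
      = (ordDivisor F (Additive.ofMul x)).sum fun v n =>
          n • g (Additive.ofMul (primeFractionalIdeal v)) := by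
  conv_lhs => rw [← toMul_ofMul x, ← idealOfDivisor_ordDivisor, ← AddMonoidHom.comp_apply,
    ← Finsupp.sum_single (ordDivisor F (Additive.ofMul x)), map_finsuppSum]
  refine Finsupp.sum_congr fun v _ => ?_
  rw [AddMonoidHom.comp_apply, idealOfDivisor_single, map_zsmul]

/-- The norm of an invertible fractional ideal. -/
noncomputable def idealNormUnit :
    Additive (FractionalIdeal (nonZeroDivisors (𝓞 F)) F)ˣ →+ Additive ℚˣ :=
  MonoidHom.toAdditive (Units.map (FractionalIdeal.absNorm (R := 𝓞 F) (K := F)).toMonoidHom)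

lemma idealNormUnit_val (I : (FractionalIdeal (nonZeroDivisors (𝓞 F)) F)ˣ) :
    ((idealNormUnit (Additive.ofMul I)).toMul : ℚ)
      = FractionalIdeal.absNorm (I : FractionalIdeal (nonZeroDivisors (𝓞 F)) F) := rfl

lemma absNorm_ne_zero (v : HeightOneSpectrum (𝓞 F)) : Ideal.absNorm v.asIdeal ≠ 0 :=
  (zero_lt_one.trans (HeightOneSpectrum.one_lt_absNorm v)).ne'

/-- The norm of a prime ideal as a unit of `ℚ`. -/
noncomputable def primeNormUnit (v : HeightOneSpectrum (𝓞 F)) : ℚˣ :=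
  Units.mk0 (Ideal.absNorm v.asIdeal : ℚ) (by exact_mod_cast absNorm_ne_zero v)

lemma idealNormUnit_prime (v : HeightOneSpectrum (𝓞 F)) :
    idealNormUnit (Additive.ofMul (primeFractionalIdeal v)) = Additive.ofMul (primeNormUnit v) := by
  apply Additive.toMul.injective
  apply Units.ext
  rw [idealNormUnit_val, primeFractionalIdeal, FractionalIdeal.coe_mk0,
    FractionalIdeal.coeIdeal_absNorm, primeNormUnit, toMul_ofMul, Units.val_mk0]

variable (F) in
/-- The global norm on units. -/
noncomputable def normUnit : Fˣ →* ℚˣ := Units.map (Algebra.norm ℚ)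

/-- An additive function of rational numbers vanishing at `-1`, evaluated at a norm. -/
lemma map_normUnit {A : Type*} [AddCommGroup A] (g : Additive ℚˣ →+ A)
    (hg : g (Additive.ofMul (-1)) = 0) (x : Fˣ) :
    g (Additive.ofMul (normUnit F x)) = (ordDivisor F (Additive.ofMul x)).sum fun v n =>
      n • g (Additive.ofMul (primeNormUnit v)) := by
  have h := map_toPrincipalIdeal (g.comp idealNormUnit) x
  simp only [AddMonoidHom.comp_apply, idealNormUnit_prime] at h
  rw [← h]
  have h1 : ((idealNormUnit (Additive.ofMul (toPrincipalIdeal (𝓞 F) F x))).toMul : ℚ)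
      = |Algebra.norm ℚ (x : F)| := by
    rw [idealNormUnit_val, coe_toPrincipalIdeal, FractionalIdeal.absNorm_span_singleton]
  -- The norm of the ideal (x) is |N(x)|; the lost sign is harmless since g vanishes at -1.
  rcases abs_choice (Algebra.norm ℚ (x : F)) with h2 | h2
  · congr 1
    apply Additive.toMul.injective
    apply Units.ext
    rw [h1, h2]; rfl
  · have : Additive.ofMul (normUnit F x) = Additive.ofMul (-1)
        + idealNormUnit (Additive.ofMul (toPrincipalIdeal (𝓞 F) F x)) := by
      apply Additive.toMul.injective
      apply Units.ext
      rw [toMul_add, Units.val_mul, h1, h2]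
      simp [normUnit]
    rw [this, map_add, hg, zero_add]

end divisors

/-! ### Orders, residue degrees and valuations of local norms. -/

section valuations
variable {F : Type*} [Field F] [NumberField F]

open Classical in
lemma ordDivisor_algebraMap (v : HeightOneSpectrum (𝓞 F)) (a : 𝓞 F) (x : Fˣ) (h : (x : F) = a) :
    ordDivisor F (Additive.ofMul x) v
      = (Associates.mk v.asIdeal).count (Associates.mk (Ideal.span {a})).factors := by
  have ha : a ≠ 0 := by
    rintro rfl
    simp at h
  rw [← FractionalIdeal.count_coe F v (J := Ideal.span {a}) (by simpa using ha),
    FractionalIdeal.coeIdeal_span_singleton, show algebraMap (𝓞 F) F a = x from h.symm, ← coe_toPrincipalIdeal]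
  rfl

lemma valuation_eq_exp_ordDivisor (v : HeightOneSpectrum (𝓞 F)) (x : Fˣ) :
    v.valuation F (x : F) = WithZero.exp (-(ordDivisor F (Additive.ofMul x) v)) := by
  classical
  have key : ∀ (a : 𝓞 F) (x : Fˣ), (x : F) = a →
      v.valuation F (x : F) = WithZero.exp (-(ordDivisor F (Additive.ofMul x) v)) := by
    intro a x h
    have ha : a ≠ 0 := by
      rintro rfl
      simp at h
    rw [ordDivisor_algebraMap v a x h, h]
    exact (HeightOneSpectrum.valuation_of_algebraMap v a).trans (v.intValuation_if_neg ha)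
  obtain ⟨a, b, hb, hab⟩ := IsFractionRing.div_surjective (A := 𝓞 F) (x : F)
  have hb0 : (b : F) ≠ 0 := by
    have := nonZeroDivisors.ne_zero hb
    exact_mod_cast this
  have ha0 : (a : F) ≠ 0 := by
    intro h0
    refine x.ne_zero ?_
    rw [← hab, show algebraMap (𝓞 F) F a = 0 from h0, zero_div]
  have hx : x = Units.mk0 (a : F) ha0 / Units.mk0 (b : F) hb0 := by
    ext
    simpa using hab.symm
  have h1 := key a (Units.mk0 (a : F) ha0) rfl
  have h2 := key b (Units.mk0 (b : F) hb0) rfl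
  rw [hx, Units.val_div_eq_div_val, map_div₀, h1, h2, ofMul_div, map_sub, Finsupp.sub_apply,
    ← WithZero.exp_sub]
  congr 1
  ring

lemma norm_eq_one_of_ordDivisor_eq_zero (v : HeightOneSpectrum (𝓞 F)) (x : Fˣ)
    (h : ordDivisor F (Additive.ofMul x) v = 0) : ‖algebraMap F (v.adicCompletion F) x‖ = 1 := by
  have h1 := FinitePlace.norm_embedding' v (x : F)
  rw [valuation_eq_exp_ordDivisor, h, neg_zero, WithZero.exp_zero, map_one] at h1
  exact h1

/-- An element of order `1` at `v` and of order `0` at finitely many given other primes. -/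
lemma exists_ordDivisor_eq_one (v : HeightOneSpectrum (𝓞 F)) (S : Finset (HeightOneSpectrum (𝓞 F))) :
    ∃ x : Fˣ, ordDivisor F (Additive.ofMul x) v = 1 ∧
      ∀ w ∈ S, w ≠ v → ordDivisor F (Additive.ofMul x) w = 0 := by
  classical
  obtain ⟨ϖ, hϖ⟩ := v.intValuation_exists_uniformizer
  -- The congruences are y ≡ ϖ modulo v² and y ≡ 1 modulo the squares of the other primes.
  obtain ⟨y, hy⟩ := IsDedekindDomain.exists_forall_sub_mem_ideal (s := insert v S)
    (fun w : HeightOneSpectrum (𝓞 F) => w.asIdeal) (fun _ => 2) (fun w _ => w.prime)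
    (fun w _ w' _ h h' => h (HeightOneSpectrum.ext h')) (fun w => if w.1 = v then ϖ else 1)
  have hv : v.intValuation y = WithZero.exp (-1 : ℤ) := by
    have h1 := hy v (Finset.mem_insert_self _ _)
    rw [if_pos rfl, ← v.intValuation_le_pow_iff_mem] at h1
    have h2 : v.intValuation (y - ϖ) < v.intValuation ϖ := by
      rw [hϖ]
      refine h1.trans_lt ?_
      rw [WithZero.exp_lt_exp]
      norm_num
    have h3 := Valuation.map_add_eq_of_lt_left _ h2
    rwa [add_sub_cancel, hϖ] at h3
  have hy0 : y ≠ 0 := by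
    rintro rfl
    rw [map_zero] at hv
    exact WithZero.exp_ne_zero hv.symm
  have hy0' : (y : F) ≠ 0 := by exact_mod_cast hy0
  refine ⟨Units.mk0 (y : F) hy0', ?_, fun w hw hwv => ?_⟩
  · have h := valuation_eq_exp_ordDivisor v (Units.mk0 (y : F) hy0')
    rw [Units.val_mk0, show v.valuation F (y : F) = _ from
      HeightOneSpectrum.valuation_of_algebraMap v y, hv, WithZero.exp_inj] at h
    linarith
  · have h1 := hy w (Finset.mem_insert_of_mem hw)
    rw [if_neg hwv] at h1
    have h2 : y ∉ w.asIdeal := by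
      intro hmem
      refine w.isPrime.ne_top ((Ideal.eq_top_iff_one _).2 ?_)
      have := Ideal.sub_mem _ hmem (Ideal.pow_le_self two_ne_zero h1)
      simpa using this
    have h := valuation_eq_exp_ordDivisor w (Units.mk0 (y : F) hy0')
    rw [Units.val_mk0, show w.valuation F (y : F) = _ from
      HeightOneSpectrum.valuation_of_algebraMap w y,
      HeightOneSpectrum.intValuation_eq_one_iff.2 h2, ← WithZero.exp_zero, WithZero.exp_inj] at h
    linarith

lemma absNorm_eq_pow_inertiaDeg (v : HeightOneSpectrum (𝓞 F)) (p : ℕ) [Fact p.Prime]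
    (hp : (p : 𝓞 F) ∈ v.asIdeal) :
    Ideal.absNorm v.asIdeal = p ^ v.asIdeal.inertiaDeg ℤ := by
  have := v.isPrime
  have hmax : (Ideal.span {(p : ℤ)}).IsMaximal :=
    ((Ideal.span_singleton_prime (by exact_mod_cast (Fact.out : p.Prime).ne_zero)).2
      (Nat.prime_iff_prime_int.1 Fact.out)).isMaximal
      (by simpa using (Fact.out : p.Prime).ne_zero)
  have : v.asIdeal.LiesOver (Ideal.span {(p : ℤ)}) := by
    refine ⟨hmax.eq_of_le (Ideal.IsPrime.ne_top inferInstance) ?_⟩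
    rw [Ideal.span_singleton_le_iff_mem, Ideal.mem_comap]
    simpa using hp
  simpa using (Ideal.natAbs_pow_inertiaDeg (p : ℤ) v.asIdeal).symm

lemma eq_residueChar {v : HeightOneSpectrum (𝓞 F)} {p : ℕ} [hp : Fact p.Prime]
    (h : (p : 𝓞 F) ∈ v.asIdeal) : p = residueChar v := by
  have h1 : ((p : ℕ) : 𝓞 F ⧸ v.asIdeal) = 0 := by
    rw [← map_natCast (Ideal.Quotient.mk v.asIdeal)]
    exact Ideal.Quotient.eq_zero_iff_mem.2 h
  have h2 : residueChar v ∣ p := ringChar.dvd h1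
  exact ((Nat.prime_dvd_prime_iff_eq (Fact.out : (residueChar v).Prime) hp.out).1 h2).symm

variable (p : ℕ) [Fact p.Prime]

/-- The `p`-adic valuation of rational numbers. -/
noncomputable def ratValuation : Additive ℚˣ →+ ℤ where
  toFun q := padicValRat p (q.toMul : ℚ)
  map_zero' := by simp
  map_add' a b := by simp [padicValRat.mul a.toMul.ne_zero b.toMul.ne_zero]

lemma valuation_localNorm_eq_zero (w : PlaceAbove F p) (x : Fˣ)
    (hx : ordDivisor F (Additive.ofMul x) w.1 = 0) :
    ((localNorm w.1 p w.2 x : ℚ_[p]ˣ) : ℚ_[p]).valuation = 0 := by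
  have h := norm_localNorm_eq_one p w x (norm_eq_one_of_ordDivisor_eq_zero w.1 x hx)
  rw [Padic.norm_eq_zpow_neg_valuation (Units.ne_zero _), zpow_eq_one_iff_right₀ (by positivity)
      (by exact_mod_cast (Fact.out : p.Prime).ne_one)] at h
  omega

lemma ratValuation_primeNormUnit (v : HeightOneSpectrum (𝓞 F)) (hv : (p : 𝓞 F) ∉ v.asIdeal) :
    ratValuation p (Additive.ofMul (primeNormUnit v)) = 0 := by
  have h : ¬ p ∣ Ideal.absNorm v.asIdeal := by
    rw [absNorm_eq_pow_inertiaDeg v (residueChar v) (residueChar_mem v)]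
    intro h
    have := (Nat.prime_dvd_prime_iff_eq (Fact.out : p.Prime) (Fact.out : (residueChar v).Prime)).1
      ((Fact.out : p.Prime).dvd_of_dvd_pow h)
    exact hv (this ▸ residueChar_mem v)
  simp [ratValuation, primeNormUnit, padicValNat.eq_zero_of_not_dvd h]

lemma ratValuation_primeNormUnit_of_mem (v : HeightOneSpectrum (𝓞 F)) (hv : (p : 𝓞 F) ∈ v.asIdeal) :
    ratValuation p (Additive.ofMul (primeNormUnit v)) = v.asIdeal.inertiaDeg ℤ := by
  simp [ratValuation, primeNormUnit, absNorm_eq_pow_inertiaDeg v p hv]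

/-- The valuation of a local norm is the residue degree times the order. -/
lemma valuation_localNorm (w : PlaceAbove F p) (x : Fˣ) :
    ((localNorm w.1 p w.2 x : ℚ_[p]ˣ) : ℚ_[p]).valuation
      = (w.1.asIdeal.inertiaDeg ℤ) * ordDivisor F (Additive.ofMul x) w.1 := by
  classical
  let g : PlaceAbove F p → Additive Fˣ →+ ℤ := fun w =>
    { toFun := fun x => ((localNorm w.1 p w.2 x.toMul : ℚ_[p]ˣ) : ℚ_[p]).valuation
      map_zero' := by simp
      map_add' := fun x y => by
        rw [toMul_add, map_mul, Units.val_mul,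
          Padic.valuation_mul (Units.ne_zero _) (Units.ne_zero _)] }
  -- The local norms of π at the other primes above p are units, so the valuation of its local norm
  -- at w is that of its global norm, which ideal norms compute.
  obtain ⟨π, h1, h2⟩ := exists_ordDivisor_eq_one w.1
    ((Finset.univ : Finset (PlaceAbove F p)).image Subtype.val)
  have h2' : ∀ w' : PlaceAbove F p, w' ≠ w → ordDivisor F (Additive.ofMul π) w'.1 = 0 :=
    fun w' hw' => h2 w'.1 (Finset.mem_image_of_mem _ (Finset.mem_univ _))
      (fun h => hw' (Subtype.ext h))
  have hπ : g w (Additive.ofMul π) = w.1.asIdeal.inertiaDeg ℤ := by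
    have h3 : ∑ w' : PlaceAbove F p, g w' (Additive.ofMul π)
        = ratValuation p (Additive.ofMul (normUnit F π)) := by
      have h4 := congrArg Padic.valuation (prod_localNorm p π)
      rw [Padic.valuation_ratCast] at h4
      refine Eq.trans ?_ h4
      have : ∀ s : Finset (PlaceAbove F p), ∑ w' ∈ s, g w' (Additive.ofMul π) = (∏ w' ∈ s,
          ((localNorm w'.1 p w'.2 π : ℚ_[p]ˣ) : ℚ_[p])).valuation := by
        intro s
        induction s using Finset.induction_on with
        | empty => simp
        | insert a s ha ih =>
          rw [Finset.sum_insert ha, Finset.prod_insert ha, Padic.valuation_mul (Units.ne_zero _)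
            (Finset.prod_ne_zero_iff.2 fun _ _ => Units.ne_zero _), ih]
          rfl
      exact this _
    rw [Finset.sum_eq_single w (fun w' _ hw' => show g w' (Additive.ofMul π) = 0 from valuation_localNorm_eq_zero p w' π (h2' w' hw'))
      (fun h => absurd (Finset.mem_univ _) h), map_normUnit (ratValuation p) (by simp [ratValuation])] at h3
    rw [h3, Finsupp.sum, Finset.sum_eq_single w.1, h1, one_smul,
      ratValuation_primeNormUnit_of_mem p _ w.2]
    · intro v _ hv
      by_cases hpv : (p : 𝓞 F) ∈ v.asIdeal
      · rw [h2' ⟨v, hpv⟩ (fun h => hv (congrArg Subtype.val h)), zero_smul]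
      · rw [ratValuation_primeNormUnit p v hpv, smul_zero]
    · intro h
      rw [Finsupp.notMem_support_iff] at h
      rw [h, zero_smul]
  set n := ordDivisor F (Additive.ofMul x) w.1 with hn
  -- The quotient x/π^n has order 0 at w, so its local norm is a unit.
  have h0 : g w (Additive.ofMul x - n • Additive.ofMul π) = 0 := by
    refine valuation_localNorm_eq_zero p w (Additive.ofMul x - n • Additive.ofMul π).toMul ?_
    rw [ofMul_toMul, map_sub, map_zsmul, Finsupp.sub_apply, Finsupp.smul_apply, h1, ← hn]
    simp
  rw [map_sub, map_zsmul, hπ, sub_eq_zero] at h0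
  change g w (Additive.ofMul x) = _
  rw [h0, smul_eq_mul, mul_comm]

end valuations

/-! ### The product formula. -/

section productFormula
variable {F : Type*} [Field F] [NumberField F] (l : ℕ) [Fact l.Prime]

/-- The Iwasawa logarithm on `ℚ^×`. -/
noncomputable def ratLog : Additive ℚˣ →+ ℚ_[l] :=
  (iwasawaLog l).comp (MonoidHom.toAdditive (Units.map (algebraMap ℚ ℚ_[l]).toMonoidHom))

lemma ratLog_neg_one : ratLog l (Additive.ofMul (-1)) = 0 := by
  rw [← iwasawaLog_neg_one l]
  simp only [ratLog, AddMonoidHom.comp_apply]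
  congr 1

lemma ratLog_primeNormUnit (v : HeightOneSpectrum (𝓞 F)) (p : ℕ) [Fact p.Prime]
    (hp : (p : 𝓞 F) ∈ v.asIdeal) : ratLog l (Additive.ofMul (primeNormUnit v))
      = (v.asIdeal.inertiaDeg ℤ) • iwasawaLog l (Additive.ofMul (primeUnit p l)) := by
  rw [← map_nsmul, ratLog, AddMonoidHom.comp_apply]
  congr 1
  apply Additive.toMul.injective
  ext
  simp [primeNormUnit, primeUnit, absNorm_eq_pow_inertiaDeg v p hp]

lemma ratLog_primeNormUnit_of_mem (v : HeightOneSpectrum (𝓞 F)) (hv : (l : 𝓞 F) ∈ v.asIdeal) :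
    ratLog l (Additive.ofMul (primeNormUnit v)) = 0 := by
  rw [ratLog_primeNormUnit l v l hv, iwasawaLog_prime, smul_zero]

lemma ratLog_normUnit (x : Fˣ) : ratLog l (Additive.ofMul (normUnit F x))
    = (ordDivisor F (Additive.ofMul x)).sum fun v n =>
      n • ratLog l (Additive.ofMul (primeNormUnit v)) :=
  map_normUnit _ (ratLog_neg_one l) x

lemma logLocalNorm_of_mem (v : HeightOneSpectrum (𝓞 F)) (hv : (l : 𝓞 F) ∈ v.asIdeal) (x : Fˣ) :
    logLocalNorm v l (Additive.ofMul x) = iwasawaLog l (Additive.ofMul (localNorm v l hv x)) := by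
  simp [logLocalNorm, hv]

lemma logLocalNorm_of_notMem (v : HeightOneSpectrum (𝓞 F)) (hv : (l : 𝓞 F) ∉ v.asIdeal) (x : Fˣ) :
    logLocalNorm v l (Additive.ofMul x)
      = - (((v.asIdeal.inertiaDeg ℤ) * ordDivisor F (Additive.ofMul x) v : ℤ) •
        iwasawaLog l (Additive.ofMul (primeUnit (residueChar v) l))) := by
  rw [← neg_smul, ← map_zsmul, ← ofMul_zpow, ← valuation_localNorm (residueChar v) ⟨v, residueChar_mem v⟩ x]
  simp [logLocalNorm, hv, padicAbs]

lemma logLocalNorm_of_notMem' (v : HeightOneSpectrum (𝓞 F)) (hv : (l : 𝓞 F) ∉ v.asIdeal) (x : Fˣ) :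
    logLocalNorm v l (Additive.ofMul x)
      = - (ordDivisor F (Additive.ofMul x) v • ratLog l (Additive.ofMul (primeNormUnit v))) := by
  rw [logLocalNorm_of_notMem l v hv, ratLog_primeNormUnit l v _ (residueChar_mem v),
    ← natCast_zsmul, smul_smul, mul_comm]

lemma iwasawaLog_ratNorm (x : Fˣ) : ∑ w : PlaceAbove F l,
    logLocalNorm w.1 l (Additive.ofMul x) = ratLog l (Additive.ofMul (normUnit F x)) := by
  simp_rw [fun w : PlaceAbove F l => logLocalNorm_of_mem l w.1 w.2 x]
  rw [← map_sum, ratLog, AddMonoidHom.comp_apply, ← ofMul_prod]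
  congr 1
  apply Additive.toMul.injective
  ext
  simpa [normUnit] using prod_localNorm l x

variable (F) in
open Classical in
/-- The primes above `ℓ`. -/
noncomputable def primesAbove : Finset (HeightOneSpectrum (𝓞 F)) :=
  (Finset.univ : Finset (PlaceAbove F l)).image Subtype.val

lemma mem_primesAbove (v : HeightOneSpectrum (𝓞 F)) :
    v ∈ primesAbove F l ↔ (l : 𝓞 F) ∈ v.asIdeal := by
  simp [primesAbove]

/-- The product formula for logarithmic valuations. -/
lemma sum_logLocalNorm (x : Fˣ) (S : Finset (HeightOneSpectrum (𝓞 F)))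
    (hS : primesAbove F l ⊆ S) (hx : (ordDivisor F (Additive.ofMul x)).support ⊆ S) :
    ∑ v ∈ S, logLocalNorm v l (Additive.ofMul x) = 0 := by
  classical
  have h1 : ∑ v ∈ primesAbove F l, logLocalNorm v l (Additive.ofMul x)
      = ratLog l (Additive.ofMul (normUnit F x)) := by
    rw [primesAbove, Finset.sum_image (fun _ _ _ _ h => Subtype.ext h), iwasawaLog_ratNorm]
  have h2 : ∑ v ∈ S, ordDivisor F (Additive.ofMul x) v • ratLog l (Additive.ofMul (primeNormUnit v))
      = ratLog l (Additive.ofMul (normUnit F x)) := by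
    rw [ratLog_normUnit, Finsupp.sum]
    refine (Finset.sum_subset hx fun v _ hv => ?_).symm
    rw [Finsupp.notMem_support_iff.1 hv, zero_smul]
  -- The primes above ℓ drop out of the factorization of N(x): their norms are powers of ℓ, and
  -- Log_ℓ ℓ = 0.
  have h3 : ∑ v ∈ S \ primesAbove F l, ordDivisor F (Additive.ofMul x) v •
      ratLog l (Additive.ofMul (primeNormUnit v)) = ratLog l (Additive.ofMul (normUnit F x)) := by
    rw [← h2, ← Finset.sum_sdiff hS, left_eq_add]
    refine Finset.sum_eq_zero fun v hv => ?_
    rw [ratLog_primeNormUnit_of_mem l v ((mem_primesAbove l v).1 hv), smul_zero]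
  rw [← Finset.sum_sdiff hS, h1, ← h3, ← Finset.sum_add_distrib]
  refine Finset.sum_eq_zero fun v hv => ?_
  rw [logLocalNorm_of_notMem' l v (fun h => (Finset.mem_sdiff.1 hv).2 ((mem_primesAbove l v).2 h))]
  simp

end productFormula

/-! ### Nonvanishing of the degrees, and ṽ_v away from ℓ. -/

section degrees

lemma finiteDimensional_of_le {k Ω : Type*} [Field k] [Field Ω] [Algebra k Ω]
    {A B : IntermediateField k Ω} (h : A ≤ B) [FiniteDimensional k B] : FiniteDimensional k A :=
  FiniteDimensional.of_injective (IntermediateField.inclusion h).toLinearMap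
    (fun _ _ h' => (IntermediateField.inclusion h).injective h')

instance finiteDimensional_fieldRange {k E Ω : Type*} [Field k] [Field E] [Field Ω] [Algebra k E]
    [Algebra k Ω] [FiniteDimensional k E] (f : E →ₐ[k] Ω) : FiniteDimensional k f.fieldRange :=
  inferInstanceAs (FiniteDimensional k f.toLinearMap.range)

lemma cyclotomicInertiaDegree_ne_zero (k E : Type*) [Field k] [Field E] [Algebra k E]
    [FiniteDimensional k E] : cyclotomicInertiaDegree k E ≠ 0 := by
  have := finiteDimensional_of_le (inf_le_left : (IsScalarTower.toAlgHom k E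
    (AlgebraicClosure E)).fieldRange ⊓ cyclotomicZHatExtension k (AlgebraicClosure E) ≤ _)
  exact Module.finrank_pos.ne'

variable {F : Type*} [Field F] [NumberField F] (v : HeightOneSpectrum (𝓞 F))

lemma logInertiaDegree_ne_zero : logInertiaDegree v ≠ 0 := by
  let := completionAlgebra v (residueChar v) (residueChar_mem v)
  have : FiniteDimensional ℚ_[residueChar v] (v.adicCompletion F) :=
    finiteDimensional_completionAbove (residueChar v) ⟨v, residueChar_mem v⟩
  exact cyclotomicInertiaDegree_ne_zero _ _

variable (l : ℕ) [Fact l.Prime]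

lemma primeDegree_ne_zero (p : ℕ) [Fact p.Prime] : primeDegree p l ≠ 0 := by
  unfold primeDegree
  split_ifs with h h2
  · norm_num
  · exact_mod_cast (Fact.out : l.Prime).ne_zero
  · exact iwasawaLog_primeUnit_ne_zero l p h

lemma placeDegree_ne_zero : placeDegree v l ≠ 0 :=
  mul_ne_zero (by exact_mod_cast logInertiaDegree_ne_zero v) (primeDegree_ne_zero l _)

lemma logValuation_tmul (z : ℤ_[l]) (x : Additive Fˣ) :
    logValuation v l (z ⊗ₜ x) = z * (-(placeDegree v l)⁻¹ * logLocalNorm v l x) := by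
  simp [logValuation, Algebra.smul_def]

/-- Both the logarithm of the local norm and deg_F v contain Log_ℓ p; it cancels and leaves ord_v
times f_v / f̃_v. -/
lemma logValuation_tmul_of_notMem (hv : (l : 𝓞 F) ∉ v.asIdeal) (z : ℤ_[l]) (x : Additive Fˣ) :
    logValuation v l (z ⊗ₜ x) = indexRatio v l * (z * (ordDivisor F x v : ℤ)) := by
  have h : residueChar v ≠ l := by
    rintro h
    exact hv (h ▸ residueChar_mem v)
  have h1 := primeDegree_ne_zero l (residueChar v)
  have h2 : (logInertiaDegree v : ℚ_[l]) ≠ 0 := by exact_mod_cast logInertiaDegree_ne_zero v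
  rw [logValuation_tmul, ← ofMul_toMul x, logLocalNorm_of_notMem l v hv, indexRatio, placeDegree]
  have h3 : primeDegree (residueChar v) l
      = iwasawaLog l (Additive.ofMul (primeUnit (residueChar v) l)) := by
    rw [primeDegree, if_neg h]
  rw [← h3, zsmul_eq_mul]
  push_cast
  field_simp

end degrees

/-! ### Galois theory of the cyclotomic ℤ_q- and Ẑ-extensions. -/

section cyclotomicTower
variable (k Ω : Type*) [Field k] [Field Ω] [Algebra k Ω] [CharZero k] [IsAlgClosed Ω]
  [Algebra.IsAlgebraic k Ω]

lemma charZero_of_algebra (k Ω : Type*) [Field k] [Field Ω] [Algebra k Ω] [CharZero k] : CharZero Ω :=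
  charZero_of_injective_algebraMap (algebraMap k Ω).injective

lemma exists_isPrimitiveRoot_of_isAlgClosed (Ω : Type*) [Field Ω] [IsAlgClosed Ω] [CharZero Ω]
    {n : ℕ} (hn : n ≠ 0) : ∃ r : Ω, IsPrimitiveRoot r n := by
  have : NeZero (n : Ω) := ⟨by exact_mod_cast hn⟩
  exact HasEnoughRootsOfUnity.exists_primitiveRoot Ω n

lemma isCyclotomicExtension_primePowerCyclotomic (q : ℕ) [Fact q.Prime] :
    IsCyclotomicExtension (Set.range fun n : ℕ => q ^ n) k (primePowerCyclotomic k Ω q) := by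
  have := charZero_of_algebra k Ω
  have h := IntermediateField.isCyclotomicExtension_adjoin_of_exists_isPrimitiveRoot
    (Set.range fun n : ℕ => q ^ n) k Ω (fun n _ h => exists_isPrimitiveRoot_of_isAlgClosed Ω h)
  have e : {b : Ω | ∃ n ∈ (Set.range fun n : ℕ => q ^ n), n ≠ 0 ∧ b ^ n = 1}
      = {z : Ω | ∃ n : ℕ, z ^ q ^ n = 1} := by
    ext z
    constructor
    · rintro ⟨_, ⟨n, rfl⟩, -, h⟩
      exact ⟨n, h⟩
    · rintro ⟨n, h⟩
      exact ⟨_, ⟨n, rfl⟩, pow_ne_zero _ (Fact.out : q.Prime).ne_zero, h⟩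
  rw [e] at h
  exact h

instance isAbelianGalois_primePowerCyclotomic (q : ℕ) [Fact q.Prime] :
    IsAbelianGalois k (primePowerCyclotomic k Ω q) :=
  have := isCyclotomicExtension_primePowerCyclotomic k Ω q
  IsCyclotomicExtension.isAbelianGalois (Set.range fun n : ℕ => q ^ n) _ _

lemma isGalois_of_isAlgClosed : IsGalois k Ω := by
  have : IsAlgClosure k Ω := ⟨inferInstance, inferInstance⟩
  have : Normal k Ω := IsAlgClosure.normal k Ω
  exact ⟨⟩

variable {k Ω}

lemma setOf_apply_eq_mem_nhds {K : Type*} [Field K] [Algebra k K] [Algebra.IsAlgebraic k K]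
    (s : Gal(K/k)) (x : K) : {g : Gal(K/k) | g x = s x} ∈ nhds s := by
  have h : IsOpen ((fun g : Gal(K/k) => s⁻¹ * g) ⁻¹' (MulAction.stabilizer Gal(K/k) x)) :=
    (stabilizer_isOpen_of_isIntegral x).preimage (continuous_const.mul continuous_id)
  refine Filter.mem_of_superset (h.mem_nhds ?_) ?_
  · change s⁻¹ * s ∈ MulAction.stabilizer _ x
    rw [inv_mul_cancel]
    exact one_mem _
  · intro g hg
    have : (s⁻¹ * g) x = x := hg
    rw [AlgEquiv.mul_apply] at this
    have := congrArg s this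
    rwa [← AlgEquiv.mul_apply, mul_inv_cancel, AlgEquiv.one_apply] at this

/-- Automorphisms that tend to torsion automorphisms of `k(μ_{q^∞})` fix infinitely often each
element of the cyclotomic `ℤ_q`-extension. -/
lemma frequently_fixed_of_eventually_pow_fixed {q : ℕ} [Fact q.Prime] (t : ℕ → Gal(Ω/k)) {r : ℕ}
    (hr : 0 < r)
    (ht : ∀ N : ℕ, ∀ᶠ j in Filter.atTop, ∀ z : Ω, z ^ q ^ N = 1 → (t j ^ r) z = z) {x : Ω}
    (hx : x ∈ cyclotomicZqExtension k Ω q) : ∃ᶠ j in Filter.atTop, t j x = x := by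
  let K := primePowerCyclotomic k Ω q
  let u : ℕ → Gal(K/k) := fun j => AlgEquiv.restrictNormalHom K (t j)
  have hu : ∀ j (y : K), ((u j y : K) : Ω) = t j y := fun j y =>
    AlgEquiv.restrictNormal_commutes (t j) K y
  -- By compactness the restrictions cluster at some s. Once s^r = 1 is known, s fixes the
  -- cyclotomic ℤ_q-extension, and u j agrees with s on x infinitely often.
  obtain ⟨s, hs⟩ := exists_clusterPt_of_compactSpace (Filter.map u Filter.atTop)
  have hs' : ∀ y : K, ∃ᶠ j in Filter.atTop, u j y = s y := fun y =>
    MapClusterPt.frequently (u := u) hs (setOf_apply_eq_mem_nhds s y)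
  have := isCyclotomicExtension_primePowerCyclotomic k Ω q
  have hsr : s ^ r = 1 := by
    refine IsCyclotomicExtension.algEquiv_eq_of_apply_eq (Set.range fun n : ℕ => q ^ n) k K ?_
    rintro _ ⟨N, rfl⟩ -
    obtain ⟨z, hz⟩ := this.exists_isPrimitiveRoot ⟨N, rfl⟩ (pow_ne_zero _ (Fact.out : q.Prime).ne_zero)
    refine ⟨z, hz, ?_⟩
    -- For this j both s⁻¹ u_j and u_j^r fix z; as the group is abelian, so does s^r.
    obtain ⟨j, h1, h2⟩ := ((hs' z).and_eventually (ht N)).exists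
    have hc : Commute s⁻¹ (u j) := mul_comm' _ _
    have h3 : s⁻¹ * u j ∈ MulAction.stabilizer Gal(K/k) z := by
      change (s⁻¹ * u j) z = z
      rw [AlgEquiv.mul_apply, h1, ← AlgEquiv.mul_apply, inv_mul_cancel, AlgEquiv.one_apply]
    have h4 : u j ^ r ∈ MulAction.stabilizer Gal(K/k) z := by
      refine Subtype.ext (Eq.trans ?_ (h2 z ?_))
      · change (((u j ^ r) z : K) : Ω) = _
        rw [← map_pow]
        exact AlgEquiv.restrictNormal_commutes (t j ^ r) K z
      · exact congrArg Subtype.val hz.pow_eq_one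
    have h5 := pow_mem h3 r
    rw [hc.mul_pow, Subgroup.mul_mem_cancel_right _ h4, inv_pow, inv_mem_iff] at h5
    exact h5
  have hxK : x ∈ K := IntermediateField.lift_le _ hx
  have hxs : s ⟨x, hxK⟩ = ⟨x, hxK⟩ := by
    have h := (IntermediateField.mem_lift (⟨x, hxK⟩ : K)).1 hx
    exact h ⟨s, Subgroup.subset_closure (isOfFinOrder_iff_pow_eq_one.2 ⟨r, hr, hsr⟩)⟩
  refine (hs' ⟨x, hxK⟩).mono fun j hj => ?_
  rw [← hu j ⟨x, hxK⟩, hj, hxs]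

lemma pow_eq_pow_iff_of_isPrimitiveRoot {R : Type*} [Field R] {w : R} {n : ℕ} (hn : n ≠ 0)
    (hw : IsPrimitiveRoot w n) {a b : ℕ} : w ^ a = w ^ b ↔ a ≡ b [MOD n] := by
  have h : IsUnit w := hw.isUnit hn
  have h0 : IsOfFinOrder w := isOfFinOrder_iff_pow_eq_one.2 ⟨n, Nat.pos_of_ne_zero hn, hw.pow_eq_one⟩
  rw [h0.pow_eq_pow_iff_modEq, ← hw.eq_orderOf]

lemma exists_apply_eq_pow (t : Gal(Ω/k)) {n : ℕ} (hn : n ≠ 0) {w : Ω} (hw : IsPrimitiveRoot w n) :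
    ∃ a : ℕ, a.Coprime n ∧ ∀ i : ℕ, (t ^ i) w = w ^ a ^ i := by
  have := NeZero.mk hn
  have h := hw.map_of_injective t.injective
  obtain ⟨a, -, ha, h1⟩ := hw.isPrimitiveRoot_iff.1 h
  refine ⟨a, ha, fun i => ?_⟩
  induction i with
  | zero => simp
  | succ i ih => rw [pow_succ', AlgEquiv.mul_apply, ih, map_pow, ← h1, ← pow_mul, pow_succ']

lemma pow_totient_apply (t : Gal(Ω/k)) {n : ℕ} (hn : n ≠ 0) {z : Ω} (hz : z ^ n = 1) :
    (t ^ n.totient) z = z := by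
  have := charZero_of_algebra k Ω
  obtain ⟨w, hw⟩ := exists_isPrimitiveRoot_of_isAlgClosed Ω hn
  have := NeZero.mk hn
  obtain ⟨b, -, rfl⟩ := hw.eq_pow_of_pow_eq_one hz
  obtain ⟨a, ha, h⟩ := exists_apply_eq_pow t hn hw
  have h1 := Nat.ModEq.pow_totient ha
  rw [map_pow, h, (pow_eq_pow_iff_of_isPrimitiveRoot hn hw).2 h1, pow_one]

/-- An automorphism acts on the cyclotomic `ℤ_q`-extension with orbits of `q`-power length. -/
lemma exists_pow_prime_pow_fixed {q : ℕ} [Fact q.Prime] (t : Gal(Ω/k)) {x : Ω}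
    (hx : x ∈ cyclotomicZqExtension k Ω q) : ∃ j : ℕ, (t ^ q ^ j) x = x := by
  have hq := (Fact.out : q.Prime)
  -- For t_j = t^(q^j) the exponent r = q - 1 works: φ(q^N) divides q^j (q - 1) as soon as j ≥ N.
  refine (frequently_fixed_of_eventually_pow_fixed (fun j => t ^ q ^ j)
    (Nat.sub_pos_of_lt hq.one_lt) (fun N => ?_) hx).exists
  filter_upwards [Filter.eventually_ge_atTop N] with j hj z hz
  obtain ⟨c, hc⟩ : (q ^ N).totient ∣ q ^ j * (q - 1) := by
    rcases Nat.eq_zero_or_pos N with rfl | hN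
    · simp
    · rw [Nat.totient_prime_pow hq hN]
      exact mul_dvd_mul_right (pow_dvd_pow q (by omega)) _
  have h := pow_totient_apply t (pow_ne_zero N hq.ne_zero) hz
  rw [← pow_mul, hc, pow_mul]
  exact pow_mem (S := MulAction.stabilizer Gal(Ω/k) z) h c

lemma mem_iff_forall_fixingSubgroup (L : IntermediateField k Ω) (x : Ω) :
    x ∈ L ↔ ∀ t : Gal(Ω/k), (∀ y ∈ L, t y = y) → t x = x := by
  have := isGalois_of_isAlgClosed (k := k) (Ω := Ω)
  constructor
  · exact fun hx t ht => ht x hx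
  · intro h
    rw [← InfiniteGalois.fixedField_fixingSubgroup L]
    exact fun t => h t fun y hy => t.2 ⟨y, hy⟩

lemma mem_adjoin_simple_iff (w x : Ω) :
    x ∈ IntermediateField.adjoin k {w} ↔ ∀ t : Gal(Ω/k), t w = w → t x = x := by
  rw [mem_iff_forall_fixingSubgroup]
  refine forall_congr' fun t => imp_congr_left ⟨fun h => h w (IntermediateField.mem_adjoin_simple_self k w),
    fun h y hy => ?_⟩
  induction hy using IntermediateField.adjoin_induction with
  | mem x hx => rw [Set.mem_singleton_iff.1 hx, h]
  | algebraMap x => exact t.commutes x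
  | add x y _ _ hx hy => rw [map_add, hx, hy]
  | inv x _ hx => rw [map_inv₀, hx]
  | mul x y _ _ hx hy => rw [map_mul, hx, hy]

/-- The elements fixed by a power of `t` prime to `l`. -/
def fixedByCoprimePower (l : ℕ) (t : Gal(Ω/k)) : IntermediateField k Ω where
  carrier := {x | ∃ m : ℕ, m.Coprime l ∧ (t ^ m) x = x}
  mul_mem' := by
    rintro a b ⟨m, hm, h1⟩ ⟨n, hn, h2⟩
    refine ⟨m * n, hm.mul_left hn, ?_⟩
    have h1' : (t ^ (m * n)) a = a := by
      rw [pow_mul]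
      exact pow_mem (S := MulAction.stabilizer Gal(Ω/k) a) h1 n
    have h2' : (t ^ (m * n)) b = b := by
      rw [mul_comm, pow_mul]
      exact pow_mem (S := MulAction.stabilizer Gal(Ω/k) b) h2 m
    rw [map_mul, h1', h2']
  add_mem' := by
    rintro a b ⟨m, hm, h1⟩ ⟨n, hn, h2⟩
    refine ⟨m * n, hm.mul_left hn, ?_⟩
    have h1' : (t ^ (m * n)) a = a := by
      rw [pow_mul]
      exact pow_mem (S := MulAction.stabilizer Gal(Ω/k) a) h1 n
    have h2' : (t ^ (m * n)) b = b := by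
      rw [mul_comm, pow_mul]
      exact pow_mem (S := MulAction.stabilizer Gal(Ω/k) b) h2 m
    rw [map_add, h1', h2']
  algebraMap_mem' a := ⟨1, Nat.coprime_one_left l, AlgEquiv.commutes _ a⟩
  inv_mem' := by
    rintro a ⟨m, hm, h⟩
    exact ⟨m, hm, by rw [map_inv₀, h]⟩

/-- The field of elements fixed by a prime-to-ℓ power of t contains each cyclotomic ℤ_q-extension:
for q = ℓ by hypothesis, for q ≠ ℓ because the orbits of t have q-power length. -/
lemma exists_coprime_pow_fixed {l : ℕ} [Fact l.Prime] (t : Gal(Ω/k))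
    (ht : ∀ y ∈ cyclotomicZqExtension k Ω l, t y = y) {x : Ω}
    (hx : x ∈ cyclotomicZHatExtension k Ω) : ∃ m : ℕ, m.Coprime l ∧ (t ^ m) x = x := by
  have h : cyclotomicZHatExtension k Ω ≤ fixedByCoprimePower l t := by
    refine iSup_le fun q y hy => ?_
    have := Fact.mk q.2
    by_cases hq : (q : ℕ) = l
    · rw [hq] at hy
      exact ⟨1, Nat.coprime_one_left l, by rw [pow_one, ht y hy]⟩
    · obtain ⟨j, hj⟩ := exists_pow_prime_pow_fixed t hy
      exact ⟨(q : ℕ) ^ j, Nat.Coprime.pow_left j ((Nat.coprime_primes q.2 Fact.out).2 hq), hj⟩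
  exact h hx

lemma isAbelianGalois_of_le_cyclotomicZHatExtension {X : IntermediateField k Ω}
    (hX : X ≤ cyclotomicZHatExtension k Ω) : IsAbelianGalois k X := by
  have := charZero_of_algebra k Ω
  have h := IntermediateField.isCyclotomicExtension_adjoin_of_exists_isPrimitiveRoot
    Set.univ k Ω (fun n _ h => exists_isPrimitiveRoot_of_isAlgClosed Ω h)
  have := IsCyclotomicExtension.isAbelianGalois Set.univ k
    (IntermediateField.adjoin k {b : Ω | ∃ n ∈ Set.univ, n ≠ 0 ∧ b ^ n = 1})
  have hle : X ≤ IntermediateField.adjoin k {b : Ω | ∃ n ∈ Set.univ, n ≠ 0 ∧ b ^ n = 1} := by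
    refine hX.trans (iSup_le fun q => (IntermediateField.lift_le _).trans ?_)
    refine IntermediateField.adjoin.mono _ _ _ ?_
    rintro z ⟨n, hz⟩
    exact ⟨_, Set.mem_univ _, pow_ne_zero n q.2.ne_zero, hz⟩
  exact IsAbelianGalois.of_algHom (IntermediateField.inclusion hle)

lemma exists_subgroup_index_eq (G : Type*) [Group G] [Finite G] [IsMulCommutative G] (l : ℕ) [Fact l.Prime] :
    ∃ H : Subgroup G, H.index = l ^ (Nat.card G).factorization l := by
  let P : Sylow l G := default
  have : (P : Subgroup G).Normal := ⟨fun n hn g => by rwa [mul_comm' g n, mul_inv_cancel_right]⟩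
  obtain ⟨H, hH⟩ := Subgroup.exists_right_complement'_of_coprime (N := (P : Subgroup G)) P.card_coprime_index
  refine ⟨H, ?_⟩
  rw [← P.card_eq_multiplicity]
  have h1 := hH.card_mul_card
  rw [← H.card_mul_index, mul_comm] at h1
  exact (Nat.eq_of_mul_eq_mul_left Nat.card_pos h1).symm

/-- The `l`-part of a finite subextension of `k^c` lies in the cyclotomic `ℤ_l`-extension. -/
lemma exists_le_cyclotomicZqExtension (l : ℕ) [Fact l.Prime] {X : IntermediateField k Ω}
    [FiniteDimensional k X] (hX : X ≤ cyclotomicZHatExtension k Ω) :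
    ∃ M : IntermediateField k Ω, M ≤ X ∧ M ≤ cyclotomicZqExtension k Ω l ∧
      Module.finrank k M = l ^ (Module.finrank k X).factorization l := by
  have := isAbelianGalois_of_le_cyclotomicZHatExtension hX
  -- H is a complement of the Sylow ℓ-subgroup, so its fixed field has degree the ℓ-part of [X : k].
  obtain ⟨H, hH⟩ := exists_subgroup_index_eq Gal(X/k) l
  rw [IsGalois.card_aut_eq_finrank] at hH
  have hM : Module.finrank k (IntermediateField.fixedField H)
      = l ^ (Module.finrank k X).factorization l := by
    rw [← hH]
    have h1 := Module.finrank_mul_finrank k (IntermediateField.fixedField H) X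
    rw [IntermediateField.finrank_fixedField_eq_card, ← IsGalois.card_aut_eq_finrank k X, mul_comm,
      ← H.card_mul_index] at h1
    exact Nat.eq_of_mul_eq_mul_left Nat.card_pos h1
  have hM' : Module.finrank k (IntermediateField.lift (IntermediateField.fixedField H))
      = l ^ (Module.finrank k X).factorization l := by
    rw [← hM]
    exact (IntermediateField.liftAlgEquiv _).symm.toLinearEquiv.finrank_eq
  refine ⟨_, IntermediateField.lift_le _, fun x hx => ?_, hM'⟩
  rw [mem_iff_forall_fixingSubgroup]
  intro t ht
  -- A prime-to-ℓ power of t fixes x; an ℓ-power of t fixes it too, since [M : k] is a power of ℓ.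
  -- Hence t fixes x.
  obtain ⟨m, hm, h1⟩ := exists_coprime_pow_fixed t ht (hX (IntermediateField.lift_le _ hx))
  set M := IntermediateField.lift (IntermediateField.fixedField H) with hMdef
  have : IsAbelianGalois k M :=
    isAbelianGalois_of_le_cyclotomicZHatExtension ((IntermediateField.lift_le _).trans hX)
  have : FiniteDimensional k M := FiniteDimensional.of_finrank_pos (by
    rw [hM']; exact pow_pos (Fact.out : l.Prime).pos _)
  have h2 : (t ^ l ^ (Module.finrank k X).factorization l) x = x := by
    have h3 : (AlgEquiv.restrictNormalHom M t) ^ l ^ (Module.finrank k X).factorization l = 1 := by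
      rw [← hM', ← IsGalois.card_aut_eq_finrank]
      exact pow_card_eq_one'
    rw [← map_pow] at h3
    have h4 := AlgEquiv.restrictNormal_commutes
      (t ^ l ^ (Module.finrank k X).factorization l) M ⟨x, hx⟩
    exact h4.symm.trans (congrArg (fun g : Gal(M/k) => ((g ⟨x, hx⟩ : M) : Ω)) h3)
  have h5 : t ^ Nat.gcd m (l ^ (Module.finrank k X).factorization l)
      ∈ MulAction.stabilizer Gal(Ω/k) x := by
    rw [← zpow_natCast, Nat.gcd_eq_gcd_ab, zpow_add, zpow_mul, zpow_mul, zpow_natCast, zpow_natCast]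
    exact mul_mem (zpow_mem (S := Subgroup Gal(Ω/k)) h1 _) (zpow_mem (S := Subgroup Gal(Ω/k)) h2 _)
  rw [Nat.Coprime.pow_right _ hm, pow_one] at h5
  exact h5

/-- A finite subextension of `k(μ_{q^∞})` is determined by the action on `μ_{q^N}` for some `N`. -/
lemma exists_level {q : ℕ} [Fact q.Prime] {M : IntermediateField k Ω} [FiniteDimensional k M]
    (hM : M ≤ primePowerCyclotomic k Ω q) :
    ∃ N : ℕ, ∀ t : Gal(Ω/k), (∀ z : Ω, z ^ q ^ N = 1 → t z = z) → ∀ y ∈ M, t y = y := by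
  have h1 : ∀ y ∈ primePowerCyclotomic k Ω q,
      ∃ N : ℕ, ∀ t : Gal(Ω/k), (∀ z : Ω, z ^ q ^ N = 1 → t z = z) → t y = y := by
    have hmono : ∀ {a b : ℕ}, a ≤ b → ∀ z : Ω, z ^ q ^ a = 1 → z ^ q ^ b = 1 := by
      intro a b hab z hz
      obtain ⟨c, hc⟩ := pow_dvd_pow q hab
      rw [hc, pow_mul, hz, one_pow]
    intro y hy
    induction hy using IntermediateField.adjoin_induction with
    | mem x hx =>
      obtain ⟨N, hN⟩ := hx
      exact ⟨N, fun t ht => ht x hN⟩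
    | algebraMap x => exact ⟨0, fun t _ => t.commutes x⟩
    | add x y _ _ hx hy =>
      obtain ⟨a, ha⟩ := hx
      obtain ⟨b, hb⟩ := hy
      exact ⟨max a b, fun t ht => by
        rw [map_add, ha t fun z hz => ht z (hmono (le_max_left _ _) z hz),
          hb t fun z hz => ht z (hmono (le_max_right _ _) z hz)]⟩
    | inv x _ hx =>
      obtain ⟨a, ha⟩ := hx
      exact ⟨a, fun t ht => by rw [map_inv₀, ha t ht]⟩
    | mul x y _ _ hx hy =>
      obtain ⟨a, ha⟩ := hx
      obtain ⟨b, hb⟩ := hy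
      exact ⟨max a b, fun t ht => by
        rw [map_mul, ha t fun z hz => ht z (hmono (le_max_left _ _) z hz),
          hb t fun z hz => ht z (hmono (le_max_right _ _) z hz)]⟩
  let b := Module.finBasis k M
  choose N hN using fun i => h1 (b i) (hM (b i).2)
  refine ⟨Finset.univ.sup N, fun t ht y hy => ?_⟩
  have hb : t.toLinearMap ∘ₗ M.val.toLinearMap = M.val.toLinearMap := by
    refine b.ext fun i => hN i t fun z hz => ht z ?_
    obtain ⟨c, hc⟩ := pow_dvd_pow q (Finset.le_sup (f := N) (Finset.mem_univ i))
    rw [hc, pow_mul, hz, one_pow]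
  exact LinearMap.congr_fun hb ⟨y, hy⟩

/-- If complex conjugations exist, a finite subextension of the cyclotomic `ℤ_l`-extension lies
in the real subfields of high cyclotomic fields. -/
lemma exists_le_adjoin_add_inv {l : ℕ} [Fact l.Prime]
    (hc : ∀ N : ℕ, ∃ c : Gal(Ω/k), ∀ z : Ω, z ^ l ^ N = 1 → c z = z⁻¹)
    {M : IntermediateField k Ω} [FiniteDimensional k M] (hM : M ≤ cyclotomicZqExtension k Ω l) :
    ∃ N₀ : ℕ, ∀ N ≥ N₀, ∀ w : Ω, IsPrimitiveRoot w (l ^ N) →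
      M ≤ IntermediateField.adjoin k {w + w⁻¹} := by
  obtain ⟨N₀, h₀⟩ := exists_level (hM.trans (IntermediateField.lift_le _))
  choose c hc using hc
  refine ⟨N₀, fun N hN w hw y hy => ?_⟩
  have hl := (Fact.out : l.Prime)
  rw [mem_adjoin_simple_iff]
  intro t ht
  have := NeZero.mk (pow_ne_zero N hl.ne_zero)
  have hdvd : ∀ {a b : ℕ}, a ≤ b → ∀ z : Ω, z ^ l ^ a = 1 → z ^ l ^ b = 1 := by
    intro a b hab z hz
    obtain ⟨c, hc⟩ := pow_dvd_pow l hab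
    rw [hc, pow_mul, hz, one_pow]
  have hw0 : w ≠ 0 := hw.ne_zero (pow_ne_zero N hl.ne_zero)
  have htw : t w = w ∨ t w = w⁻¹ := by
    have htw0 : t w ≠ 0 := (map_ne_zero t).2 hw0
    rw [map_add, map_inv₀] at ht
    have : (t w - w) * (t w - w⁻¹) = 0 := by
      field_simp at ht ⊢
      linear_combination ht
    rcases mul_eq_zero.1 this with h | h
    · exact Or.inl (sub_eq_zero.1 h)
    · exact Or.inr (sub_eq_zero.1 h)
  rcases htw with h | h
  · refine h₀ t (fun z hz => ?_) y hy
    obtain ⟨i, -, rfl⟩ := hw.eq_pow_of_pow_eq_one (hdvd hN z hz)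
    rw [map_pow, h]
  -- The square of c j is trivial on μ_{ℓ^n} for j ≥ n, so r = 2 shows that c j fixes y for
  -- arbitrarily large j. For such j, (c j)⁻¹ t fixes w, hence y, and so t fixes y.
  · have hfreq := frequently_fixed_of_eventually_pow_fixed c two_pos (fun n => by
      filter_upwards [Filter.eventually_ge_atTop n] with j hj z hz
      rw [pow_two, AlgEquiv.mul_apply, hc j z (hdvd hj z hz), map_inv₀, hc j z (hdvd hj z hz),
        inv_inv]) (hM hy)
    obtain ⟨j, hj, hjN⟩ := (hfreq.and_eventually (Filter.eventually_ge_atTop N)).exists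
    have h2 := h₀ ((c j)⁻¹ * t) (fun z hz => ?_) y hy
    · have h3 := congrArg (c j) h2
      rwa [← AlgEquiv.mul_apply, mul_inv_cancel_left, hj] at h3
    · obtain ⟨i, -, rfl⟩ := hw.eq_pow_of_pow_eq_one (hdvd hN z hz)
      have h4 : ((c j)⁻¹ * t) w = w := by
        rw [AlgEquiv.mul_apply, h, ← hc j w (hdvd hjN w hw.pow_eq_one), ← AlgEquiv.mul_apply,
          inv_mul_cancel, AlgEquiv.one_apply]
      rw [map_pow, h4]

end cyclotomicTower

/-! ### Norms of primes in real cyclotomic fields. -/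

section realCyclotomic
variable (l : ℕ) [Fact l.Prime]

lemma norm_iwasawaLog_le_of_dvd {N : ℕ} (hN : ((l : ℝ) ^ N)⁻¹ ≤ logRadius l) {u : ℚ_[l]ˣ} {Q : ℤ}
    (hu : (u : ℚ_[l]) = Q) (hQ : (l : ℤ) ^ N ∣ Q - 1 ∨ (l : ℤ) ^ N ∣ Q + 1) :
    ‖iwasawaLog l (Additive.ofMul u)‖ ≤ ((l : ℝ) ^ N)⁻¹ := by
  have key : ∀ w : ℚ_[l]ˣ, ∀ R : ℤ, (w : ℚ_[l]) = R → (l : ℤ) ^ N ∣ R - 1 →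
      ‖iwasawaLog l (Additive.ofMul w)‖ ≤ ((l : ℝ) ^ N)⁻¹ := by
    intro w R hw hR
    have h : ‖(w : ℚ_[l]) - 1‖ ≤ ((l : ℝ) ^ N)⁻¹ := by
      rw [hw, ← zpow_natCast, ← zpow_neg]
      have := (Padic.norm_int_le_pow_iff_dvd (p := l) (R - 1) N).2 (by exact_mod_cast hR)
      exact_mod_cast this
    exact (norm_iwasawaLog_le l (h.trans hN)).trans h
  rcases hQ with h | h
  · exact key u Q hu h
  · have h1 := key (-1 * u) (-Q) (by rw [Units.val_mul, hu]; push_cast; ring)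
      (by rw [← dvd_neg]; convert! h using 1; ring)
    rwa [ofMul_mul, map_add, iwasawaLog_neg_one, zero_add] at h1

/-- Up to sign the global norm is a product of powers of prime norms; those above ℓ have logarithm
0, and the others are ± 1 modulo ℓ^N. -/
lemma norm_ratLog_normUnit_le {K : Type*} [Field K] [NumberField K] {N : ℕ}
    (hN : ((l : ℝ) ^ N)⁻¹ ≤ logRadius l)
    (hK : ∀ v : HeightOneSpectrum (𝓞 K), (l : 𝓞 K) ∉ v.asIdeal →
      (l : ℤ) ^ N ∣ (Ideal.absNorm v.asIdeal : ℤ) - 1 ∨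
      (l : ℤ) ^ N ∣ (Ideal.absNorm v.asIdeal : ℤ) + 1) (x : Kˣ) :
    ‖ratLog l (Additive.ofMul (normUnit K x))‖ ≤ ((l : ℝ) ^ N)⁻¹ := by
  rw [ratLog_normUnit]
  refine IsUltrametricDist.norm_sum_le_of_forall_le_of_nonneg (by positivity) fun v _ => ?_
  change ‖(_ : ℤ) • ratLog l (Additive.ofMul (primeNormUnit v))‖ ≤ _
  rw [zsmul_eq_mul, norm_mul]
  refine (mul_le_of_le_one_left (norm_nonneg _) (Padic.norm_int_le_one _)).trans ?_
  by_cases hv : (l : 𝓞 K) ∈ v.asIdeal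
  · rw [ratLog_primeNormUnit_of_mem l v hv, norm_zero]
    positivity
  · refine norm_iwasawaLog_le_of_dvd l hN ?_ (hK v hv)
    simp [primeNormUnit]

/-- In a field containing `ζ_n + ζ_n⁻¹`, the norms of the primes not dividing `n` are `± 1` modulo `n`. -/
lemma dvd_absNorm_sub_one_or_add_one {L : Type*} [Field L] [NumberField L] {n : ℕ} (hn : n ≠ 0)
    {ζ : L} (hζ : IsPrimitiveRoot ζ n) {K : IntermediateField ℚ L} (hK : ζ + ζ⁻¹ ∈ K)
    (v : HeightOneSpectrum (𝓞 K)) (hv : (n : 𝓞 K) ∉ v.asIdeal) :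
    (n : ℤ) ∣ (Ideal.absNorm v.asIdeal : ℤ) - 1 ∨ (n : ℤ) ∣ (Ideal.absNorm v.asIdeal : ℤ) + 1 := by
  have := NeZero.mk hn
  have hz : IsIntegral ℤ ζ := hζ.isIntegral (Nat.pos_of_ne_zero hn)
  have hz' : IsIntegral ℤ ζ⁻¹ := hζ.inv.isIntegral (Nat.pos_of_ne_zero hn)
  let z : 𝓞 L := ⟨ζ, hz⟩
  let z' : 𝓞 L := ⟨ζ⁻¹, hz'⟩
  have hzp : IsPrimitiveRoot z n := (IsPrimitiveRoot.coe_submonoidClass_iff (M := L)).1 hζ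
  have hzz : z * z' = 1 := Subtype.ext (mul_inv_cancel₀ (hζ.ne_zero hn))
  let a : K := ⟨ζ + ζ⁻¹, hK⟩
  have ha : IsIntegral ℤ a := (isIntegral_algebraMap_iff (algebraMap K L).injective).1 (hz.add hz')
  let α : 𝓞 K := ⟨a, ha⟩
  have hα : algebraMap (𝓞 K) (𝓞 L) α = z + z' := Subtype.ext rfl
  have := v.isPrime
  obtain ⟨P, hPm, hPv⟩ := Ideal.exists_maximal_ideal_liesOver_of_isIntegral (S := 𝓞 L) v.asIdeal
  have hPp := hPm.isPrime
  have : Finite (𝓞 K ⧸ v.asIdeal) := v.asIdeal.finiteQuotientOfFreeOfNeBot v.ne_bot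
  set Q := Ideal.absNorm v.asIdeal with hQ
  have hcard : Nat.card (𝓞 K ⧸ v.asIdeal) = Q := (Submodule.cardQuot_apply _).symm
  have hmem : ∀ x : 𝓞 K, algebraMap (𝓞 K) (𝓞 L) x ∈ P ↔ x ∈ v.asIdeal := fun x => by
    rw [hPv.over]
    rfl
  -- The residue of ζ + ζ⁻¹ comes from a field with Q elements, so the Q-th power map fixes it.
  have hαQ : Ideal.Quotient.mk P (z + z') ^ Q = Ideal.Quotient.mk P (z + z') := by
    let : Field (𝓞 K ⧸ v.asIdeal) := Ideal.Quotient.field _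
    have h1 : (Ideal.Quotient.mk v.asIdeal α) ^ Q = Ideal.Quotient.mk v.asIdeal α := by
      have := Fintype.ofFinite (𝓞 K ⧸ v.asIdeal)
      rw [← hcard, Nat.card_eq_fintype_card]
      exact FiniteField.pow_card _
    rw [← map_pow, Ideal.Quotient.eq] at h1
    rw [← hα, ← map_pow, ← map_pow, Ideal.Quotient.eq, ← map_sub, hmem]
    exact h1
  let p := residueChar v
  have : CharP (𝓞 L ⧸ P) p := by
    refine (CharP.charP_iff_prime_eq_zero Fact.out).2 ?_
    rw [← map_natCast (Ideal.Quotient.mk P), Ideal.Quotient.eq_zero_iff_mem,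
      ← map_natCast (algebraMap (𝓞 K) (𝓞 L)), hmem]
    exact residueChar_mem v
  set y := Ideal.Quotient.mk P z with hy
  set y' := Ideal.Quotient.mk P z' with hy'
  have hyy : y * y' = 1 := by rw [hy, hy', ← map_mul, hzz, map_one]
  have hfrob : (y + y') ^ Q = y ^ Q + y' ^ Q := by
    rw [hQ, absNorm_eq_pow_inertiaDeg v p (residueChar_mem v)]
    have : ExpChar (𝓞 L ⧸ P) p := ExpChar.prime Fact.out
    exact add_pow_expChar_pow y y' p _
  rw [map_add, ← hy, ← hy', hfrob] at hαQ
  have hyyQ : y ^ Q * y' ^ Q = 1 := by rw [← mul_pow, hyy, one_pow]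
  -- Raising to the power Q preserves y + y⁻¹, so y^Q is again a root of X² - (y + y⁻¹)X + 1.
  have hprod : (y ^ Q - y) * (y ^ Q - y') = 0 := by
    linear_combination y ^ Q * hαQ - hyyQ + hyy
  have hprim : IsPrimitiveRoot y n := by
    have hn0 : NeZero (n : 𝓞 L ⧸ P) := ⟨by
      rwa [← map_natCast (Ideal.Quotient.mk P), Ne, Ideal.Quotient.eq_zero_iff_mem,
        ← map_natCast (algebraMap (𝓞 K) (𝓞 L)), hmem]⟩
    rw [← Polynomial.isRoot_cyclotomic_iff]
    have h1 := hzp.isRoot_cyclotomic (Nat.pos_of_ne_zero hn)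
    have h2 := h1.map (f := Ideal.Quotient.mk P)
    rwa [Polynomial.map_cyclotomic] at h2
  have hQ1 : 1 ≤ Q := Nat.pos_of_ne_zero (absNorm_ne_zero v)
  have hy0 : y ≠ 0 := left_ne_zero_of_mul_eq_one hyy
  rcases mul_eq_zero.1 hprod with h | h
  · left
    have h1 : y ^ (Q - 1) = 1 := by
      refine mul_right_cancel₀ hy0 ?_
      rw [← pow_succ, Nat.sub_add_cancel hQ1, one_mul, sub_eq_zero.1 h]
    have h2 := (hprim.pow_eq_one_iff_dvd _).1 h1
    have h3 := Int.natCast_dvd_natCast.2 h2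
    rwa [Nat.cast_sub hQ1, Nat.cast_one] at h3
  · right
    have h1 : y ^ (Q + 1) = 1 := by
      rw [pow_succ, sub_eq_zero.1 h, mul_comm, hyy]
    exact_mod_cast (hprim.pow_eq_one_iff_dvd _).1 h1

end realCyclotomic

/-! ### Irreducibility of Φ_{ℓ^n} over ℚ_ℓ. -/

section eisenstein
variable (l : ℕ) [Fact l.Prime]

open Polynomial in
-- Φ(X + 1) is Eisenstein at ℓ over ℤ and stays so over ℤ_ℓ, its constant term being Φ(1) = ℓ.
-- Irreducibility passes to ℚ_ℓ by Gauss's lemma.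
lemma irreducible_cyclotomic_prime_pow (N : ℕ) : Irreducible (cyclotomic (l ^ (N + 1)) ℚ_[l]) := by
  have hE := cyclotomic_prime_pow_comp_X_add_one_isEisensteinAt l N
  have hmon : ((cyclotomic (l ^ (N + 1)) ℤ).comp (X + 1)).Monic :=
    (cyclotomic.monic _ ℤ).comp_X_add_C 1
  have hmap : ((cyclotomic (l ^ (N + 1)) ℤ).comp (X + 1)).map (Int.castRingHom ℤ_[l])
      = (cyclotomic (l ^ (N + 1)) ℤ_[l]).comp (X + 1) := by
    rw [Polynomial.map_comp, map_cyclotomic]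
    simp
  have hmon' : ((cyclotomic (l ^ (N + 1)) ℤ_[l]).comp (X + 1)).Monic :=
    (cyclotomic.monic _ _).comp_X_add_C 1
  have hspan : (Ideal.span {(l : ℤ_[l])}).IsPrime := by
    rw [Ideal.span_singleton_prime (PadicInt.prime_p.ne_zero)]
    exact PadicInt.prime_p
  have hdeg : ((cyclotomic (l ^ (N + 1)) ℤ_[l]).comp (X + 1)).natDegree
      = ((cyclotomic (l ^ (N + 1)) ℤ).comp (X + 1)).natDegree := by
    rw [← hmap, hmon.natDegree_map]
  have hE' : ((cyclotomic (l ^ (N + 1)) ℤ_[l]).comp (X + 1)).IsEisensteinAt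
      (Ideal.span {(l : ℤ_[l])}) := by
    refine hmon'.isEisensteinAt_of_mem_of_notMem hspan.ne_top (fun {n} hn => ?_) ?_
    · rw [← hmap, coeff_map]
      have h := hE.coeff_mem (n := n) (by rw [← hdeg]; exact hn.ne)
      obtain ⟨c, hc⟩ := Ideal.mem_span_singleton.1 h
      rw [hc]
      exact Ideal.mem_span_singleton.2 ⟨(c : ℤ_[l]), by simp⟩
    · rw [coeff_zero_eq_eval_zero, eval_comp]
      simp only [eval_add, eval_X, eval_one, zero_add]
      rw [eval_one_cyclotomic_prime_pow, Ideal.span_singleton_pow, Ideal.mem_span_singleton]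
      rintro ⟨c, hc⟩
      have h0 := PadicInt.prime_p (p := l)
      have h1 : (l : ℤ_[l]) * (l * c) = l * 1 := by rw [mul_one]; linear_combination -hc
      exact h0.not_isUnit (IsUnit.of_mul_eq_one _ (mul_left_cancel₀ h0.ne_zero h1))
  have hirr := hE'.irreducible hspan hmon'.isPrimitive (by
    rw [natDegree_comp, natDegree_cyclotomic]
    refine Nat.mul_pos (Nat.totient_pos.2 (pow_pos (Fact.out : l.Prime).pos _)) ?_
    rw [← C_1, natDegree_X_add_C]
    exact one_pos)
  have hirr2 : Irreducible (cyclotomic (l ^ (N + 1)) ℤ_[l]) := by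
    refine (MulEquiv.irreducible_iff (algEquivAevalXAddC (1 : ℤ_[l]))).1 ?_
    rwa [algEquivAevalXAddC_apply, C_1, ← comp_eq_aeval]
  have := ((cyclotomic.monic (l ^ (N + 1)) ℤ_[l]).irreducible_iff_irreducible_map_fraction_map
    (K := ℚ_[l])).1 hirr2
  rwa [map_cyclotomic] at this

end eisenstein

/-! ### Complex conjugation on roots of unity. -/

section conj
variable {k Ω : Type*} [Field k] [Field Ω] [Algebra k Ω] [CharZero k] [IsAlgClosed Ω]
  [Algebra.IsAlgebraic k Ω]

/-- When Φ_n is irreducible, a primitive root and its inverse share the minimal polynomial Φ_n and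
are therefore conjugate. -/
lemma exists_conjugation {n : ℕ} (hn : n ≠ 0) (h : Irreducible (Polynomial.cyclotomic n k)) :
    ∃ c : Gal(Ω/k), ∀ z : Ω, z ^ n = 1 → c z = z⁻¹ := by
  have := charZero_of_algebra k Ω
  have := isGalois_of_isAlgClosed (k := k) (Ω := Ω)
  have := NeZero.mk hn
  have : NeZero (n : k) := ⟨by exact_mod_cast hn⟩
  obtain ⟨w, hw⟩ := exists_isPrimitiveRoot_of_isAlgClosed Ω hn
  have h1 : IsConjRoot k w⁻¹ w := by
    rw [IsConjRoot, ← hw.minpoly_eq_cyclotomic_of_irreducible h,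
      ← hw.inv.minpoly_eq_cyclotomic_of_irreducible h]
  obtain ⟨c, hc⟩ := isConjRoot_iff_exists_algEquiv.1 h1
  refine ⟨c, fun z hz => ?_⟩
  obtain ⟨i, -, rfl⟩ := hw.eq_pow_of_pow_eq_one hz
  rw [map_pow, hc, inv_pow]

end conj
-- Real cyclotomic fields and their scalar extension.
section real
open IntermediateField

lemma two_mul_finrank_adjoin_le {L : Type*} [Field L] [NumberField L] {n : ℕ}
    [IsCyclotomicExtension {n} ℚ L] (hn : n ≠ 0) {ζ : L} (h : ζ ∉ ℚ⟮ζ + ζ⁻¹⟯) :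
    2 * Module.finrank ℚ ℚ⟮ζ + ζ⁻¹⟯ ≤ n.totient := by
  have := NeZero.mk hn
  rw [← IsCyclotomicExtension.finrank L (Polynomial.cyclotomic.irreducible_rat (Nat.pos_of_ne_zero hn)),
    ← Module.finrank_mul_finrank ℚ ℚ⟮ζ + ζ⁻¹⟯ L, mul_comm]
  refine Nat.mul_le_mul_left _ ?_
  have h0 : 0 < Module.finrank ℚ⟮ζ + ζ⁻¹⟯ L := Module.finrank_pos
  have h1 : Module.finrank ℚ⟮ζ + ζ⁻¹⟯ L ≠ 1 := by
    intro h1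
    rw [IntermediateField.finrank_eq_one_iff_eq_top.1 h1] at h
    exact h trivial
  omega

variable {k Ω : Type*} [Field k] [Field Ω] [Algebra k Ω]

/-- The root w has degree φ(n) over k, and degree at most 2 over k(w + w⁻¹), as a root of X² - (w +
w⁻¹)X + 1. -/
lemma totient_le_two_mul_finrank [CharZero k] [Algebra.IsAlgebraic k Ω] {n : ℕ} (hn : n ≠ 0)
    (hirr : Irreducible (Polynomial.cyclotomic n k)) {w : Ω} (hw : IsPrimitiveRoot w n) :
    n.totient ≤ 2 * Module.finrank k k⟮w + w⁻¹⟯ := by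
  have : NeZero (n : k) := ⟨by exact_mod_cast hn⟩
  have hint : ∀ x : Ω, IsIntegral k x := fun x => Algebra.IsIntegral.isIntegral x
  have h1 : Module.finrank k k⟮w⟯ = n.totient := by
    rw [adjoin.finrank (hint w), ← hw.minpoly_eq_cyclotomic_of_irreducible hirr,
      Polynomial.natDegree_cyclotomic]
  have hw0 : w ≠ 0 := hw.ne_zero hn
  set A := k⟮w + w⁻¹⟯ with hA
  let a : A := ⟨w + w⁻¹, mem_adjoin_simple_self k _⟩
  have hwA : IsIntegral A w := (hint w).tower_top
  have h2 : Module.finrank A A⟮w⟯ ≤ 2 := by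
    rw [adjoin.finrank hwA]
    have h3 : (Polynomial.X ^ 2 - Polynomial.C a * Polynomial.X + 1 : Polynomial A).Monic := by monicity!
    have h4 : (Polynomial.X ^ 2 - Polynomial.C a * Polynomial.X + 1 : Polynomial A).natDegree = 2 := by
      compute_degree!
    rw [← h4]
    refine Polynomial.natDegree_le_of_dvd (minpoly.dvd A w ?_) h3.ne_zero
    have : algebraMap A Ω a = w + w⁻¹ := rfl
    simp only [map_add, map_sub, map_pow, map_mul, Polynomial.aeval_X, Polynomial.aeval_C, map_one, this]
    field_simp
    ring
  have : FiniteDimensional k A := adjoin.finiteDimensional (hint _)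
  have : FiniteDimensional A A⟮w⟯ := adjoin.finiteDimensional hwA
  have h5 := Module.finrank_mul_finrank k A A⟮w⟯
  have hle : k⟮w⟯ ≤ A⟮w⟯.restrictScalars k :=
    adjoin_simple_le_iff.2 (mem_adjoin_simple_self A w)
  have : FiniteDimensional k (A⟮w⟯.restrictScalars k) :=
    FiniteDimensional.trans k A A⟮w⟯
  have h6 : Module.finrank k k⟮w⟯ ≤ Module.finrank k (A⟮w⟯.restrictScalars k) :=
    LinearMap.finrank_le_finrank_of_injective (f := (inclusion hle).toLinearMap)
      (inclusion hle).injective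
  have h7 : Module.finrank k (A⟮w⟯.restrictScalars k) = Module.finrank k A⟮w⟯ := rfl
  rw [h1, h7, ← h5] at h6
  nlinarith

/-- Conjugation fixes w + w⁻¹ but moves w, since w² ≠ 1 for n > 2. -/
lemma notMem_adjoin_add_inv {n : ℕ} (hn : 2 < n) {w : Ω} (hw : IsPrimitiveRoot w n)
    (hc : ∃ c : Gal(Ω/k), c w = w⁻¹) : w ∉ k⟮w + w⁻¹⟯ := by
  obtain ⟨c, hc⟩ := hc
  intro h
  have h1 : ∀ y ∈ k⟮w + w⁻¹⟯, c y = y := by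
    intro y hy
    induction hy using IntermediateField.adjoin_induction with
    | mem x hx => rw [Set.mem_singleton_iff.1 hx, map_add, map_inv₀, hc, inv_inv, add_comm]
    | algebraMap x => exact c.commutes x
    | add x y _ _ hx hy => rw [map_add, hx, hy]
    | inv x _ hx => rw [map_inv₀, hx]
    | mul x y _ _ hx hy => rw [map_mul, hx, hy]
  have h2 := h1 w h
  rw [hc] at h2
  have h3 : w ^ 2 = 1 := by
    rw [pow_two]
    nth_rewrite 1 [← h2]
    exact inv_mul_cancel₀ (hw.ne_zero (by omega))
  exact absurd (Nat.le_of_dvd two_pos ((hw.pow_eq_one_iff_dvd 2).1 h3)) (by omega)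

/-- Scalar extension from `ℚ` to `k` of the real cyclotomic field, if the cyclotomic polynomial
is irreducible over `k`. -/
lemma exists_tensor_equiv_adjoin_add_inv [CharZero k] [IsAlgClosed Ω] [Algebra.IsAlgebraic k Ω]
    {n : ℕ} (hn : 2 < n)
    (hirr : Irreducible (Polynomial.cyclotomic n k)) {L : Type*} [Field L] [NumberField L]
    [IsCyclotomicExtension {n} ℚ L] {ζ : L} (hζ : IsPrimitiveRoot ζ n) {w : Ω}
    (hw : IsPrimitiveRoot w n) (hc : ∃ c : Gal(Ω/k), c w = w⁻¹) :
    Nonempty (k ⊗[ℚ] ℚ⟮ζ + ζ⁻¹⟯ ≃ₐ[k] k⟮w + w⁻¹⟯) ∧ 2 * Module.finrank k k⟮w + w⁻¹⟯ = n.totient := by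
  have := charZero_of_algebra k Ω
  have hn0 : n ≠ 0 := by omega
  have := NeZero.mk hn0
  have hmin : minpoly ℚ w = minpoly ℚ ζ := by
    rw [← hw.minpoly_eq_cyclotomic_of_irreducible (Polynomial.cyclotomic.irreducible_rat (Nat.pos_of_ne_zero hn0)),
      ← hζ.minpoly_eq_cyclotomic_of_irreducible (Polynomial.cyclotomic.irreducible_rat (Nat.pos_of_ne_zero hn0))]
  obtain ⟨i, hi⟩ : ∃ i : L →ₐ[ℚ] Ω, i ζ = w := by
    let pb := hζ.powerBasis ℚ
    have hgen : pb.gen = ζ := hζ.powerBasis_gen ℚ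
    refine ⟨pb.lift w (by rw [hgen, ← hmin, minpoly.aeval]), ?_⟩
    exact (congrArg _ hgen.symm).trans (pb.lift_gen _ _)
  have hmap : ∀ x ∈ ℚ⟮ζ + ζ⁻¹⟯, i x ∈ k⟮w + w⁻¹⟯ := by
    intro x hx
    induction hx using IntermediateField.adjoin_induction with
    | mem x hx =>
      rw [Set.mem_singleton_iff.1 hx, map_add, map_inv₀, hi]
      exact mem_adjoin_simple_self k _
    | algebraMap x =>
      rw [AlgHom.commutes, IsScalarTower.algebraMap_apply ℚ k Ω]
      exact IntermediateField.algebraMap_mem _ _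
    | add x y _ _ hx hy => rw [map_add]; exact add_mem hx hy
    | inv x _ hx => rw [map_inv₀]; exact inv_mem hx
    | mul x y _ _ hx hy => rw [map_mul]; exact mul_mem hx hy
  -- The degrees are squeezed: 2[ℚ(ζ + ζ⁻¹) : ℚ] ≤ φ(n) ≤ 2[k(w + w⁻¹) : k], while surjectivity of f
  -- gives the reverse inequality. Hence f is bijective.
  have hnot : ζ ∉ ℚ⟮ζ + ζ⁻¹⟯ := fun h => notMem_adjoin_add_inv hn hw hc (hi ▸ hmap ζ h)
  have hQ := two_mul_finrank_adjoin_le hn0 hnot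
  have hk := totient_le_two_mul_finrank hn0 hirr hw
  let j : ℚ⟮ζ + ζ⁻¹⟯ →ₐ[ℚ] k⟮w + w⁻¹⟯ :=
    (i.comp (val _)).codRestrict ((k⟮w + w⁻¹⟯).restrictScalars ℚ).toSubalgebra fun x => hmap x x.2
  let f : k ⊗[ℚ] ℚ⟮ζ + ζ⁻¹⟯ →ₐ[k] k⟮w + w⁻¹⟯ :=
    Algebra.TensorProduct.lift (Algebra.ofId k _) j fun _ _ => Commute.all _ _
  have hint : IsIntegral k (w + w⁻¹) := Algebra.IsIntegral.isIntegral _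
  have : FiniteDimensional k k⟮w + w⁻¹⟯ := adjoin.finiteDimensional hint
  have hsurj : Function.Surjective f := by
    have h1 : Algebra.adjoin k {w + w⁻¹} ≤ f.range.map (val k⟮w + w⁻¹⟯) := by
      refine Algebra.adjoin_le (Set.singleton_subset_iff.2 ?_)
      refine ⟨_, ⟨1 ⊗ₜ ⟨ζ + ζ⁻¹, mem_adjoin_simple_self ℚ _⟩, rfl⟩, ?_⟩
      change ((f (1 ⊗ₜ[ℚ] _) : k⟮w + w⁻¹⟯) : Ω) = _
      rw [Algebra.TensorProduct.lift_tmul, map_one, one_mul]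
      change i (ζ + ζ⁻¹) = _
      rw [map_add, map_inv₀, hi]
    rintro ⟨y, hy⟩
    rw [← adjoin_simple_toSubalgebra_of_isAlgebraic hint.isAlgebraic] at h1
    obtain ⟨_, ⟨t, rfl⟩, ht⟩ := h1 hy
    exact ⟨t, Subtype.ext ht⟩
  have hfin : Module.finrank k (k ⊗[ℚ] ℚ⟮ζ + ζ⁻¹⟯) = Module.finrank ℚ ℚ⟮ζ + ζ⁻¹⟯ :=
    Module.finrank_baseChange
  have hle := LinearMap.finrank_le_finrank_of_surjective (f := f.toLinearMap) hsurj
  have heq : Module.finrank k (k ⊗[ℚ] ℚ⟮ζ + ζ⁻¹⟯) = Module.finrank k k⟮w + w⁻¹⟯ := by omega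
  refine ⟨⟨AlgEquiv.ofBijective f ⟨?_, hsurj⟩⟩, by omega⟩
  exact (LinearMap.injective_iff_surjective_of_finrank_eq_finrank (f := f.toLinearMap) heq).2 hsurj

end real

/-! ### Logarithms of norms from ℚ_ℓ(ζ + ζ⁻¹). -/

section lognorm
variable (l : ℕ) [Fact l.Prime]

/-- Norms of elements of `ℚ_l ⊗ K` are multiplicatively close to norms of elements of `K`. -/
lemma exists_norm_close {K : Type*} [Field K] [NumberField K] (t : ℚ_[l] ⊗[ℚ] K)
    {ε : ℝ} (hε : 0 < ε) :
    ∃ x : K, ‖((Algebra.norm ℚ x : ℚ) : ℚ_[l]) - Algebra.norm ℚ_[l] t‖ < ε := by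
  let b := Module.finBasis ℚ K
  let B := b.baseChange ℚ_[l]
  let g : (Fin (Module.finrank ℚ K) → ℚ_[l]) → ℚ_[l] := fun c =>
    Algebra.norm ℚ_[l] (∑ i, c i • B i)
  -- The norm is a determinant with entries linear in the coordinates, so rational coordinates close
  -- to those of t give a close norm.
  have hg : Continuous g := by
    have : g = fun c => (∑ i, c i • Algebra.leftMulMatrix B (B i)).det := by
      ext c
      simp only [g]
      rw [Algebra.norm_eq_matrix_det B, map_sum]
      simp_rw [map_smul]
    rw [this]
    fun_prop
  have hd : DenseRange (fun (c : Fin (Module.finrank ℚ K) → ℚ) i => (c i : ℚ_[l])) :=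
    DenseRange.piMap fun _ => Padic.denseRange_ratCast l
  obtain ⟨c, hc⟩ := hd.exists_mem_open
    ((Metric.isOpen_ball (x := Algebra.norm ℚ_[l] t) (ε := ε)).preimage hg)
    ⟨fun i => B.repr t i, by
      change g _ ∈ Metric.ball _ _
      simp only [g]
      rw [B.sum_repr]
      exact Metric.mem_ball_self hε⟩
  refine ⟨∑ i, c i • b i, ?_⟩
  have h1 : g (fun i => (c i : ℚ_[l])) = ((Algebra.norm ℚ (∑ i, c i • b i) : ℚ) : ℚ_[l]) := by
    simp only [g]
    rw [← eq_ratCast (algebraMap ℚ ℚ_[l]), ← norm_baseChange, TensorProduct.tmul_sum]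
    congr 1
    refine Finset.sum_congr rfl fun i _ => ?_
    rw [TensorProduct.tmul_smul, ← Rat.cast_smul_eq_qsmul ℚ_[l]]
    simp [B]
  rw [← h1, ← dist_eq_norm]
  exact hc

lemma exists_cyclotomic_numberField {n : ℕ} (hn : n ≠ 0) :
    ∃ (L : Type) (_ : Field L) (_ : NumberField L), IsCyclotomicExtension {n} ℚ L := by
  have := NeZero.mk hn
  refine ⟨CyclotomicField n ℚ, inferInstance, inferInstance, ?_⟩
  have h : IsCyclotomicExtension {n} ℚ (CyclotomicField n ℚ) :=
    CyclotomicField.isCyclotomicExtension n ℚ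
  convert! h

open IntermediateField in
-- This replaces local class field theory. The norm u is approximated by the norm of an element of
-- ℚ(ζ + ζ⁻¹), whose logarithm is divisible by ℓ^(N+1), and the ratio of the two norms is 1 modulo
-- ℓ^(N+1).
lemma norm_iwasawaLog_norm_real_le {Ω : Type*} [Field Ω] [Algebra ℚ_[l] Ω] [IsAlgClosed Ω]
    [Algebra.IsAlgebraic ℚ_[l] Ω] {N : ℕ} (hN : 2 < l ^ (N + 1))
    (hN' : ((l : ℝ) ^ (N + 1))⁻¹ ≤ logRadius l) {w : Ω}
    (hw : IsPrimitiveRoot w (l ^ (N + 1))) (u : ℚ_[l]ˣ) (y : ℚ_[l]⟮w + w⁻¹⟯)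
    (hu : (u : ℚ_[l]) = Algebra.norm ℚ_[l] y) :
    ‖iwasawaLog l (Additive.ofMul u)‖ ≤ ((l : ℝ) ^ (N + 1))⁻¹ := by
  have hl := (Fact.out : l.Prime)
  have hn := pow_ne_zero (N + 1) hl.ne_zero
  have := NeZero.mk hn
  obtain ⟨L, _, _, _⟩ := exists_cyclotomic_numberField hn
  have hζ := IsCyclotomicExtension.zeta_spec (l ^ (N + 1)) ℚ L
  set ζ := IsCyclotomicExtension.zeta (l ^ (N + 1)) ℚ L with hζdef
  have hirr := irreducible_cyclotomic_prime_pow l N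
  obtain ⟨c, hc⟩ := exists_conjugation (Ω := Ω) hn hirr
  obtain ⟨⟨e⟩, -⟩ := exists_tensor_equiv_adjoin_add_inv hN hirr hζ hw ⟨c, hc w hw.pow_eq_one⟩
  have h1 : Algebra.norm ℚ_[l] (e.symm y) = u := by
    rw [hu, ← Algebra.norm_eq_of_algEquiv e (e.symm y), AlgEquiv.apply_symm_apply]
  have hl0 : (0 : ℝ) < l := by exact_mod_cast hl.pos
  have hu0 : 0 < ‖(u : ℚ_[l])‖ := norm_pos_iff.2 u.ne_zero
  -- The precision is taken relative to ‖u‖, so that N(x)/u is 1 modulo ℓ^(N+1); it also forces x ≠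
  -- 0.
  obtain ⟨x, hx⟩ := exists_norm_close l (e.symm y)
    (ε := ‖(u : ℚ_[l])‖ * ((l : ℝ) ^ (N + 1))⁻¹) (by positivity)
  rw [h1] at hx
  have hx0 : x ≠ 0 := by
    rintro rfl
    rw [Algebra.norm_zero, Rat.cast_zero, zero_sub, norm_neg] at hx
    have h2 : ((l : ℝ) ^ (N + 1))⁻¹ ≤ 1 := hN'.trans (logRadius_lt_one l).le
    nlinarith
  let X : (ℚ⟮ζ + ζ⁻¹⟯)ˣ := Units.mk0 x hx0
  have h2 := norm_ratLog_normUnit_le l (N := N + 1) hN' (fun v hv => by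
    have := dvd_absNorm_sub_one_or_add_one hn hζ (mem_adjoin_simple_self ℚ _) v (by
      rw [Nat.cast_pow]
      intro h
      exact hv (v.isPrime.mem_of_pow_mem _ h))
    exact_mod_cast this) X
  let s : ℚ_[l]ˣ := Units.map (algebraMap ℚ ℚ_[l]).toMonoidHom (normUnit _ X)
  have hs : (s : ℚ_[l]) = ((Algebra.norm ℚ x : ℚ) : ℚ_[l]) := by
    simp [s, normUnit, X]
  have h3 : ‖((s * u⁻¹ : ℚ_[l]ˣ) : ℚ_[l]) - 1‖ ≤ ((l : ℝ) ^ (N + 1))⁻¹ := by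
    have : ((s * u⁻¹ : ℚ_[l]ˣ) : ℚ_[l]) - 1 = (s - u) * (u : ℚ_[l])⁻¹ := by
      rw [Units.val_mul, Units.val_inv_eq_inv_val, sub_mul, mul_inv_cancel₀ u.ne_zero]
    rw [this, norm_mul, norm_inv, hs, mul_inv_le_iff₀ hu0, mul_comm]
    exact hx.le
  have h4 := (norm_iwasawaLog_le l (h3.trans hN')).trans h3
  have h5 : iwasawaLog l (Additive.ofMul u) = ratLog l (Additive.ofMul (normUnit _ X))
      - iwasawaLog l (Additive.ofMul (s * u⁻¹)) := by
    rw [ofMul_mul, ofMul_inv, map_add, map_neg]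
    change _ = iwasawaLog l (Additive.ofMul s) - _
    ring
  rw [h5]
  rw [sub_eq_add_neg]
  exact (Padic.nonarchimedean _ _).trans (max_le h2 (by rwa [norm_neg]))

end lognorm

/-! ### Norms in towers. -/

section towers
variable {k Ω : Type*} [Field k] [Field Ω] [Algebra k Ω]

lemma exists_norm_eq_of_le {A B : IntermediateField k Ω} (h : A ≤ B) [FiniteDimensional k B] (y : B) :
    ∃ z : A, Algebra.norm k y = Algebra.norm k z := by
  let : Algebra A B := (IntermediateField.inclusion h).toAlgebra
  have : IsScalarTower k A B := IsScalarTower.of_algebraMap_eq fun _ => rfl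
  exact ⟨Algebra.norm A y, (Algebra.norm_norm (R := k) (S := A) (a := y)).symm⟩

lemma norm_inclusion {A B : IntermediateField k Ω} (h : A ≤ B) [FiniteDimensional k B] :
    ∃ r : ℕ, Module.finrank k A * r = Module.finrank k B ∧
      ∀ z : A, Algebra.norm k (IntermediateField.inclusion h z) = Algebra.norm k z ^ r := by
  let : Algebra A B := (IntermediateField.inclusion h).toAlgebra
  have : IsScalarTower k A B := IsScalarTower.of_algebraMap_eq fun _ => rfl
  refine ⟨Module.finrank A B, Module.finrank_mul_finrank k A B, fun z => ?_⟩
  rw [← map_pow, ← Algebra.norm_algebraMap (R := A) (S := B) z, Algebra.norm_norm]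
  rfl

end towers

/-! ### Integrality of the logarithmic valuations above ℓ. -/

section localBound
variable (l : ℕ) [Fact l.Prime]

/-- The 2 is the degree of ℚ_ℓ(ζ) over ℚ_ℓ(ζ + ζ⁻¹). It is a unit for odd ℓ and accounts for deg_2 2
= 4 in place of 2. -/
lemma inv_mul_norm_two_le_logRadius : (l : ℝ)⁻¹ * ‖(2 : ℚ_[l])‖ = logRadius l := by
  unfold logRadius
  split_ifs with h
  · subst h
    have : ‖((2 : ℕ) : ℚ_[2])‖ = (2 : ℝ)⁻¹ := by
      have := Padic.norm_p (p := 2)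
      exact_mod_cast this
    rw [Nat.cast_ofNat] at this
    rw [this]
    norm_num
  · have h2 : ‖((2 : ℤ) : ℚ_[l])‖ = 1 := by
      refine le_antisymm (Padic.norm_int_le_one _) (not_lt.1 fun hlt => h ?_)
      rw [Padic.norm_intCast_lt_one_iff] at hlt
      have h3 : l ∣ 2 := by exact_mod_cast hlt
      exact (Nat.prime_dvd_prime_iff_eq Fact.out Nat.prime_two).1 h3
    rw [Int.cast_ofNat] at h2
    rw [h2, mul_one]

lemma norm_natCast_eq_inv_pow_factorization {d : ℕ} (hd : d ≠ 0) :
    ‖(d : ℚ_[l])‖ = ((l : ℝ) ^ d.factorization l)⁻¹ := by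
  rw [Padic.norm_eq_zpow_neg_valuation (by exact_mod_cast hd), Padic.valuation_natCast,
    zpow_neg, zpow_natCast, Nat.factorization_def _ Fact.out]

/-- If r is the degree of the real field over M, the norm of z from the real field is u^r, so ‖r‖
‖Log u‖ ≤ ℓ^(-(N+1)). The equality 2 [M : ℚ_ℓ] r = ℓ^N (ℓ - 1) then removes ‖r‖. -/
lemma norm_iwasawaLog_norm_le_of_le {Ω : Type*} [Field Ω] [Algebra ℚ_[l] Ω] [IsAlgClosed Ω]
    [Algebra.IsAlgebraic ℚ_[l] Ω] {M : IntermediateField ℚ_[l] Ω} [FiniteDimensional ℚ_[l] M]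
    (hM : M ≤ cyclotomicZqExtension ℚ_[l] Ω l) (u : ℚ_[l]ˣ) (z : M)
    (hu : (u : ℚ_[l]) = Algebra.norm ℚ_[l] z) :
    ‖iwasawaLog l (Additive.ofMul u)‖ ≤ ‖(Module.finrank ℚ_[l] M : ℚ_[l])‖ * logRadius l := by
  have hl := (Fact.out : l.Prime)
  have hl0 : (0 : ℝ) < l := by exact_mod_cast hl.pos
  obtain ⟨N₀, hN₀⟩ := exists_le_adjoin_add_inv (fun N => by
    rcases N with _ | N
    · exact ⟨1, fun z hz => by
        rw [pow_zero, pow_one] at hz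
        rw [hz, map_one, inv_one]⟩
    · exact exists_conjugation (pow_ne_zero _ hl.ne_zero) (irreducible_cyclotomic_prime_pow l N)) hM
  -- The shift ensures N + 1 ≥ 2, whence ℓ^(N+1) > 2 and ℓ^(-(N+1)) ≤ `logRadius l`, also for ℓ = 2.
  set N := N₀ + 1 with hN
  have hN1 : 2 < l ^ (N + 1) := by
    calc 2 < 2 ^ 2 := by norm_num
      _ ≤ l ^ 2 := Nat.pow_le_pow_left hl.two_le 2
      _ ≤ l ^ (N + 1) := Nat.pow_le_pow_right hl.pos (by omega)
  have hN2 : ((l : ℝ) ^ (N + 1))⁻¹ ≤ logRadius l := by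
    have h1 : ((l : ℝ) ^ (N + 1))⁻¹ ≤ ((l : ℝ) ^ 2)⁻¹ := by
      gcongr
      · exact_mod_cast hl.one_le
      · omega
    refine h1.trans ?_
    unfold logRadius
    split_ifs with h
    · subst h; norm_num
    · gcongr
      rw [pow_two]
      exact le_mul_of_one_le_left hl0.le (by exact_mod_cast hl.one_le)
  have := charZero_of_algebra ℚ_[l] Ω
  have hn := pow_ne_zero (N + 1) hl.ne_zero
  obtain ⟨w, hw⟩ := exists_isPrimitiveRoot_of_isAlgClosed Ω hn
  have hirr := irreducible_cyclotomic_prime_pow l N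
  have hle := hN₀ (N + 1) (by omega) w hw
  have hfin : FiniteDimensional ℚ_[l] (IntermediateField.adjoin ℚ_[l] {w + w⁻¹}) :=
    IntermediateField.adjoin.finiteDimensional (Algebra.IsIntegral.isIntegral _)
  obtain ⟨r, hr, hnorm⟩ := norm_inclusion hle
  have h1 := norm_iwasawaLog_norm_real_le l hN1 hN2 hw (u ^ r)
    (IntermediateField.inclusion hle z) (by rw [hnorm, Units.val_pow_eq_pow_val, hu])
  obtain ⟨L, _, _, _⟩ := exists_cyclotomic_numberField hn
  have := NeZero.mk hn
  obtain ⟨c, hc⟩ := exists_conjugation (Ω := Ω) hn hirr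
  obtain ⟨-, hdeg⟩ := exists_tensor_equiv_adjoin_add_inv hN1 hirr
    (IsCyclotomicExtension.zeta_spec (l ^ (N + 1)) ℚ L) hw ⟨c, hc w hw.pow_eq_one⟩
  rw [← hr, Nat.totient_prime_pow_succ hl] at hdeg
  rw [ofMul_pow, map_nsmul, nsmul_eq_mul, norm_mul] at h1
  have h2 := congrArg (fun n : ℕ => ‖(n : ℚ_[l])‖) hdeg
  simp only [Nat.cast_mul, norm_mul, Nat.cast_pow, norm_pow, Padic.norm_p, Nat.cast_ofNat,
    Nat.cast_sub hl.one_le, Nat.cast_one, norm_prime_sub_one, mul_one] at h2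
  rw [← inv_mul_norm_two_le_logRadius]
  have hr0 : 0 < ‖(r : ℚ_[l])‖ := by
    refine (norm_nonneg _).lt_of_ne' fun h => ?_
    rw [h, mul_zero, mul_zero] at h2
    exact (pow_pos (inv_pos.2 hl0) N).ne h2
  refine le_of_mul_le_mul_left (h1.trans_eq ?_) hr0
  rw [pow_succ, mul_inv, ← inv_pow, ← h2]
  ring

variable {l}
lemma isAlgebraic_algebraicClosure (k E : Type*) [Field k] [Field E] [Algebra k E]
    [FiniteDimensional k E] : Algebra.IsAlgebraic k (AlgebraicClosure E) :=
  Algebra.IsAlgebraic.trans k E (AlgebraicClosure E)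

variable (l)
-- A norm from E is a norm from the subfield M of E ∩ ℚ_ℓ^c whose degree is the ℓ-part of f̃, and
-- only this ℓ-part affects the absolute value.
lemma norm_iwasawaLog_norm_le (E : Type*) [Field E] [Algebra ℚ_[l] E] [FiniteDimensional ℚ_[l] E]
    (u : ℚ_[l]ˣ) (y : E) (hu : (u : ℚ_[l]) = Algebra.norm ℚ_[l] y) :
    ‖iwasawaLog l (Additive.ofMul u)‖ ≤ ‖(cyclotomicInertiaDegree ℚ_[l] E : ℚ_[l])‖ * logRadius l := by
  have := isAlgebraic_algebraicClosure ℚ_[l] E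
  let f := IsScalarTower.toAlgHom ℚ_[l] E (AlgebraicClosure E)
  let e : E ≃ₐ[ℚ_[l]] f.fieldRange := AlgEquiv.ofInjectiveField f
  have hX : f.fieldRange ⊓ cyclotomicZHatExtension ℚ_[l] (AlgebraicClosure E) ≤ f.fieldRange :=
    inf_le_left
  have := finiteDimensional_of_le hX
  obtain ⟨M, hMX, hMl, hM⟩ := exists_le_cyclotomicZqExtension l
    (inf_le_right : f.fieldRange ⊓ cyclotomicZHatExtension ℚ_[l] (AlgebraicClosure E) ≤ _)
  have := finiteDimensional_of_le hMX
  obtain ⟨z, hz⟩ := exists_norm_eq_of_le (hMX.trans hX) (e y)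
  have h := norm_iwasawaLog_norm_le_of_le l hMl u z (by
    rw [← hz, Algebra.norm_eq_of_algEquiv, hu])
  have h0 : cyclotomicInertiaDegree ℚ_[l] E ≠ 0 := cyclotomicInertiaDegree_ne_zero _ _
  rw [norm_natCast_eq_inv_pow_factorization l h0]
  rwa [hM, Nat.cast_pow, norm_pow, Padic.norm_p, inv_pow] at h

lemma norm_primeDegree_self : ‖primeDegree l l‖ = logRadius l := by
  unfold primeDegree logRadius
  rw [if_pos rfl]
  split_ifs with h
  · subst h
    have : (4 : ℚ_[2]) = (2 : ℕ) ^ 2 := by norm_num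
    rw [this, norm_pow, Padic.norm_p]
    norm_num
  · exact Padic.norm_p

variable {F : Type*} [Field F] [NumberField F] (v : HeightOneSpectrum (𝓞 F))

/-- At the primes above `ℓ`, the logarithms of local norms are divisible by the degree. -/
lemma norm_logLocalNorm_le (hv : (l : 𝓞 F) ∈ v.asIdeal) (x : Additive Fˣ) :
    ‖logLocalNorm v l x‖ ≤ ‖placeDegree v l‖ := by
  obtain rfl : l = residueChar v := eq_residueChar hv
  obtain ⟨x, rfl⟩ := Additive.ofMul.surjective x
  rw [logLocalNorm_of_mem _ _ hv, placeDegree, norm_mul, norm_primeDegree_self]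
  let := completionAlgebra v (residueChar v) (residueChar_mem v)
  have : FiniteDimensional ℚ_[residueChar v] (v.adicCompletion F) :=
    finiteDimensional_completionAbove (residueChar v) ⟨v, residueChar_mem v⟩
  exact norm_iwasawaLog_norm_le (residueChar v) (v.adicCompletion F) _
    (algebraMap F (v.adicCompletion F) x) rfl

end localBound

/-! ### Powers and roots of unity in ultrametric fields. -/

section ultrametric
variable {K : Type*} [NormedField K] [IsUltrametricDist K]

lemma norm_eq_one_of_pow {m : ℕ} (hm : m ≠ 0) {z : K} (hz : z ^ m = 1) : ‖z‖ = 1 :=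
  (pow_eq_one_iff_of_nonneg (norm_nonneg z) hm).1 (by rw [← norm_pow, hz, norm_one])

lemma norm_pow_sub_pow_le {x y : K} (hx : ‖x‖ ≤ 1) (hy : ‖y‖ ≤ 1) (n : ℕ) :
    ‖x ^ n - y ^ n‖ ≤ ‖x - y‖ := by
  rw [← (Commute.all x y).geom_sum₂_mul, norm_mul]
  refine mul_le_of_le_one_left (norm_nonneg _) ?_
  refine IsUltrametricDist.norm_sum_le_of_forall_le_of_nonneg zero_le_one fun i _ => ?_
  rw [norm_mul, norm_pow, norm_pow]
  exact mul_le_one₀ (pow_le_one₀ (norm_nonneg _) hx) (by positivity) (pow_le_one₀ (norm_nonneg _) hy)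

/-- The cofactor Σ x^i y^(n-1-i) of x - y is congruent to n y^(n-1) modulo x - y. This contraction
makes the Teichmüller sequence a^(q^j) converge. -/
lemma norm_pow_sub_pow_le_mul {x y : K} {r : ℝ} (hx : ‖x‖ ≤ 1) (hy : ‖y‖ ≤ 1) {n : ℕ}
    (hn : ‖(n : K)‖ ≤ r) (h : ‖x - y‖ ≤ r) : ‖x ^ n - y ^ n‖ ≤ r * ‖x - y‖ := by
  rw [← (Commute.all x y).geom_sum₂_mul, norm_mul]
  refine mul_le_mul_of_nonneg_right ?_ (norm_nonneg _)
  have hr : 0 ≤ r := (norm_nonneg _).trans h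
  have e : ∑ i ∈ Finset.range n, x ^ i * y ^ (n - 1 - i)
      = ∑ i ∈ Finset.range n, (x ^ i - y ^ i) * y ^ (n - 1 - i) + n * y ^ (n - 1) := by
    simp_rw [sub_mul]
    rw [Finset.sum_sub_distrib, sub_add_eq_add_sub, eq_sub_iff_add_eq, add_right_inj]
    calc ∑ i ∈ Finset.range n, y ^ i * y ^ (n - 1 - i)
        = ∑ i ∈ Finset.range n, y ^ (n - 1) := Finset.sum_congr rfl fun i hi => by
          rw [← pow_add]
          congr 1
          have := Finset.mem_range.1 hi
          omega
      _ = n * y ^ (n - 1) := by rw [Finset.sum_const, Finset.card_range, nsmul_eq_mul]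
  have hpow : ∀ j, ‖y‖ ^ j ≤ 1 := fun j => pow_le_one₀ (norm_nonneg _) hy
  rw [e]
  refine (IsUltrametricDist.norm_add_le_max _ _).trans (max_le ?_ ?_)
  · refine IsUltrametricDist.norm_sum_le_of_forall_le_of_nonneg hr fun i _ => ?_
    rw [norm_mul, norm_pow]
    exact (mul_le_of_le_one_right (norm_nonneg _) (hpow _)).trans
      ((norm_pow_sub_pow_le hx hy i).trans h)
  · rw [norm_mul, norm_pow]
    exact (mul_le_of_le_one_right (norm_nonneg _) (hpow _)).trans hn

lemma norm_sub_le_max_of_ultrametric (x y : K) : ‖x - y‖ ≤ max ‖x‖ ‖y‖ := by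
  rw [sub_eq_add_neg, ← norm_neg y]
  exact IsUltrametricDist.norm_add_le_max _ _

/-- Roots of unity of order prime to the residue characteristic are determined by their residue. -/
lemma eq_one_of_norm_sub_one_lt {m : ℕ} (hm : ‖(m : K)‖ = 1) {z : K} (hz : z ^ m = 1)
    (h : ‖z - 1‖ < 1) : z = 1 := by
  by_contra hne
  have hm0 : m ≠ 0 := by
    rintro rfl
    simp at hm
  have hz1 : ‖z‖ = 1 := norm_eq_one_of_pow hm0 hz
  have h1 : ∑ i ∈ Finset.range m, z ^ i = 0 := by
    have := geom_sum_mul z m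
    rw [hz, sub_self] at this
    exact (mul_eq_zero.1 this).resolve_right (sub_ne_zero.2 hne)
  have h2 : (m : K) = ∑ i ∈ Finset.range m, (1 - z ^ i) := by
    rw [Finset.sum_sub_distrib, h1, sub_zero, Finset.sum_const, Finset.card_range, nsmul_one]
  have h3 : ‖(m : K)‖ ≤ ‖z - 1‖ := by
    rw [h2]
    refine IsUltrametricDist.norm_sum_le_of_forall_le_of_nonneg (norm_nonneg _) fun i _ => ?_
    rw [norm_sub_rev]
    simpa using norm_pow_sub_pow_le hz1.le norm_one.le i
  exact absurd h (not_lt.2 (hm ▸ h3))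

lemma eq_of_norm_sub_lt {m : ℕ} (hm : ‖(m : K)‖ = 1) {z w : K} (hz : z ^ m = 1) (hw : w ^ m = 1)
    (h : ‖z - w‖ < 1) : z = w := by
  have hm0 : m ≠ 0 := by
    rintro rfl
    simp at hm
  have hw1 : ‖w‖ = 1 := norm_eq_one_of_pow hm0 hw
  have hw0 : w ≠ 0 := norm_pos_iff.1 (hw1 ▸ one_pos)
  refine (div_eq_one_iff_eq hw0).1 (eq_one_of_norm_sub_one_lt hm ?_ ?_)
  · rw [div_pow, hz, hw, div_one]
  · rwa [div_sub_one hw0, norm_div, hw1, div_one]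

/-- Teichmüller representatives. -/
lemma exists_pow_eq_self [CompleteSpace K] {q : ℕ} (hq : ‖(q : K)‖ < 1) {a : K} (ha : ‖a‖ ≤ 1)
    (h : ‖a ^ q - a‖ < 1) : ∃ z : K, z ^ q = z ∧ ‖z - a‖ < 1 := by
  -- Bounding both the first difference and q by r gains a factor r at each q-th power.
  set r := max ‖a ^ q - a‖ ‖(q : K)‖ with hr
  have hr0 : 0 ≤ r := (norm_nonneg _).trans (le_max_right _ _)
  have hr1 : r < 1 := max_lt h hq
  let x : ℕ → K := fun j => a ^ q ^ j
  have hx1 : ∀ j, ‖x j‖ ≤ 1 := fun j => by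
    rw [norm_pow]
    exact pow_le_one₀ (norm_nonneg _) ha
  have hxs : ∀ j, x (j + 1) = x j ^ q := fun j => by simp only [x, pow_succ, pow_mul]
  have hstep : ∀ j, ‖x (j + 1) - x j‖ ≤ r * r ^ j := by
    intro j
    induction j with
    | zero => simp [x, r]
    | succ j ih =>
      have h1 : ‖x (j + 1) - x j‖ ≤ r := ih.trans (mul_le_of_le_one_right hr0 (pow_le_one₀ hr0 hr1.le))
      rw [hxs (j + 1), hxs j, ← hxs j]
      nth_rw 2 [hxs j]
      refine (norm_pow_sub_pow_le_mul (hx1 _) (hx1 _) (le_max_right _ _) h1).trans ?_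
      rw [pow_succ']
      exact mul_le_mul_of_nonneg_left ih hr0
  have hc : CauchySeq x := cauchySeq_of_le_geometric r r hr1 fun j => by
    rw [dist_comm, dist_eq_norm]
    exact hstep j
  obtain ⟨z, hz⟩ := cauchySeq_tendsto_of_complete hc
  refine ⟨z, ?_, ?_⟩
  · refine tendsto_nhds_unique (hz.pow q) ?_
    simp_rw [← hxs]
    exact hz.comp (Filter.tendsto_add_atTop_nat 1)
  · refine lt_of_le_of_lt (le_of_tendsto (hz.sub_const a).norm
      (Filter.Eventually.of_forall fun j => ?_)) hr1
    induction j with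
    | zero => simpa [x] using hr0
    | succ j ih =>
      rw [← sub_add_sub_cancel _ (x j) a]
      exact (IsUltrametricDist.norm_add_le_max _ _).trans (max_le ((hstep j).trans
        (mul_le_of_le_one_right hr0 (pow_le_one₀ hr0 hr1.le))) ih)

end ultrametric

/-! ### Roots of unity in F_v. -/

section place
variable {F : Type*} [Field F] [NumberField F] (v : HeightOneSpectrum (𝓞 F))

lemma norm_algebraMap_lt_one_iff (x : 𝓞 F) :
    ‖algebraMap F (v.adicCompletion F) (algebraMap (𝓞 F) F x)‖ < 1 ↔ x ∈ v.asIdeal :=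
  FinitePlace.norm_lt_one_iff_mem F v x

lemma norm_algebraMap_le_one (x : 𝓞 F) : ‖algebraMap F (v.adicCompletion F) (algebraMap (𝓞 F) F x)‖ ≤ 1 :=
  FinitePlace.norm_le_one F v x

lemma pow_absNorm_sub_mem (x : 𝓞 F) : x ^ Ideal.absNorm v.asIdeal - x ∈ v.asIdeal := by
  have := v.isMaximal
  let : Field (𝓞 F ⧸ v.asIdeal) := Ideal.Quotient.field _
  have : Finite (𝓞 F ⧸ v.asIdeal) := v.asIdeal.finiteQuotientOfFreeOfNeBot v.ne_bot
  have := Fintype.ofFinite (𝓞 F ⧸ v.asIdeal)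
  have hcard : Nat.card (𝓞 F ⧸ v.asIdeal) = Ideal.absNorm v.asIdeal :=
    (Submodule.cardQuot_apply _).symm
  rw [← Ideal.Quotient.eq, map_pow, ← hcard, Nat.card_eq_fintype_card]
  exact FiniteField.pow_card _

lemma norm_absNorm_lt_one : ‖(Ideal.absNorm v.asIdeal : v.adicCompletion F)‖ < 1 := by
  have h := (norm_algebraMap_lt_one_iff v (Ideal.absNorm v.asIdeal : 𝓞 F)).2 (Ideal.absNorm_mem _)
  simpa using h

/-- `F_v` contains the roots of unity of order `N v - 1`. -/
lemma exists_isPrimitiveRoot_completion :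
    ∃ z : v.adicCompletion F, IsPrimitiveRoot z (Ideal.absNorm v.asIdeal - 1) := by
  have := v.isMaximal
  let : Field (𝓞 F ⧸ v.asIdeal) := Ideal.Quotient.field _
  have : Finite (𝓞 F ⧸ v.asIdeal) := v.asIdeal.finiteQuotientOfFreeOfNeBot v.ne_bot
  obtain ⟨g, hg⟩ := IsCyclic.exists_ofOrder_eq_natCard (α := (𝓞 F ⧸ v.asIdeal)ˣ)
  rw [Nat.card_units] at hg
  obtain ⟨a, ha⟩ := Ideal.Quotient.mk_surjective (g : 𝓞 F ⧸ v.asIdeal)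
  have hq : 1 < Ideal.absNorm v.asIdeal := HeightOneSpectrum.one_lt_absNorm v
  have h1 := (norm_algebraMap_lt_one_iff v _).2 (pow_absNorm_sub_mem v a)
  rw [map_sub, map_sub, map_pow, map_pow] at h1
  -- z is the Teichmüller lift of a generator of the units of the residue field; its order is read
  -- off from the residue.
  obtain ⟨z, hz, hza⟩ := exists_pow_eq_self (norm_absNorm_lt_one v) (norm_algebraMap_le_one v a) h1
  have ha1 : ¬ ‖algebraMap F (v.adicCompletion F) (algebraMap (𝓞 F) F a)‖ < 1 := by
    rw [norm_algebraMap_lt_one_iff, ← Ideal.Quotient.eq_zero_iff_mem, ha]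
    exact g.ne_zero
  have hz0 : z ≠ 0 := by
    rintro rfl
    rw [zero_sub, norm_neg] at hza
    exact ha1 hza
  have hz1 : z ^ (Ideal.absNorm v.asIdeal - 1) = 1 := by
    refine mul_right_cancel₀ hz0 ?_
    rw [← pow_succ, Nat.sub_add_cancel hq.le, hz, one_mul]
  refine ⟨z, hz1, fun d hd => ?_⟩
  have h2 := (norm_pow_sub_pow_le (norm_eq_one_of_pow (by omega) hz1).le
    (norm_algebraMap_le_one v a) d).trans_lt hza
  rw [hd, ← map_pow, ← map_pow, ← map_one (algebraMap F (v.adicCompletion F)),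
    ← map_one (algebraMap (𝓞 F) F), ← map_sub, ← map_sub, norm_algebraMap_lt_one_iff,
    ← Ideal.Quotient.eq, map_one, map_pow, ha] at h2
  have h3 : g ^ d = 1 := Units.ext (by simpa using h2.symm)
  have h4 := orderOf_dvd_of_pow_eq_one h3
  rw [hg] at h4
  exact h4

lemma exists_norm_sub_algebraMap_lt_one {x : v.adicCompletion F} (hx : ‖x‖ ≤ 1) :
    ∃ b : 𝓞 F, ‖x - algebraMap F (v.adicCompletion F) (algebraMap (𝓞 F) F b)‖ < 1 := by
  obtain ⟨y, hy⟩ := (HeightOneSpectrum.denseRange_algebraMap F v).exists_dist_lt x one_pos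
  rw [dist_eq_norm] at hy
  have hy1 : ‖algebraMap F (v.adicCompletion F) y‖ ≤ 1 := by
    rw [← sub_sub_cancel x (algebraMap F (v.adicCompletion F) y)]
    exact (norm_sub_le_max_of_ultrametric _ _).trans (max_le hx hy.le)
  have key : ∀ z : F, ‖algebraMap F (v.adicCompletion F) z‖
      = WithZeroMulInt.toNNReal (HeightOneSpectrum.absNorm_ne_zero v) (v.valuation F z) :=
    fun z => FinitePlace.norm_embedding' (v := v) z
  have hN := HeightOneSpectrum.one_lt_absNorm_nnreal v
  rw [key, ← NNReal.coe_one, NNReal.coe_le_coe, WithZeroMulInt.toNNReal_le_one_iff hN] at hy1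
  obtain ⟨b, hb⟩ := v.exists_valuation_sub_lt_of_integer hy1 1
  refine ⟨b, ?_⟩
  have h1 : ‖algebraMap F (v.adicCompletion F) (algebraMap (𝓞 F) F b - y)‖ < 1 := by
    rw [key, ← NNReal.coe_one, NNReal.coe_lt_coe, WithZeroMulInt.toNNReal_lt_one_iff hN]
    simpa using hb
  rw [map_sub, norm_sub_rev] at h1
  rw [← sub_add_sub_cancel x (algebraMap F (v.adicCompletion F) y)]
  exact (IsUltrametricDist.norm_add_le_max _ _).trans_lt (max_lt hy h1)

/-- The roots of unity of order prime to `p` in `F_v` have order dividing `N v - 1`. -/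
lemma dvd_absNorm_sub_one {m : ℕ} (hm : ‖(m : v.adicCompletion F)‖ = 1) {z : v.adicCompletion F}
    (hz : IsPrimitiveRoot z m) : m ∣ Ideal.absNorm v.asIdeal - 1 := by
  have hm0 : m ≠ 0 := by
    rintro rfl
    simp at hm
  have hz1 : ‖z‖ = 1 := norm_eq_one_of_pow hm0 hz.pow_eq_one
  obtain ⟨b, hb⟩ := exists_norm_sub_algebraMap_lt_one v hz1.le
  have h1 := (norm_algebraMap_lt_one_iff v _).2 (pow_absNorm_sub_mem v b)
  rw [map_sub, map_sub, map_pow, map_pow] at h1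
  have h2 := (norm_pow_sub_pow_le hz1.le (norm_algebraMap_le_one v b)
    (Ideal.absNorm v.asIdeal)).trans_lt hb
  -- z and its N v-th power have the same residue; being m-th roots of unity with m a unit, they
  -- coincide.
  have h3 : ‖z ^ Ideal.absNorm v.asIdeal - z‖ < 1 := by
    have e : z ^ Ideal.absNorm v.asIdeal - z
        = (z ^ Ideal.absNorm v.asIdeal
            - algebraMap F (v.adicCompletion F) (algebraMap (𝓞 F) F b) ^ Ideal.absNorm v.asIdeal)
          + (algebraMap F (v.adicCompletion F) (algebraMap (𝓞 F) F b) ^ Ideal.absNorm v.asIdeal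
            - algebraMap F (v.adicCompletion F) (algebraMap (𝓞 F) F b))
          - (z - algebraMap F (v.adicCompletion F) (algebraMap (𝓞 F) F b)) := by ring
    rw [e]
    exact (norm_sub_le_max_of_ultrametric _ _).trans_lt (max_lt
      ((IsUltrametricDist.norm_add_le_max _ _).trans_lt (max_lt h2 h1)) hb)
  have h4 : z ^ Ideal.absNorm v.asIdeal = z :=
    eq_of_norm_sub_lt hm (by rw [← pow_mul, mul_comm, pow_mul, hz.pow_eq_one, one_pow])
      hz.pow_eq_one h3
  refine hz.dvd_of_pow_eq_one _ (mul_right_cancel₀ (hz.ne_zero hm0) ?_)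
  rw [← pow_succ, Nat.sub_add_cancel (HeightOneSpectrum.one_lt_absNorm v).le, h4, one_mul]

end place

/-! ### Residue fields and integral polynomials modulo p. -/

section residue
variable (K : Type*) [NormedField K] [IsUltrametricDist K]

/-- The residue field of an ultrametric normed field. -/
abbrev UltrametricResidueField : Type _ :=
  IsLocalRing.ResidueField (NormedField.valuation (K := K)).valuationSubring

variable {K}
lemma residue_eq_zero_iff_norm_lt_one (x : (NormedField.valuation (K := K)).valuationSubring) :
    IsLocalRing.residue _ x = 0 ↔ ‖(x : K)‖ < 1 := by
  rw [IsLocalRing.residue_eq_zero_iff, Valuation.mem_maximalIdeal_iff]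
  exact Iff.rfl

variable (K) in
lemma charP_ultrametricResidueField (p : ℕ) [Fact p.Prime] (hp : ‖(p : K)‖ < 1) :
    CharP (UltrametricResidueField K) p := by
  refine (CharP.charP_iff_prime_eq_zero Fact.out).2 ?_
  rw [← map_natCast (IsLocalRing.residue (NormedField.valuation (K := K)).valuationSubring),
    residue_eq_zero_iff_norm_lt_one]
  simpa using hp

open Polynomial in
lemma exists_map_intCast_eq {κ : Type*} [Field κ] (p : ℕ) [Fact p.Prime] [CharP κ p] (g : κ[X])
    (hg : g.map (frobenius κ p) = g) : ∃ h : ℤ[X], h.map (Int.castRingHom κ) = g := by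
  rw [← mem_lifts, lifts_iff_coeff_lifts]
  intro n
  have h1 : g.coeff n ^ p = g.coeff n := by
    conv_rhs => rw [← hg, coeff_map, frobenius_def]
  obtain ⟨m, hm⟩ := (_root_.mem_bot_iff_intCast p κ).1 ((Subfield.mem_bot_iff_pow_eq_self κ p).2 h1)
  exact ⟨m, by simpa using hm⟩

open Polynomial in
/-- The integral polynomial with roots modulo `p` the `w ^ p ^ i`. -/
lemma exists_intPolynomial_forall_norm_eval {p : ℕ} [Fact p.Prime] (hp : ‖(p : K)‖ < 1) {D : ℕ} {w : K}
    (hw1 : ‖w‖ ≤ 1) (hD : w ^ p ^ D = w) : ∃ G : ℤ[X], ∀ z : K, ‖z‖ ≤ 1 →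
      (‖aeval z G‖ < 1 ↔ ∃ i < D, ‖z - w ^ p ^ i‖ < 1) := by
  have := charP_ultrametricResidueField K p hp
  let A := (NormedField.valuation (K := K)).valuationSubring
  let W : A := ⟨w, hw1⟩
  let r := IsLocalRing.residue A
  have hWD : W ^ p ^ D = W := Subtype.ext hD
  let g : (UltrametricResidueField K)[X] := ∏ i ∈ Finset.range D, (X - C (r W ^ p ^ i))
  -- Since w^(p^D) = w, Frobenius permutes the factors of g cyclically, so its coefficients lie in
  -- 𝔽_p and lift to ℤ.
  have hg : g.map (frobenius _ p) = g := by
    have h1 : g.map (frobenius _ p) = ∏ i ∈ Finset.range D, (X - C (r W ^ p ^ (i + 1))) := by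
      rw [Polynomial.map_prod]
      refine Finset.prod_congr rfl fun i _ => ?_
      rw [Polynomial.map_sub, map_X, map_C, frobenius_def, ← pow_mul, ← pow_succ]
    have h2 := (Finset.prod_range_succ (fun i => X - C (r W ^ p ^ i)) D).symm.trans
      (Finset.prod_range_succ' (fun i => X - C (r W ^ p ^ i)) D)
    have h3 : r W ^ p ^ D = r W ^ p ^ 0 := by rw [← map_pow, hWD, pow_zero, pow_one]
    rw [h1]
    rw [h3] at h2
    exact (mul_right_cancel₀ (X_sub_C_ne_zero _) h2).symm
  obtain ⟨G, hG⟩ := exists_map_intCast_eq p g hg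
  refine ⟨G, fun z hz => ?_⟩
  let Z : A := ⟨z, hz⟩
  have h1 : ((aeval Z G : A) : K) = aeval z G :=
    (aeval_algHom_apply A.subtype.toIntAlgHom Z G).symm
  have h2 : r (aeval Z G) = g.eval (r Z) := by
    rw [← hG, eval_map]
    exact (aeval_algHom_apply r.toIntAlgHom Z G).symm
  rw [← h1, ← residue_eq_zero_iff_norm_lt_one]
  change r _ = 0 ↔ _
  rw [h2, eval_prod, Finset.prod_eq_zero_iff]
  refine exists_congr fun i => and_congr Finset.mem_range ?_
  rw [eval_sub, eval_X, eval_C, ← map_pow, ← map_sub]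
  exact residue_eq_zero_iff_norm_lt_one _

open Polynomial in
-- Frobenius of the residue field fixes the reduced coefficients of G, so it maps roots of G to
-- roots.
lemma norm_aeval_pow_lt_one {p : ℕ} [Fact p.Prime] (hp : ‖(p : K)‖ < 1) (G : ℤ[X]) {z : K}
    (hz : ‖z‖ ≤ 1) (h : ‖aeval z G‖ < 1) : ‖aeval (z ^ p) G‖ < 1 := by
  have := charP_ultrametricResidueField K p hp
  let A := (NormedField.valuation (K := K)).valuationSubring
  let r := IsLocalRing.residue A
  have key : ∀ Z : A, ‖aeval (Z : K) G‖ < 1 ↔ aeval (r Z) G = 0 := fun Z => by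
    have h1 : ((aeval Z G : A) : K) = aeval (Z : K) G :=
      (aeval_algHom_apply A.subtype.toIntAlgHom Z G).symm
    have h2 : r (aeval Z G) = aeval (r Z) G := (aeval_algHom_apply r.toIntAlgHom Z G).symm
    rw [← h1, ← h2, residue_eq_zero_iff_norm_lt_one]
  let Z : A := ⟨z, hz⟩
  have h1 : aeval (r Z) G = 0 := (key Z).1 h
  refine (key (Z ^ p)).2 ?_
  rw [map_pow]
  refine (aeval_algHom_apply (frobenius (UltrametricResidueField K) p).toIntAlgHom (r Z) G).trans ?_
  rw [h1, map_zero]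

end residue

/-! ### Frobenius on an algebraic closure of ℚ_p. -/

section frobenius
variable (p : ℕ) [Fact p.Prime] {Ω : Type*} [NormedField Ω] [IsUltrametricDist Ω]
  [NormedAlgebra ℚ_[p] Ω] [IsAlgClosed Ω] [Algebra.IsAlgebraic ℚ_[p] Ω]

lemma norm_algEquiv_apply (t : Gal(Ω/ℚ_[p])) (z : Ω) : ‖t z‖ = ‖z‖ := by
  rw [NormedAlgebra.norm_eq_spectralNorm ℚ_[p], NormedAlgebra.norm_eq_spectralNorm ℚ_[p]]
  exact (spectralNorm_eq_of_equiv t z).symm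

lemma norm_natCast_eq_norm_padic (n : ℕ) : ‖(n : Ω)‖ = ‖(n : ℚ_[p])‖ := by
  rw [← map_natCast (algebraMap ℚ_[p] Ω), norm_algebraMap']

lemma norm_prime_lt_one : ‖(p : Ω)‖ < 1 := by
  rw [norm_natCast_eq_norm_padic p]
  exact Padic.norm_p_lt_one

lemma norm_natCast_eq_one_of_coprime {m : ℕ} (hm : p.Coprime m) : ‖(m : Ω)‖ = 1 := by
  rw [norm_natCast_eq_norm_padic p, Padic.norm_natCast_eq_one_iff]
  exact hm

/-- Every automorphism acts on a root of unity of order prime to `p` as a power of Frobenius. -/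
lemma exists_apply_eq_pow_prime_pow {m : ℕ} (hm : p.Coprime m) {w : Ω} (hw : w ^ m = 1)
    (t : Gal(Ω/ℚ_[p])) : ∃ i : ℕ, t w = w ^ p ^ i := by
  have hm0 : m ≠ 0 := by
    rintro rfl
    exact (Fact.out : p.Prime).one_lt.ne' ((Nat.coprime_zero_right p).1 hm)
  have hw1 := norm_eq_one_of_pow hm0 hw
  have hD : w ^ p ^ m.totient = w := by
    have h := pow_eq_pow_mod (p ^ m.totient) hw
    rw [Nat.ModEq.pow_totient hm] at h
    rw [h, ← pow_eq_pow_mod 1 hw, pow_one]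
  -- The roots of G modulo p are the iterates w^(p^i). The isometry t fixes the coefficients of G,
  -- so t w is congruent to an iterate, and congruent m-th roots of unity are equal.
  obtain ⟨G, hG⟩ := exists_intPolynomial_forall_norm_eval (norm_prime_lt_one p) hw1.le hD
  have h1 : ‖Polynomial.aeval w G‖ < 1 :=
    (hG w hw1.le).2 ⟨0, Nat.totient_pos.2 (Nat.pos_of_ne_zero hm0), by simp⟩
  have h2 : ‖Polynomial.aeval (t w) G‖ < 1 := by
    have : Polynomial.aeval (t w) G = t (Polynomial.aeval w G) := by
      rw [Polynomial.aeval_def, Polynomial.aeval_def]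
      have := Polynomial.hom_eval₂ G (algebraMap ℤ Ω) (t : Ω →+* Ω) w
      rw [RingHom.eq_intCast' ((t : Ω →+* Ω).comp _), ← RingHom.eq_intCast' (algebraMap ℤ Ω)] at this
      exact this.symm
    rw [this, norm_algEquiv_apply]
    exact h1
  obtain ⟨i, -, hi⟩ := (hG (t w) ((norm_algEquiv_apply p t w).trans hw1).le).1 h2
  refine ⟨i, eq_of_norm_sub_lt (norm_natCast_eq_one_of_coprime p hm) ?_ ?_ hi⟩
  · rw [← map_pow, hw, map_one]
  · rw [← pow_mul, mul_comm, pow_mul, hw, one_pow]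

open Polynomial in
lemma exists_intPolynomial_norm_sub_lt (h : ℚ_[p][X]) (hcoef : ∀ n, ‖h.coeff n‖ ≤ 1) :
    ∃ G : ℤ[X], ∀ z : Ω, ‖z‖ ≤ 1 → ‖aeval z h - aeval z G‖ < 1 := by
  have h1 : ∀ n, ∃ a : ℤ, ‖h.coeff n - a‖ < 1 := by
    intro n
    obtain ⟨x, hx⟩ : ∃ x : ℤ_[p], (x : ℚ_[p]) = h.coeff n := ⟨⟨h.coeff n, hcoef n⟩, rfl⟩
    obtain ⟨a, -, ha⟩ := PadicInt.exists_mem_range x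
    rw [PadicInt.maximalIdeal_eq_span_p, Ideal.mem_span_singleton,
      ← PadicInt.norm_lt_one_iff_dvd] at ha
    refine ⟨a, ?_⟩
    rw [PadicInt.norm_def, PadicInt.coe_sub, PadicInt.coe_natCast, hx] at ha
    rwa [Int.cast_natCast]
  choose a ha using h1
  refine ⟨∑ i ∈ Finset.range (h.natDegree + 1), C (a i) * X ^ i, fun z hz => ?_⟩
  rw [aeval_eq_sum_range, map_sum, ← Finset.sum_sub_distrib]
  refine Finset.sum_induction _ (fun x : Ω => ‖x‖ < 1)
    (fun x y hx hy => (IsUltrametricDist.norm_add_le_max _ _).trans_lt (max_lt hx hy))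
    (by simp) fun i _ => ?_
  have e : h.coeff i • z ^ i - aeval z (C (a i) * X ^ i)
      = algebraMap ℚ_[p] Ω (h.coeff i - a i) * z ^ i := by
    rw [map_mul, map_pow, aeval_X, aeval_C, Algebra.smul_def, map_sub, sub_mul, map_intCast,
      eq_intCast]
  rw [e, norm_mul, norm_algebraMap', norm_pow]
  exact (mul_le_of_le_one_right (norm_nonneg _) (pow_le_one₀ (norm_nonneg _) hz)).trans_lt (ha i)

open Polynomial in
/-- The Frobenius automorphism of the maximal unramified extension, lifted. -/
lemma exists_apply_eq_pow_prime {m : ℕ} (hm : p.Coprime m) {w : Ω} (hw : w ^ m = 1) :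
    ∃ t : Gal(Ω/ℚ_[p]), t w = w ^ p := by
  have hm0 : m ≠ 0 := by
    rintro rfl
    exact (Fact.out : p.Prime).one_lt.ne' ((Nat.coprime_zero_right p).1 hm)
  have hw1 := norm_eq_one_of_pow hm0 hw
  have hwp : ‖w ^ p‖ = 1 := by rw [norm_pow, hw1, one_pow]
  have hint : IsIntegral ℚ_[p] w := Algebra.IsIntegral.isIntegral w
  have := isGalois_of_isAlgClosed (k := ℚ_[p]) (Ω := Ω)
  set h := minpoly ℚ_[p] w with hh
  have hcoef : ∀ n, ‖h.coeff n‖ ≤ 1 := by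
    refine (spectralValue_le_one_iff (minpoly.monic hint)).1 (le_of_eq ?_)
    rw [← hw1, NormedAlgebra.norm_eq_spectralNorm ℚ_[p]]
    rfl
  -- G reduces to the minimal polynomial h, so h is small at w^p as well as at w. As h(w^p) is the
  -- product of the w^p - x over the conjugates x of w, one of these is congruent to w^p.
  obtain ⟨G, hG⟩ := exists_intPolynomial_norm_sub_lt p (Ω := Ω) h hcoef
  have h1 : ‖aeval w G‖ < 1 := by
    have := hG w hw1.le
    rwa [hh, minpoly.aeval, zero_sub, norm_neg] at this
  have h2 := norm_aeval_pow_lt_one (norm_prime_lt_one p) G hw1.le h1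
  have h3 : ‖aeval (w ^ p) h‖ < 1 := by
    rw [← sub_add_cancel (aeval (w ^ p) h) (aeval (w ^ p) G)]
    exact (IsUltrametricDist.norm_add_le_max _ _).trans_lt (max_lt (hG _ hwp.le) h2)
  rw [(IsAlgClosed.splits _).aeval_eq_prod_aroots_of_monic (minpoly.monic hint)] at h3
  obtain ⟨x, hx, hx1⟩ : ∃ x ∈ h.aroots Ω, ‖w ^ p - x‖ < 1 := by
    by_contra! hcon
    refine absurd h3 (not_lt.2 ?_)
    refine Multiset.prod_induction (fun y : Ω => 1 ≤ ‖y‖) _ (fun a b ha hb => ?_) norm_one.ge ?_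
    · rw [norm_mul]
      exact one_le_mul_of_one_le_of_one_le ha hb
    · intro y hy
      obtain ⟨x, hx, rfl⟩ := Multiset.mem_map.1 hy
      exact hcon x hx
  have hconj : IsConjRoot ℚ_[p] w x :=
    (isConjRoot_iff_mem_minpoly_aroots hint).2 hx
  obtain ⟨t, rfl⟩ := isConjRoot_iff_exists_algEquiv.1 hconj.symm
  refine ⟨t, (eq_of_norm_sub_lt (norm_natCast_eq_one_of_coprime p hm) ?_ ?_ hx1).symm⟩
  · rw [← pow_mul, mul_comm, pow_mul, hw, one_pow]
  · rw [← map_pow, hw, map_one]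

end frobenius

/-! ### Divisibility among the numbers p^a - 1. -/

section arithmetic

lemma dvd_of_pow_sub_one_dvd_pow_sub_one {p a j : ℕ} (hp : 1 < p) (h : p ^ a - 1 ∣ p ^ j - 1) :
    a ∣ j := by
  have h1 := Nat.gcd_eq_left h
  rw [Nat.pow_sub_one_gcd_pow_sub_one] at h1
  have h2 : p ^ a.gcd j = p ^ a := by
    have := Nat.one_le_pow (a.gcd j) p (by omega)
    have := Nat.one_le_pow a p (by omega)
    omega
  exact Nat.gcd_eq_left_iff_dvd.1 (Nat.pow_right_injective hp h2)

lemma pow_sub_one_dvd_pow_sub_one_of_dvd (p : ℕ) {a j : ℕ} (h : a ∣ j) :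
    p ^ a - 1 ∣ p ^ j - 1 := by
  obtain ⟨c, rfl⟩ := h
  rw [pow_mul]
  simpa using Nat.sub_dvd_pow_sub_pow (p ^ a) 1 c

lemma dvd_pow_totient_mul_sub_one {p n : ℕ} (h : p.Coprime n) (a : ℕ) :
    n ∣ p ^ (a * n.totient) - 1 := by
  have h1 : n ∣ p ^ n.totient - 1 := by
    rcases Nat.eq_zero_or_pos (p ^ n.totient) with h0 | h0
    · rw [h0]; simp
    · exact (Nat.modEq_iff_dvd' h0).1 (Nat.ModEq.pow_totient h).symm
  exact h1.trans (pow_sub_one_dvd_pow_sub_one_of_dvd p (Dvd.intro_left a rfl))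

/-- The order of `p` modulo `l ^ N` is divisible by high powers of `l`. -/
lemma exists_forall_dvd_of_dvd_pow_sub_one {p l : ℕ} [Fact p.Prime] [Fact l.Prime] (h : p ≠ l)
    (c : ℕ) : ∃ N : ℕ, ∀ j : ℕ, l ^ N ∣ p ^ j - 1 → l ^ c ∣ j := by
  have hp := (Fact.out : p.Prime)
  have hl := (Fact.out : l.Prime)
  have hl1 : 0 < l - 1 := Nat.sub_pos_of_lt hl.one_lt
  -- If ℓ^c ∤ j, the gcd of j and φ(ℓ^N) divides B, so ℓ^N divides p^B - 1. The choice N = p^B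
  -- excludes this, because ℓ^N > N.
  set B := l ^ c * (l - 1) with hB
  have hB0 : 0 < B := Nat.mul_pos (pow_pos hl.pos c) hl1
  refine ⟨p ^ B, fun j hj => ?_⟩
  by_contra hcj
  set N := p ^ B with hN
  have hN0 : 0 < N := pow_pos hp.pos B
  have hcop : p.Coprime (l ^ N) := Nat.Coprime.pow_right N ((Nat.coprime_primes hp hl).2 h)
  have h1 : l ^ N ∣ p ^ (j.gcd (l ^ N).totient) - 1 := by
    rw [← Nat.pow_sub_one_gcd_pow_sub_one]
    refine Nat.dvd_gcd hj ?_
    simpa using dvd_pow_totient_mul_sub_one hcop 1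
  have h2 : j.gcd (l ^ N).totient ∣ B := by
    rw [Nat.totient_prime_pow hl hN0]
    obtain ⟨u, v, hu, hv, huv⟩ := Nat.dvd_mul.1
      (Nat.gcd_dvd_right j (l ^ (N - 1) * (l - 1)))
    obtain ⟨m, -, rfl⟩ := (Nat.dvd_prime_pow hl).1 hu
    rw [← huv, hB]
    refine mul_dvd_mul (pow_dvd_pow l ?_) hv
    by_contra hmc
    refine hcj ((pow_dvd_pow l (by omega : c ≤ m)).trans ?_)
    exact (Dvd.intro v huv).trans (Nat.gcd_dvd_left _ _)
  have h3 := Nat.le_of_dvd (Nat.sub_pos_of_lt (Nat.one_lt_pow hB0.ne' hp.one_lt))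
    (h1.trans (pow_sub_one_dvd_pow_sub_one_of_dvd p h2))
  have h4 : N < l ^ N := Nat.lt_pow_self hl.one_lt
  omega

lemma pow_pow_eq_self {R : Type*} [Monoid R] {p a i : ℕ} (hp : 0 < p) {z : R} (hz : z ^ (p ^ a - 1) = 1)
    (h : a ∣ i) : z ^ p ^ i = z := by
  obtain ⟨c, hc⟩ := pow_sub_one_dvd_pow_sub_one_of_dvd p h
  have h1 : z ^ (p ^ i - 1) = 1 := by rw [hc, pow_mul, hz, one_pow]
  have h2 : p ^ i = (p ^ i - 1) + 1 := (Nat.sub_add_cancel (Nat.one_le_pow _ _ hp)).symm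
  rw [h2, pow_succ, h1, one_mul]

end arithmetic

/-! ### For p ≠ ℓ the cyclotomic ℤ_ℓ-extension of ℚ_p is unramified. -/

section unramified
variable (p : ℕ) [Fact p.Prime] {Ω : Type*} [Field Ω] [Algebra ℚ_[p] Ω] [IsAlgClosed Ω]
  [Algebra.IsAlgebraic ℚ_[p] Ω]

/-- The spectral norm makes Ω an ultrametric normed field, so the normed results yield a purely
algebraic statement. -/
lemma exists_frobenius_on_roots {m : ℕ} (hm : p.Coprime m) {w : Ω} (hw : w ^ m = 1) :
    (∃ t : Gal(Ω/ℚ_[p]), t w = w ^ p) ∧ ∀ t : Gal(Ω/ℚ_[p]), ∃ i : ℕ, t w = w ^ p ^ i := by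
  let : NormedField Ω := spectralNorm.normedField ℚ_[p] Ω
  let : NormedAlgebra ℚ_[p] Ω := spectralNorm.normedAlgebra ℚ_[p] Ω
  have : IsUltrametricDist Ω :=
    IsUltrametricDist.isUltrametricDist_of_isNonarchimedean_norm isNonarchimedean_spectralNorm
  exact ⟨exists_apply_eq_pow_prime p hm hw, exists_apply_eq_pow_prime_pow p hm hw⟩

lemma coprime_pow_sub_one {R : ℕ} (hR : R ≠ 0) : p.Coprime (p ^ R - 1) := by
  have hp := (Fact.out : p.Prime)
  have h : (p ^ R).Coprime (p ^ R - 1) :=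
    (Nat.coprime_self_sub_right (Nat.one_le_pow _ _ hp.pos)).2 (Nat.coprime_one_right _)
  exact Nat.Coprime.coprime_dvd_left (dvd_pow_self p hR) h

lemma pow_sub_one_ne_zero {R : ℕ} (hR : R ≠ 0) : p ^ R - 1 ≠ 0 :=
  (Nat.sub_pos_of_lt (Nat.one_lt_pow hR (Fact.out : p.Prime).one_lt)).ne'

lemma exists_frobenius {R : ℕ} (hR : R ≠ 0) : ∃ s : Gal(Ω/ℚ_[p]), ∀ z : Ω,
    z ^ (p ^ R - 1) = 1 → ∀ i : ℕ, (s ^ i) z = z ^ p ^ i := by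
  have := charZero_of_algebra ℚ_[p] Ω
  have hn := pow_sub_one_ne_zero p hR
  have := NeZero.mk hn
  obtain ⟨w, hw⟩ := exists_isPrimitiveRoot_of_isAlgClosed Ω hn
  obtain ⟨s, hs⟩ := (exists_frobenius_on_roots p (coprime_pow_sub_one p hR) hw.pow_eq_one).1
  refine ⟨s, fun z hz i => ?_⟩
  obtain ⟨b, -, rfl⟩ := hw.eq_pow_of_pow_eq_one hz
  induction i with
  | zero => simp
  | succ i ih =>
    rw [pow_succ', AlgEquiv.mul_apply, ih, map_pow, map_pow, hs, ← pow_mul, ← pow_mul, ← pow_mul]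
    congr 1
    ring

lemma exists_forall_apply_eq_pow {R : ℕ} (hR : R ≠ 0) (t : Gal(Ω/ℚ_[p])) : ∃ i : ℕ, ∀ z : Ω,
    z ^ (p ^ R - 1) = 1 → ∀ e : ℕ, (t ^ e) z = z ^ p ^ (i * e) := by
  have := charZero_of_algebra ℚ_[p] Ω
  have hn := pow_sub_one_ne_zero p hR
  have := NeZero.mk hn
  obtain ⟨w, hw⟩ := exists_isPrimitiveRoot_of_isAlgClosed Ω hn
  obtain ⟨i, hi⟩ := (exists_frobenius_on_roots p (coprime_pow_sub_one p hR) hw.pow_eq_one).2 t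
  refine ⟨i, fun z hz e => ?_⟩
  obtain ⟨b, -, rfl⟩ := hw.eq_pow_of_pow_eq_one hz
  induction e with
  | zero => simp
  | succ e ih =>
    rw [pow_succ', AlgEquiv.mul_apply, ih, map_pow, map_pow, hi, ← pow_mul, ← pow_mul, ← pow_mul]
    congr 1
    ring

variable {p}
/-- A finite extension inside the cyclotomic `ℤ_l`-extension of `ℚ_p` is unramified. -/
lemma mem_of_pow_eq_one_of_le_cyclotomicZqExtension {l : ℕ} [Fact l.Prime] (hpl : p ≠ l)
    {M : IntermediateField ℚ_[p] Ω} [FiniteDimensional ℚ_[p] M]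
    (hM : M ≤ cyclotomicZqExtension ℚ_[p] Ω l) {z : Ω}
    (hz : z ^ (p ^ Module.finrank ℚ_[p] M - 1) = 1) : z ∈ M := by
  have hp := (Fact.out : p.Prime)
  have hl := (Fact.out : l.Prime)
  have := isGalois_of_isAlgClosed (k := ℚ_[p]) (Ω := Ω)
  have : IsAbelianGalois ℚ_[p] M := isAbelianGalois_of_le_cyclotomicZHatExtension
    (hM.trans (le_iSup (fun q : Nat.Primes => cyclotomicZqExtension ℚ_[p] Ω q) ⟨l, hl⟩))
  obtain ⟨N, hN⟩ := exists_level (hM.trans (IntermediateField.lift_le _))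
  set d := Module.finrank ℚ_[p] M with hd
  have hd0 : d ≠ 0 := Module.finrank_pos.ne'
  have hcop : p.Coprime (l ^ N) := Nat.Coprime.pow_right N ((Nat.coprime_primes hp hl).2 hpl)
  -- With this R, μ_{p^R - 1} contains both μ_{ℓ^N}, which controls M, and μ_{p^d - 1}.
  set R := d * (l ^ N).totient with hR
  have hR0 : R ≠ 0 := mul_ne_zero hd0 (Nat.totient_pos.2 (pow_pos hl.pos N)).ne'
  obtain ⟨c, hc⟩ := dvd_pow_totient_mul_sub_one hcop d
  have hroot : ∀ z : Ω, z ^ l ^ N = 1 → z ^ (p ^ R - 1) = 1 := fun z hz => by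
    rw [hR, hc, pow_mul, hz, one_pow]
  obtain ⟨s, hs⟩ := exists_frobenius p (Ω := Ω) hR0
  set u := AlgEquiv.restrictNormalHom M s with hu
  have key : ∀ (t : Gal(Ω/ℚ_[p])) (i : ℕ), (∀ z : Ω, z ^ (p ^ R - 1) = 1 → t z = z ^ p ^ i) →
      AlgEquiv.restrictNormalHom M t = u ^ i := by
    intro t i ht
    have h1 : ∀ y ∈ M, ((s ^ i)⁻¹ * t) y = y := hN _ fun z hz => by
      rw [AlgEquiv.mul_apply, ht z (hroot z hz), ← hs z (hroot z hz) i, ← AlgEquiv.mul_apply,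
        inv_mul_cancel, AlgEquiv.one_apply]
    rw [hu, ← map_pow]
    ext y
    have h2 := congrArg (s ^ i) (h1 y y.2)
    rw [← AlgEquiv.mul_apply, mul_inv_cancel_left] at h2
    exact (AlgEquiv.restrictNormal_commutes t M y).trans
      (h2.trans (AlgEquiv.restrictNormal_commutes (s ^ i) M y).symm)
  -- Every automorphism acts on μ_{p^R - 1}, hence on M, as a power of Frobenius; so u generates the
  -- Galois group of M.
  have hord : orderOf u = d := by
    rw [orderOf_eq_card_of_forall_mem_zpowers, IsGalois.card_aut_eq_finrank]
    intro g
    obtain ⟨t, rfl⟩ := AlgEquiv.restrictNormalHom_surjective (F := ℚ_[p]) (K₁ := M) Ω g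
    obtain ⟨i, hi⟩ := exists_forall_apply_eq_pow p hR0 t
    refine ⟨i, ?_⟩
    rw [key t i fun z hz => by simpa using hi z hz 1]
    exact zpow_natCast u i
  rw [mem_iff_forall_fixingSubgroup]
  intro t ht
  obtain ⟨i, hi⟩ := exists_forall_apply_eq_pow p hR0 t
  have hi' : ∀ z : Ω, z ^ (p ^ R - 1) = 1 → t z = z ^ p ^ i := fun z hz => by simpa using hi z hz 1
  have h1 : u ^ i = 1 := by
    rw [← key t i hi']
    ext y
    exact (AlgEquiv.restrictNormal_commutes t M y).trans (ht y y.2)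
  have h2 := orderOf_dvd_of_pow_eq_one h1
  rw [hord] at h2
  obtain ⟨c', hc'⟩ := pow_sub_one_dvd_pow_sub_one_of_dvd p (Dvd.intro _ rfl : d ∣ R)
  rw [hi' z (by rw [hc', pow_mul, hz, one_pow]), pow_pow_eq_self hp.pos hz h2]

/-- On the relevant roots of unity t is raising to the power p^i. If t^e is trivial on μ_{ℓ^N} with
N large, i e is divisible by ℓ^b times the ℓ-part of e, so ℓ^b ∣ i. The exponent e serves
automorphisms that are torsion on ℚ_p(μ_{ℓ^∞}). -/
lemma exists_level_of_pow_eq_one {l : ℕ} [Fact l.Prime] (hpl : p ≠ l) {b e : ℕ} (he : e ≠ 0) {z : Ω}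
    (hz : z ^ (p ^ l ^ b - 1) = 1) : ∃ N : ℕ, ∀ t : Gal(Ω/ℚ_[p]),
      (∀ w : Ω, w ^ l ^ N = 1 → (t ^ e) w = w) → t z = z := by
  have hp := (Fact.out : p.Prime)
  have hl := (Fact.out : l.Prime)
  have := charZero_of_algebra ℚ_[p] Ω
  obtain ⟨c, e', he', rfl⟩ := Nat.exists_eq_pow_mul_and_not_dvd he l hl.ne_one
  obtain ⟨N, hN⟩ := exists_forall_dvd_of_dvd_pow_sub_one hpl (c + b)
  refine ⟨N, fun t ht => ?_⟩
  have hcop : p.Coprime (l ^ N) := Nat.Coprime.pow_right N ((Nat.coprime_primes hp hl).2 hpl)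
  set R := l ^ b * (l ^ N).totient with hR
  have hR0 : R ≠ 0 := mul_ne_zero (pow_ne_zero _ hl.ne_zero) (Nat.totient_pos.2 (pow_pos hl.pos N)).ne'
  obtain ⟨d, hd⟩ := dvd_pow_totient_mul_sub_one hcop (l ^ b)
  obtain ⟨w, hw⟩ := exists_isPrimitiveRoot_of_isAlgClosed Ω (pow_ne_zero N hl.ne_zero)
  obtain ⟨i, hi⟩ := exists_forall_apply_eq_pow p hR0 t
  have h1 := ht w hw.pow_eq_one
  rw [hi w (by rw [hR, hd, pow_mul, hw.pow_eq_one, one_pow])] at h1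
  have h2 : l ^ N ∣ p ^ (i * (l ^ c * e')) - 1 := by
    refine hw.dvd_of_pow_eq_one _ (mul_right_cancel₀ (hw.ne_zero (pow_ne_zero N hl.ne_zero)) ?_)
    rw [← pow_succ, Nat.sub_add_cancel (Nat.one_le_pow _ _ hp.pos), h1, one_mul]
  have h3 := hN _ h2
  rw [pow_add, mul_left_comm, Nat.mul_dvd_mul_iff_left (pow_pos hl.pos c)] at h3
  have h4 : l ^ b ∣ i := Nat.Coprime.dvd_of_dvd_mul_right
    (Nat.Coprime.pow_left b ((hl.coprime_iff_not_dvd).2 he')) h3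
  obtain ⟨c', hc'⟩ := pow_sub_one_dvd_pow_sub_one_of_dvd p (Dvd.intro _ rfl : l ^ b ∣ R)
  have h5 := hi z (by rw [hc', pow_mul, hz, one_pow]) 1
  rw [pow_one, mul_one, pow_pow_eq_self hp.pos hz h4] at h5
  exact h5

/-- The unramified extension of `ℚ_p` of degree `l ^ b` lies in the cyclotomic `ℤ_l`-extension. -/
lemma mem_cyclotomicZqExtension_of_pow_eq_one {l : ℕ} [Fact l.Prime] (hpl : p ≠ l) {b : ℕ} {z : Ω}
    (hz : z ^ (p ^ l ^ b - 1) = 1) : z ∈ cyclotomicZqExtension ℚ_[p] Ω l := by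
  have := isGalois_of_isAlgClosed (k := ℚ_[p]) (Ω := Ω)
  have hsub : ∀ (N : ℕ) (w : Ω), w ^ l ^ N = 1 → w ∈ primePowerCyclotomic ℚ_[p] Ω l :=
    fun N w hw => IntermediateField.subset_adjoin _ _ ⟨N, hw⟩
  have hzK : z ∈ primePowerCyclotomic ℚ_[p] Ω l := by
    rw [mem_iff_forall_fixingSubgroup]
    intro t ht
    obtain ⟨N, hN⟩ := exists_level_of_pow_eq_one hpl one_ne_zero hz
    exact hN t fun w hw => by rw [pow_one, ht w (hsub N w hw)]
  refine (IntermediateField.mem_lift (⟨z, hzK⟩ : primePowerCyclotomic ℚ_[p] Ω l)).2 ?_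
  intro g
  have hle : Subgroup.closure {s : Gal(primePowerCyclotomic ℚ_[p] Ω l/ℚ_[p]) | IsOfFinOrder s}
      ≤ MulAction.stabilizer Gal(primePowerCyclotomic ℚ_[p] Ω l/ℚ_[p])
        (⟨z, hzK⟩ : primePowerCyclotomic ℚ_[p] Ω l) := by
    refine (Subgroup.closure_le _).2 fun s hs => ?_
    -- A torsion automorphism lifts to some t with t^e trivial on all ℓ-power roots of unity; such a
    -- t fixes z.
    obtain ⟨e, he, hse⟩ := isOfFinOrder_iff_pow_eq_one.1 hs
    obtain ⟨t, rfl⟩ := AlgEquiv.restrictNormalHom_surjective (F := ℚ_[p])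
      (K₁ := primePowerCyclotomic ℚ_[p] Ω l) Ω s
    obtain ⟨N, hN⟩ := exists_level_of_pow_eq_one hpl he.ne' hz
    refine Subtype.ext ((AlgEquiv.restrictNormal_commutes t (primePowerCyclotomic ℚ_[p] Ω l)
      ⟨z, hzK⟩).trans (hN t fun w hw => ?_))
    rw [← map_pow] at hse
    have h1 := AlgEquiv.restrictNormal_commutes (t ^ e) (primePowerCyclotomic ℚ_[p] Ω l)
      ⟨w, hsub N w hw⟩
    exact h1.symm.trans (congrArg
      (fun g : Gal(primePowerCyclotomic ℚ_[p] Ω l/ℚ_[p]) => ((g ⟨w, hsub N w hw⟩ : _) : Ω)) hse)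
  exact hle g.2

/-- The order of Frobenius on ℚ_p(z) is a multiple of ℓ^b, because z^(p^j) = z forces ℓ^b ∣ j. -/
lemma pow_dvd_finrank_adjoin {l : ℕ} [Fact l.Prime] (hpl : p ≠ l) {b : ℕ} {z : Ω}
    (hz : IsPrimitiveRoot z (p ^ l ^ b - 1)) :
    l ^ b ∣ Module.finrank ℚ_[p] (IntermediateField.adjoin ℚ_[p] {z}) := by
  have hp := (Fact.out : p.Prime)
  have hl := (Fact.out : l.Prime)
  have hb0 : l ^ b ≠ 0 := pow_ne_zero b hl.ne_zero
  have hn := pow_sub_one_ne_zero p hb0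
  have := isGalois_of_isAlgClosed (k := ℚ_[p]) (Ω := Ω)
  have hle : IntermediateField.adjoin ℚ_[p] {z} ≤ cyclotomicZqExtension ℚ_[p] Ω l :=
    IntermediateField.adjoin_le_iff.2 (Set.singleton_subset_iff.2
      (mem_cyclotomicZqExtension_of_pow_eq_one hpl hz.pow_eq_one))
  have : IsAbelianGalois ℚ_[p] (IntermediateField.adjoin ℚ_[p] {z}) :=
    isAbelianGalois_of_le_cyclotomicZHatExtension
      (hle.trans (le_iSup (fun q : Nat.Primes => cyclotomicZqExtension ℚ_[p] Ω q) ⟨l, hl⟩))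
  have : FiniteDimensional ℚ_[p] (IntermediateField.adjoin ℚ_[p] {z}) :=
    IntermediateField.adjoin.finiteDimensional (Algebra.IsIntegral.isIntegral _)
  obtain ⟨s, hs⟩ := exists_frobenius p (Ω := Ω) hb0
  rw [← IsGalois.card_aut_eq_finrank]
  refine Dvd.dvd.trans ?_ (orderOf_dvd_natCard
    (AlgEquiv.restrictNormalHom (IntermediateField.adjoin ℚ_[p] {z}) s))
  set j := orderOf (AlgEquiv.restrictNormalHom (IntermediateField.adjoin ℚ_[p] {z}) s) with hj
  have h1 := pow_orderOf_eq_one (AlgEquiv.restrictNormalHom (IntermediateField.adjoin ℚ_[p] {z}) s)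
  rw [← hj, ← map_pow] at h1
  have h2 : (s ^ j) z = z := (AlgEquiv.restrictNormal_commutes (s ^ j)
      (IntermediateField.adjoin ℚ_[p] {z}) ⟨z, IntermediateField.mem_adjoin_simple_self _ z⟩).symm.trans
    (congrArg (fun g : Gal(IntermediateField.adjoin ℚ_[p] {z}/ℚ_[p]) =>
      ((g ⟨z, IntermediateField.mem_adjoin_simple_self _ z⟩ : _) : Ω)) h1)
  rw [hs z hz.pow_eq_one] at h2
  refine dvd_of_pow_sub_one_dvd_pow_sub_one hp.one_lt (hz.dvd_of_pow_eq_one _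
    (mul_right_cancel₀ (hz.ne_zero hn) ?_))
  rw [← pow_succ, Nat.sub_add_cancel (Nat.one_le_pow _ _ hp.pos), h2, one_mul]

end unramified

/-! ### λ_v is an ℓ-adic unit for v ∤ ℓ. -/

section indexRatio

/-- For `l ≠ p`, the `l`-part of the degree `[E ∩ ℚ_p^c : ℚ_p]` is determined by the roots of unity
in `E`. -/
lemma pow_dvd_cyclotomicInertiaDegree {p : ℕ} [Fact p.Prime] {l : ℕ} [Fact l.Prime] (hpl : p ≠ l)
    (E : Type*) [Field E] [Algebra ℚ_[p] E] [FiniteDimensional ℚ_[p] E] {b : ℕ} {z : E}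
    (hz : IsPrimitiveRoot z (p ^ l ^ b - 1)) : l ^ b ∣ cyclotomicInertiaDegree ℚ_[p] E := by
  have := isAlgebraic_algebraicClosure ℚ_[p] E
  let f := IsScalarTower.toAlgHom ℚ_[p] E (AlgebraicClosure E)
  have hX : f.fieldRange ⊓ cyclotomicZHatExtension ℚ_[p] (AlgebraicClosure E) ≤ f.fieldRange :=
    inf_le_left
  have := finiteDimensional_of_le hX
  have hfz : IsPrimitiveRoot (f z) (p ^ l ^ b - 1) := hz.map_of_injective f.injective
  have hle : IntermediateField.adjoin ℚ_[p] {f z}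
      ≤ f.fieldRange ⊓ cyclotomicZHatExtension ℚ_[p] (AlgebraicClosure E) := by
    refine IntermediateField.adjoin_le_iff.2 (Set.singleton_subset_iff.2 ⟨⟨z, rfl⟩, ?_⟩)
    exact le_iSup (fun q : Nat.Primes => cyclotomicZqExtension ℚ_[p] (AlgebraicClosure E) q)
      ⟨l, Fact.out⟩ (mem_cyclotomicZqExtension_of_pow_eq_one hpl hfz.pow_eq_one)
  obtain ⟨r, hr, -⟩ := norm_inclusion hle
  exact (pow_dvd_finrank_adjoin hpl hfz).trans (Dvd.intro r hr)

/-- The ℓ-part M of E ∩ ℚ_p^c lies in the cyclotomic ℤ_ℓ-extension, so it contains the roots of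
unity of order p^[M : ℚ_p] - 1. -/
lemma exists_isPrimitiveRoot_of_cyclotomicInertiaDegree {p : ℕ} [Fact p.Prime] {l : ℕ}
    [Fact l.Prime] (hpl : p ≠ l)
    (E : Type*) [Field E] [Algebra ℚ_[p] E] [FiniteDimensional ℚ_[p] E] :
    ∃ z : E, IsPrimitiveRoot z (p ^ l ^ (cyclotomicInertiaDegree ℚ_[p] E).factorization l - 1) := by
  have := isAlgebraic_algebraicClosure ℚ_[p] E
  have := charZero_of_algebra ℚ_[p] (AlgebraicClosure E)
  let f := IsScalarTower.toAlgHom ℚ_[p] E (AlgebraicClosure E)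
  have hX : f.fieldRange ⊓ cyclotomicZHatExtension ℚ_[p] (AlgebraicClosure E) ≤ f.fieldRange :=
    inf_le_left
  have := finiteDimensional_of_le hX
  obtain ⟨M, hMX, hMl, hM⟩ := exists_le_cyclotomicZqExtension l
    (inf_le_right : f.fieldRange ⊓ cyclotomicZHatExtension ℚ_[p] (AlgebraicClosure E) ≤ _)
  have := finiteDimensional_of_le hMX
  obtain ⟨w, hw⟩ := exists_isPrimitiveRoot_of_isAlgClosed (AlgebraicClosure E)
    (pow_sub_one_ne_zero p (pow_ne_zero ((cyclotomicInertiaDegree ℚ_[p] E).factorization l)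
      (Fact.out : l.Prime).ne_zero))
  have hwM : w ∈ M := mem_of_pow_eq_one_of_le_cyclotomicZqExtension hpl hMl (by
    rw [hM]; exact hw.pow_eq_one)
  obtain ⟨z, rfl⟩ := hX (hMX hwM)
  exact ⟨z, IsPrimitiveRoot.of_map_of_injective (f := f) hw f.injective⟩

variable {F : Type*} [Field F] [NumberField F] (v : HeightOneSpectrum (𝓞 F)) (l : ℕ) [Fact l.Prime]

lemma norm_natCast_completion_eq_one {m : ℕ} (hm : (residueChar v).Coprime m) :
    ‖(m : v.adicCompletion F)‖ = 1 := by
  have h : (m : 𝓞 F) ∉ v.asIdeal := by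
    rw [← Ideal.Quotient.eq_zero_iff_mem, map_natCast, ringChar.spec]
    exact fun h => (Fact.out : (residueChar v).Prime).one_lt.ne'
      (Nat.Coprime.eq_one_of_dvd hm h)
  have h1 := (FinitePlace.norm_eq_one_iff_notMem F v (m : 𝓞 F)).2 h
  rwa [map_natCast, map_natCast] at h1

/-- Both ℓ-parts equal the largest ℓ^b for which F_v contains a primitive root of unity of order
p^(ℓ^b) - 1. -/
lemma factorization_logInertiaDegree (hv : (l : 𝓞 F) ∉ v.asIdeal) :
    (logInertiaDegree v).factorization l = (v.asIdeal.inertiaDeg ℤ).factorization l := by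
  have hl := (Fact.out : l.Prime)
  have hpl : residueChar v ≠ l := fun h => hv (h ▸ residueChar_mem v)
  let := completionAlgebra v (residueChar v) (residueChar_mem v)
  have : FiniteDimensional ℚ_[residueChar v] (v.adicCompletion F) :=
    finiteDimensional_completionAbove (residueChar v) ⟨v, residueChar_mem v⟩
  have hN := absNorm_eq_pow_inertiaDeg v (residueChar v) (residueChar_mem v)
  have hp := (Fact.out : (residueChar v).Prime)
  have hf : v.asIdeal.inertiaDeg ℤ ≠ 0 := by
    intro h
    rw [h, pow_zero] at hN
    exact (HeightOneSpectrum.one_lt_absNorm v).ne' hN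
  have hft := logInertiaDegree_ne_zero v
  refine le_antisymm ?_ ?_
  · obtain ⟨z, hz⟩ := exists_isPrimitiveRoot_of_cyclotomicInertiaDegree hpl (v.adicCompletion F)
    have h1 := dvd_absNorm_sub_one v (m := residueChar v ^ l ^ (logInertiaDegree v).factorization l - 1) ?_ hz
    · rw [hN] at h1
      exact (hl.pow_dvd_iff_le_factorization hf).1 (dvd_of_pow_sub_one_dvd_pow_sub_one hp.one_lt h1)
    · exact norm_natCast_completion_eq_one v
        (coprime_pow_sub_one _ (pow_ne_zero _ hl.ne_zero))
  · rw [← hl.pow_dvd_iff_le_factorization hft]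
    obtain ⟨z, hz⟩ := exists_isPrimitiveRoot_completion v
    rw [hN] at hz
    obtain ⟨c, hc⟩ := pow_sub_one_dvd_pow_sub_one_of_dvd (residueChar v)
      (Nat.ordProj_dvd (v.asIdeal.inertiaDeg ℤ) l)
    refine pow_dvd_cyclotomicInertiaDegree hpl (v.adicCompletion F) (hz.pow
      (Nat.pos_of_ne_zero (pow_sub_one_ne_zero _ hf)) (a := c) ?_)
    rw [hc, mul_comm]

/-- At the primes not above `ℓ`, the ratio `λ_v` is an `ℓ`-adic unit. -/
lemma norm_indexRatio (hv : (l : 𝓞 F) ∉ v.asIdeal) : ‖indexRatio v l‖ = 1 := by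
  have hft := logInertiaDegree_ne_zero v
  have hf : v.asIdeal.inertiaDeg ℤ ≠ 0 := by
    intro h
    have hN := absNorm_eq_pow_inertiaDeg v (residueChar v) (residueChar_mem v)
    rw [h, pow_zero] at hN
    exact (HeightOneSpectrum.one_lt_absNorm v).ne' hN
  have hl : (l : ℝ) ≠ 0 := by exact_mod_cast (Fact.out : l.Prime).ne_zero
  rw [indexRatio, norm_div, norm_natCast_eq_inv_pow_factorization l hf,
    norm_natCast_eq_inv_pow_factorization l hft, factorization_logInertiaDegree v l hv, div_self]
  exact inv_ne_zero (pow_ne_zero _ hl)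

end indexRatio

/-! ### Logarithmic divisors, the homomorphism θ and its kernel. -/

section main
variable {F : Type*} [Field F] [NumberField F] (l : ℕ) [Fact l.Prime]

lemma norm_logValuation_tmul_le (v : HeightOneSpectrum (𝓞 F)) (z : ℤ_[l]) (x : Additive Fˣ) :
    ‖logValuation v l (z ⊗ₜ x)‖ ≤ 1 := by
  have hz : ‖(z : ℚ_[l])‖ ≤ 1 := PadicInt.norm_le_one z
  by_cases hv : (l : 𝓞 F) ∈ v.asIdeal
  · rw [logValuation_tmul, norm_mul, norm_mul, norm_neg, norm_inv]
    refine mul_le_one₀ hz (by positivity) ?_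
    have h := norm_logLocalNorm_le l v hv x
    have h0 : 0 < ‖placeDegree v l‖ := norm_pos_iff.2 (placeDegree_ne_zero v l)
    rw [inv_mul_le_iff₀ h0, mul_one]
    exact h
  · rw [logValuation_tmul_of_notMem v l hv, norm_mul, norm_indexRatio v l hv, one_mul, norm_mul]
    exact mul_le_one₀ hz (norm_nonneg _) (Padic.norm_int_le_one _)

lemma finite_support_logValuation (x : ℤ_[l] ⊗[ℤ] Additive Fˣ) :
    {v : HeightOneSpectrum (𝓞 F) | logValuation v l x ≠ 0}.Finite := by
  induction x using TensorProduct.induction_on with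
  | zero => simp
  | tmul z x =>
    refine ((primesAbove F l).finite_toSet.union (ordDivisor F x).hasFiniteSupport).subset ?_
    intro v hv
    by_contra h
    simp only [Set.mem_union, not_or, Finset.mem_coe, mem_primesAbove,
      Function.mem_support, not_not] at h
    exact hv (by rw [logValuation_tmul_of_notMem v l h.1, h.2]; simp)
  | add x y hx hy =>
    refine (hx.union hy).subset fun v hv => ?_
    by_contra h
    simp only [Set.mem_union, Set.mem_ofPred_eq, not_or, not_not] at h
    exact hv (by rw [map_add, h.1, h.2, add_zero])

lemma norm_logValuation_le (v : HeightOneSpectrum (𝓞 F)) (x : ℤ_[l] ⊗[ℤ] Additive Fˣ) :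
    ‖logValuation v l x‖ ≤ 1 := by
  induction x using TensorProduct.induction_on with
  | zero => simp
  | tmul z x => exact norm_logValuation_tmul_le l v z x
  | add x y hx hy =>
    rw [map_add]
    exact (Padic.nonarchimedean _ _).trans (max_le hx hy)

/-- The logarithmic divisor of an element of `ℤ_ℓ ⊗ F^×`. -/
noncomputable def divisor (x : ℤ_[l] ⊗[ℤ] Additive Fˣ) : LogDivisor F l :=
  Finsupp.ofSupportFinite (fun v => (⟨logValuation v l x, norm_logValuation_le l v x⟩ : ℤ_[l])) <| by
    refine (finite_support_logValuation l x).subset fun v hv h => hv ?_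
    exact Subtype.ext h

lemma coe_divisor (x : ℤ_[l] ⊗[ℤ] Additive Fˣ) (v : HeightOneSpectrum (𝓞 F)) :
    ((divisor l x v : ℤ_[l]) : ℚ_[l]) = logValuation v l x := rfl

lemma divisorCoeffs_injective : Function.Injective (divisorCoeffs F l) := by
  intro D E h
  ext1 v
  exact Subtype.ext (congrFun h v)

lemma divisorCoeffs_divisor (x : ℤ_[l] ⊗[ℤ] Additive Fˣ) :
    divisorCoeffs F l (divisor l x) = logDiv F l x := rfl

/-- Multiplying ṽ_v by deg_F v clears the denominator, and what remains is the product formula. -/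
lemma logDegree_divisor (x : ℤ_[l] ⊗[ℤ] Additive Fˣ) : logDegree F l (divisor l x) = 0 := by
  classical
  induction x using TensorProduct.induction_on with
  | zero =>
    have : divisor (F := F) l 0 = 0 := divisorCoeffs_injective l (by
      rw [divisorCoeffs_divisor, map_zero, map_zero])
    rw [this, map_zero]
  | add x y hx hy =>
    have : divisor l (x + y) = divisor l x + divisor l y := divisorCoeffs_injective l (by
      rw [map_add, divisorCoeffs_divisor, divisorCoeffs_divisor, divisorCoeffs_divisor, map_add])
    rw [this, map_add, hx, hy, add_zero]
  | tmul z x =>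
    set S := (divisor l (z ⊗ₜ[ℤ] x)).support ∪ (primesAbove F l ∪ (ordDivisor F x).support) with hS
    rw [logDegree, Finsupp.linearCombination_apply, Finsupp.sum_of_support_subset _
      (Finset.subset_union_left : _ ⊆ S) _ (by simp)]
    have h := sum_logLocalNorm l x.toMul S
      (Finset.subset_union_left.trans Finset.subset_union_right)
      (Finset.subset_union_right.trans Finset.subset_union_right)
    have h1 : ∀ v ∈ S, divisor l (z ⊗ₜ[ℤ] x) v • placeDegree v l
        = -(z : ℚ_[l]) * logLocalNorm v l x := by
      intro v _
      have h0 := placeDegree_ne_zero v l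
      rw [Algebra.smul_def, show algebraMap ℤ_[l] ℚ_[l] (divisor l (z ⊗ₜ[ℤ] x) v)
        = logValuation v l (z ⊗ₜ[ℤ] x) from rfl, logValuation_tmul]
      field_simp
    rw [Finset.sum_congr rfl h1, ← Finset.mul_sum]
    rw [ofMul_toMul] at h
    rw [h, mul_zero]

variable (F) in
open Classical in
/-- The projection of divisors to those prime to `ℓ`. -/
noncomputable def primeToPart (A : Type*) [AddCommGroup A] :
    (HeightOneSpectrum (𝓞 F) →₀ A) →+ (HeightOneSpectrum (𝓞 F) →₀ A) :=
  Finsupp.filterAddHom fun v : HeightOneSpectrum (𝓞 F) => (l : 𝓞 F) ∉ v.asIdeal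

section primeToPart
variable {A : Type*} [AddCommGroup A] {v : HeightOneSpectrum (𝓞 F)}

lemma primeToPart_of_mem (hv : (l : 𝓞 F) ∈ v.asIdeal) (D : HeightOneSpectrum (𝓞 F) →₀ A) :
    primeToPart F l A D v = 0 := by
  classical
  exact Finsupp.filter_apply_neg _ _ (not_not.2 hv)

lemma primeToPart_of_notMem (hv : (l : 𝓞 F) ∉ v.asIdeal) (D : HeightOneSpectrum (𝓞 F) →₀ A) :
    primeToPart F l A D v = D v := by
  classical
  exact Finsupp.filter_apply_pos _ _ hv

lemma primeToPart_single_of_mem (hv : (l : 𝓞 F) ∈ v.asIdeal) (a : A) :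
    primeToPart F l A (Finsupp.single v a) = 0 := by
  classical
  exact Finsupp.filter_single_of_neg _ (not_not.2 hv)

lemma primeToPart_single_of_notMem (hv : (l : 𝓞 F) ∉ v.asIdeal) (a : A) :
    primeToPart F l A (Finsupp.single v a) = Finsupp.single v a := by
  classical
  exact Finsupp.filter_single_of_pos _ hv

end primeToPart

/-- The divisor away from `ℓ` of an element of `F^×`, in the free `ℤ_ℓ`-module on the primes. -/
noncomputable def primeToDivisor : ℤ_[l] ⊗[ℤ] Additive Fˣ →ₗ[ℤ_[l]] LogDivisor F l :=
  LinearMap.liftBaseChange ℤ_[l] (AddMonoidHom.toIntLinearMap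
    (((Finsupp.mapRange.addMonoidHom (Int.castAddHom ℤ_[l])).comp (primeToPart F l ℤ)).comp
      (ordDivisor F)))

lemma primeToDivisor_tmul' (z : ℤ_[l]) (x : Additive Fˣ) :
    primeToDivisor l (z ⊗ₜ x) = z • Finsupp.mapRange.addMonoidHom (Int.castAddHom ℤ_[l])
      (primeToPart F l ℤ (ordDivisor F x)) := rfl

lemma primeToDivisor_tmul (z : ℤ_[l]) (x : Additive Fˣ) {v : HeightOneSpectrum (𝓞 F)}
    (hv : (l : 𝓞 F) ∉ v.asIdeal) :
    primeToDivisor l (z ⊗ₜ x) v = z * (ordDivisor F x v : ℤ) := by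
  rw [primeToDivisor_tmul', Finsupp.smul_apply, smul_eq_mul, Finsupp.mapRange.addMonoidHom_apply,
    Finsupp.mapRange_apply, primeToPart_of_notMem l hv]
  rfl

lemma primeToDivisor_of_mem (x : ℤ_[l] ⊗[ℤ] Additive Fˣ) {v : HeightOneSpectrum (𝓞 F)}
    (hv : (l : 𝓞 F) ∈ v.asIdeal) : primeToDivisor l x v = 0 := by
  induction x using TensorProduct.induction_on with
  | zero => simp
  | tmul z x =>
    rw [primeToDivisor_tmul', Finsupp.smul_apply, Finsupp.mapRange.addMonoidHom_apply,
      Finsupp.mapRange_apply, primeToPart_of_mem l hv, map_zero, smul_zero]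
  | add x y hx hy => rw [map_add, Finsupp.add_apply, hx, hy, add_zero]

lemma logValuation_eq_indexRatio_mul (x : ℤ_[l] ⊗[ℤ] Additive Fˣ) {v : HeightOneSpectrum (𝓞 F)}
    (hv : (l : 𝓞 F) ∉ v.asIdeal) :
    logValuation v l x = indexRatio v l * (primeToDivisor l x v : ℤ_[l]) := by
  induction x using TensorProduct.induction_on with
  | zero => simp
  | tmul z x =>
    rw [primeToDivisor_tmul l z x hv, logValuation_tmul_of_notMem v l hv]
    push_cast
    ring
  | add x y hx hy =>
    rw [map_add, map_add, Finsupp.add_apply, hx, hy]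
    push_cast
    ring

/-- The inverse `1 / λ_v`, as an `ℓ`-adic integer. -/
noncomputable def indexRatioInv (v : HeightOneSpectrum (𝓞 F)) (hv : (l : 𝓞 F) ∉ v.asIdeal) : ℤ_[l] :=
  ⟨1 / indexRatio v l, by rw [norm_div, norm_one, norm_indexRatio v l hv, div_one]⟩

open Classical in
/-- The coefficient `1 / λ_v`, and `0` for `v ∣ ℓ`. -/
noncomputable def scaleCoeff (v : HeightOneSpectrum (𝓞 F)) : ℤ_[l] :=
  if hv : (l : 𝓞 F) ∈ v.asIdeal then 0 else indexRatioInv l v hv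

lemma scaleCoeff_of_mem {v : HeightOneSpectrum (𝓞 F)} (hv : (l : 𝓞 F) ∈ v.asIdeal) :
    scaleCoeff l v = 0 := dif_pos hv

lemma coe_scaleCoeff_of_notMem {v : HeightOneSpectrum (𝓞 F)} (hv : (l : 𝓞 F) ∉ v.asIdeal) :
    (scaleCoeff l v : ℚ_[l]) = 1 / indexRatio v l := by
  rw [scaleCoeff, dif_neg hv]
  rfl

variable (F) in
/-- The map `∑ m_v v ↦ ∑_{v ∤ ℓ} (m_v / λ_v) v`. -/
noncomputable def scale : LogDivisor F l →ₗ[ℤ_[l]] LogDivisor F l :=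
  Finsupp.lsum ℤ_[l] fun v => (Finsupp.lsingle v).comp (LinearMap.lsmul ℤ_[l] ℤ_[l] (scaleCoeff l v))

lemma scale_apply (D : LogDivisor F l) (v : HeightOneSpectrum (𝓞 F)) :
    scale F l D v = scaleCoeff l v * D v := by
  classical
  induction D using Finsupp.induction_linear with
  | zero => simp
  | add D E hD hE => rw [map_add, Finsupp.add_apply, hD, hE, Finsupp.add_apply, mul_add]
  | single w n =>
    by_cases h : w = v
    · subst h; simp [scale]
    · simp [scale, h]

/-- The factor 1/λ_v undoes ṽ_v = λ_v ord_v. With `idealClass_primeToDivisor` this makes θ vanish on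
principal divisors. -/
lemma scale_divisor (x : ℤ_[l] ⊗[ℤ] Additive Fˣ) : scale F l (divisor l x) = primeToDivisor l x := by
  ext1 v
  rw [scale_apply]
  by_cases hv : (l : 𝓞 F) ∈ v.asIdeal
  · rw [primeToDivisor_of_mem l x hv, scaleCoeff_of_mem l hv, zero_mul]
  · have h0 : indexRatio v l ≠ 0 := norm_ne_zero_iff.1 (by rw [norm_indexRatio v l hv]; exact one_ne_zero)
    apply PadicInt.ext
    rw [PadicInt.coe_mul, coe_divisor, logValuation_eq_indexRatio_mul l x hv,
      coe_scaleCoeff_of_notMem l hv]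
    field_simp

variable (F) in
/-- The class modulo the primes above `ℓ` of an integral divisor. -/
noncomputable def divisorClass : (HeightOneSpectrum (𝓞 F) →₀ ℤ) →+
    Additive (ClassGroup (𝓞 F) ⧸ ladicClasses F l) :=
  Finsupp.liftAddHom fun v => (zmultiplesHom _)
    (Additive.ofMul (placeClass v : ClassGroup (𝓞 F) ⧸ ladicClasses F l))

lemma placeClass_mem (v : HeightOneSpectrum (𝓞 F)) (hv : (l : 𝓞 F) ∈ v.asIdeal) :
    placeClass v ∈ ladicClasses F l := Subgroup.subset_closure ⟨v, hv, rfl⟩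

lemma divisorClass_primeToPart (D : HeightOneSpectrum (𝓞 F) →₀ ℤ) :
    divisorClass F l (primeToPart F l ℤ D) = divisorClass F l D := by
  classical
  have : (divisorClass F l).comp (primeToPart F l ℤ) = divisorClass F l := by
    refine Finsupp.addHom_ext fun v n => ?_
    by_cases hv : (l : 𝓞 F) ∈ v.asIdeal
    · have h0 : (Additive.ofMul (placeClass v : ClassGroup (𝓞 F) ⧸ ladicClasses F l)) = 0 := by
        rw [(QuotientGroup.eq_one_iff _).2 (placeClass_mem l v hv)]
        rfl
      simp [primeToPart_single_of_mem l hv, divisorClass, h0]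
    · simp [primeToPart_single_of_notMem l hv]
  exact DFunLike.congr_fun this D

lemma divisorClass_eq (D : HeightOneSpectrum (𝓞 F) →₀ ℤ) :
    divisorClass F l D = Additive.ofMul
      (ClassGroup.mk F (idealOfDivisor F D).toMul : ClassGroup (𝓞 F) ⧸ ladicClasses F l) := by
  have : divisorClass F l = (MonoidHom.toAdditive
      ((QuotientGroup.mk' (ladicClasses F l)).comp (ClassGroup.mk F))).comp (idealOfDivisor F) := by
    refine Finsupp.addHom_ext fun v n => ?_
    rw [AddMonoidHom.comp_apply, idealOfDivisor_single, map_zsmul]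
    simp only [divisorClass, Finsupp.liftAddHom_apply_single, zmultiplesHom_apply]
    congr 1
    rw [MonoidHom.toAdditive_apply_apply, toMul_ofMul, MonoidHom.comp_apply, primeFractionalIdeal,
      ClassGroup.mk_mk0]
    rfl
  rw [this]
  rfl

lemma mk_eq_one_iff (I : (FractionalIdeal (nonZeroDivisors (𝓞 F)) F)ˣ) :
    ClassGroup.mk F I = 1 ↔ ∃ x : Fˣ, toPrincipalIdeal (𝓞 F) F x = I := by
  rw [← (ClassGroup.equiv F).injective.eq_iff, map_one, ClassGroup.equiv_mk]
  rw [QuotientGroup.mk'_apply, QuotientGroup.eq_one_iff, MonoidHom.mem_range]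
  have : Units.mapEquiv (FractionalIdeal.canonicalEquiv (nonZeroDivisors (𝓞 F)) F F : _ ≃* _) I = I := by
    ext
    simp
  rw [this]

lemma divisorClass_ordDivisor (x : Additive Fˣ) : divisorClass F l (ordDivisor F x) = 0 := by
  rw [divisorClass_eq, idealOfDivisor_ordDivisor, toMul_ofMul, (mk_eq_one_iff _).2 ⟨_, rfl⟩]
  rfl

lemma exists_divisor_of_mem_ladicClasses {c : ClassGroup (𝓞 F)} (hc : c ∈ ladicClasses F l) :
    ∃ D : HeightOneSpectrum (𝓞 F) →₀ ℤ, primeToPart F l ℤ D = 0 ∧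
      ClassGroup.mk F (idealOfDivisor F D).toMul = c := by
  classical
  induction hc using Subgroup.closure_induction with
  | mem c hc =>
    obtain ⟨v, hv, rfl⟩ := hc
    refine ⟨Finsupp.single v 1, primeToPart_single_of_mem l hv 1, ?_⟩
    rw [idealOfDivisor_single, one_smul, toMul_ofMul, primeFractionalIdeal, ClassGroup.mk_mk0]
    rfl
  | one => exact ⟨0, by simp, by simp⟩
  | mul a b _ _ ha hb =>
    obtain ⟨D, h1, rfl⟩ := ha
    obtain ⟨E, h2, rfl⟩ := hb
    exact ⟨D + E, by rw [map_add, h1, h2, add_zero], by rw [map_add, toMul_add, map_mul]⟩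
  | inv a _ ha =>
    obtain ⟨D, h1, rfl⟩ := ha
    exact ⟨-D, by rw [map_neg, h1, neg_zero], by rw [map_neg, toMul_neg, map_inv]⟩

/-- Exactness of `F^× → ⊕_{v ∤ ℓ} ℤ → Cl / ⟨[v] : v ∣ ℓ⟩`. -/
lemma exists_ordDivisor_of_divisorClass_eq_zero {D : HeightOneSpectrum (𝓞 F) →₀ ℤ}
    (hD : divisorClass F l D = 0) : ∃ x, primeToPart F l ℤ (ordDivisor F x) = primeToPart F l ℤ D := by
  rw [divisorClass_eq] at hD
  have h1 : ClassGroup.mk F (idealOfDivisor F D).toMul ∈ ladicClasses F l :=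
    (QuotientGroup.eq_one_iff _).1 (Additive.ofMul.injective hD)
  obtain ⟨E, hE, h2⟩ := exists_divisor_of_mem_ladicClasses l h1
  have h3 : ClassGroup.mk F (idealOfDivisor F (D - E)).toMul = 1 := by
    rw [map_sub, toMul_sub, map_div, h2, div_self']
  obtain ⟨x, hx⟩ := (mk_eq_one_iff _).1 h3
  refine ⟨Additive.ofMul x, ?_⟩
  have h4 : ordDivisor F (Additive.ofMul x) = D - E := by
    rw [← divisorOfIdeal_idealOfDivisor (D - E), ← ofMul_toMul (idealOfDivisor F (D - E)), ← hx]
    rfl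
  rw [h4, map_sub, hE, sub_zero]

lemma divisorClass_surjective : Function.Surjective (divisorClass F l) := by
  intro c
  obtain ⟨c, rfl⟩ := Additive.ofMul.surjective c
  obtain ⟨c, rfl⟩ := QuotientGroup.mk_surjective c
  refine ClassGroup.induction F (fun I => ?_) c
  refine ⟨divisorOfIdeal F (Additive.ofMul I), ?_⟩
  rw [divisorClass_eq, idealOfDivisor_divisorOfIdeal, toMul_ofMul]

lemma idealClass_mapRange (D : HeightOneSpectrum (𝓞 F) →₀ ℤ) :
    idealClass F l (Finsupp.mapRange.addMonoidHom (Int.castAddHom ℤ_[l]) D)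
      = 1 ⊗ₜ divisorClass F l D := by
  induction D using Finsupp.induction_linear with
  | zero => simp
  | add D E hD hE => rw [map_add, map_add, map_add, TensorProduct.tmul_add, hD, hE]
  | single v n =>
    simp only [divisorClass, Finsupp.liftAddHom_apply_single, zmultiplesHom_apply, idealClass,
      Finsupp.mapRange.addMonoidHom_apply, Finsupp.mapRange_single, Int.coe_castAddHom,
      Finsupp.linearCombination_single]
    rw [Int.cast_smul_eq_zsmul, TensorProduct.tmul_smul]

lemma idealClass_primeToDivisor (x : ℤ_[l] ⊗[ℤ] Additive Fˣ) :
    idealClass F l (primeToDivisor l x) = 0 := by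
  induction x using TensorProduct.induction_on with
  | zero => simp
  | add x y hx hy => rw [map_add, map_add, hx, hy, add_zero]
  | tmul z x =>
    rw [primeToDivisor_tmul', map_smul, idealClass_mapRange, divisorClass_primeToPart,
      divisorClass_ordDivisor, TensorProduct.tmul_zero, smul_zero]

variable (F) in
/-- The relations among integral divisors modulo principal divisors and divisors above `ℓ`. -/
noncomputable def divisorRelations :
    (Additive Fˣ × (HeightOneSpectrum (𝓞 F) →₀ ℤ)) →ₗ[ℤ] (HeightOneSpectrum (𝓞 F) →₀ ℤ) :=
  AddMonoidHom.toIntLinearMap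
    (AddMonoidHom.coprod (ordDivisor F) (AddMonoidHom.id _ - primeToPart F l ℤ))

/-- The differences E - `primeToPart` E are the divisors supported above ℓ. This is a presentation
of Cl/⟨[v] : v ∣ ℓ⟩ over ℤ, in a form ready for tensoring. -/
lemma divisorRelations_exact :
    Function.Exact (divisorRelations F l) (divisorClass F l).toIntLinearMap := by
  intro D
  constructor
  · intro h
    obtain ⟨x, hx⟩ := exists_ordDivisor_of_divisorClass_eq_zero l h
    refine ⟨(x, D - ordDivisor F x), ?_⟩
    change ordDivisor F x + (D - ordDivisor F x - primeToPart F l ℤ (D - ordDivisor F x)) = D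
    rw [map_sub, hx]
    abel
  · rintro ⟨⟨x, E⟩, rfl⟩
    change divisorClass F l (ordDivisor F x + (E - primeToPart F l ℤ E)) = 0
    rw [map_add, divisorClass_ordDivisor, map_sub, divisorClass_primeToPart, sub_self, add_zero]

open Classical in
lemma primeToPart_relation (s : ℤ_[l] ⊗[ℤ] (Additive Fˣ × (HeightOneSpectrum (𝓞 F) →₀ ℤ))) :
    primeToPart F l ℤ_[l] (TensorProduct.finsuppScalarRight ℤ ℤ_[l] ℤ_[l] _
      ((divisorRelations F l).lTensor ℤ_[l] s))
      = primeToDivisor l ((LinearMap.fst ℤ _ _).lTensor ℤ_[l] s) := by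
  induction s using TensorProduct.induction_on with
  | zero => simp
  | add x y hx hy => rw [map_add, map_add, map_add, map_add, map_add, hx, hy]
  | tmul z x =>
    obtain ⟨x, E⟩ := x
    rw [LinearMap.lTensor_tmul, LinearMap.lTensor_tmul, LinearMap.fst_apply]
    ext1 v
    by_cases hv : (l : 𝓞 F) ∈ v.asIdeal
    · rw [primeToPart_of_mem l hv, primeToDivisor_of_mem l _ hv]
    · rw [primeToPart_of_notMem l hv, primeToDivisor_tmul l _ _ hv,
        TensorProduct.finsuppScalarRight_apply_tmul_apply]
      change (ordDivisor F x + (E - primeToPart F l ℤ E)) v • z = _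
      rw [Finsupp.add_apply, Finsupp.sub_apply, primeToPart_of_notMem l hv, sub_self, add_zero,
        zsmul_eq_mul, mul_comm]

open Classical in
lemma lTensor_divisorClass (s : ℤ_[l] ⊗[ℤ] (HeightOneSpectrum (𝓞 F) →₀ ℤ)) :
    (divisorClass F l).toIntLinearMap.lTensor ℤ_[l] s
      = idealClass F l (TensorProduct.finsuppScalarRight ℤ ℤ_[l] ℤ_[l] _ s) := by
  induction s using TensorProduct.induction_on with
  | zero => simp
  | add x y hx hy => rw [map_add, map_add, map_add, hx, hy]
  | tmul z D =>
    have h : TensorProduct.finsuppScalarRight ℤ ℤ_[l] ℤ_[l] _ (z ⊗ₜ[ℤ] D)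
        = z • Finsupp.mapRange.addMonoidHom (Int.castAddHom ℤ_[l]) D := by
      ext1 v
      rw [TensorProduct.finsuppScalarRight_apply_tmul_apply, zsmul_eq_mul, mul_comm]
      rfl
    rw [h, map_smul, idealClass_mapRange, TensorProduct.smul_tmul', smul_eq_mul, mul_one]
    rfl

/-- Right exactness of ℤ_ℓ ⊗ – lifts D to relations with coefficients in ℤ_ℓ; the component
supported above ℓ disappears in the prime-to-ℓ part, leaving an element of ℤ_ℓ ⊗ F^×. -/
lemma exists_primeToDivisor_eq {D : LogDivisor F l} (hD : idealClass F l D = 0) :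
    ∃ x, primeToDivisor l x = primeToPart F l ℤ_[l] D := by
  classical
  have h := lTensor_exact ℤ_[l] (divisorRelations_exact (F := F) l)
    (divisorClass_surjective (F := F) l)
  set e := TensorProduct.finsuppScalarRight ℤ ℤ_[l] ℤ_[l] (HeightOneSpectrum (𝓞 F)) with he
  obtain ⟨s, hs⟩ := (h (e.symm D)).1 (by
    rw [lTensor_divisorClass, ← he, LinearEquiv.apply_symm_apply, hD])
  refine ⟨_, (primeToPart_relation l s).symm.trans ?_⟩
  rw [hs, ← he, LinearEquiv.apply_symm_apply]

lemma mem_principal_iff {D : LogDivisor F l} : D ∈ principal F l ↔ ∃ x, divisor l x = D := by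
  constructor
  · rintro ⟨x, hx⟩
    exact ⟨x, divisorCoeffs_injective l hx⟩
  · rintro ⟨x, rfl⟩
    exact ⟨x, rfl⟩

variable (F) in
/-- The homomorphism from logarithmic classes to ideal classes. -/
noncomputable def logClassToIdealClass : LogClassGroup F l →ₗ[ℤ_[l]] LIdealClassGroup F l :=
  Submodule.liftQ _ ((idealClass F l ∘ₗ scale F l) ∘ₗ (degreeZero F l).subtype) <| by
    rintro D hD
    obtain ⟨x, hx⟩ := (mem_principal_iff l).1 hD
    rw [LinearMap.mem_ker, LinearMap.comp_apply, ← hx, LinearMap.comp_apply, scale_divisor,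
      idealClass_primeToDivisor]

lemma logClassToIdealClass_mk (D : degreeZero F l) :
    logClassToIdealClass F l (Submodule.Quotient.mk D) = idealClass F l (scale F l D) := rfl

lemma ker_logClassToIdealClass : LinearMap.ker (logClassToIdealClass F l) = ladicPart F l := by
  ext c
  obtain ⟨D, rfl⟩ := Submodule.Quotient.mk_surjective _ c
  rw [LinearMap.mem_ker, logClassToIdealClass_mk]
  constructor
  · intro h
    obtain ⟨x, hx⟩ := exists_primeToDivisor_eq l h
    have hdeg : divisor l x ∈ degreeZero F l := logDegree_divisor l x
    -- D and div(x) agree at v ∤ ℓ, because their multiples by the nonzero 1/λ_v do. Their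
    -- difference is the representative supported above ℓ.
    refine ⟨D - ⟨divisor l x, hdeg⟩, ?_, ?_⟩
    · refine (Finsupp.mem_supported' ℤ_[l] _).2 fun v hv => ?_
      have hv : (l : 𝓞 F) ∉ v.asIdeal := hv
      have h0 : scaleCoeff l v ≠ 0 := by
        intro h0
        have h1 := coe_scaleCoeff_of_notMem l hv
        rw [h0, PadicInt.coe_zero] at h1
        have h2 := congrArg norm h1
        rw [norm_div, norm_one, norm_indexRatio v l hv, norm_zero, div_one] at h2
        exact zero_ne_one h2
      refine mul_left_cancel₀ h0 ?_
      change scaleCoeff l v * ((D : LogDivisor F l) v - divisor l x v) = _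
      rw [mul_sub, ← scale_apply, ← scale_apply, scale_divisor, hx, primeToPart_of_notMem l hv,
        sub_self, mul_zero]
    · rw [Submodule.mkQ_apply, Submodule.Quotient.mk_sub, sub_eq_self, Submodule.Quotient.mk_eq_zero]
      exact (mem_principal_iff l).2 ⟨x, rfl⟩
  · rintro ⟨E, hE, hED⟩
    rw [← logClassToIdealClass_mk, ← hED, Submodule.mkQ_apply, logClassToIdealClass_mk]
    have : scale F l E = 0 := by
      ext1 v
      rw [scale_apply, Finsupp.zero_apply]
      by_cases hv : (l : 𝓞 F) ∈ v.asIdeal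
      · rw [scaleCoeff_of_mem l hv, zero_mul]
      · have h0 : (E : LogDivisor F l) v = 0 := (Finsupp.mem_supported' ℤ_[l] _).1 hE v hv
        rw [h0, mul_zero]
    rw [this, map_zero]

end main
end LogClass

open LogClass
theorem mainTheorem6 (F : Type*) [Field F] [NumberField F] (l : ℕ) [Fact l.Prime] :
    (∀ x : ℤ_[l] ⊗[ℤ] Additive Fˣ, ∃ D ∈ degreeZero F l, divisorCoeffs F l D = logDiv F l x) ∧
    (∀ v : HeightOneSpectrum (𝓞 F), (l : 𝓞 F) ∉ v.asIdeal → ‖indexRatio v l‖ = 1) ∧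
    ∃ θ : LogClassGroup F l →ₗ[ℤ_[l]] LIdealClassGroup F l,
      (∀ D : degreeZero F l, ∃ a : HeightOneSpectrum (𝓞 F) →₀ ℤ_[l],
        (∀ v : HeightOneSpectrum (𝓞 F), (l : 𝓞 F) ∈ v.asIdeal → a v = 0) ∧
        (∀ v : HeightOneSpectrum (𝓞 F), (l : 𝓞 F) ∉ v.asIdeal →
          (a v : ℚ_[l]) = (1 / indexRatio v l) * ((D : LogDivisor F l) v : ℚ_[l])) ∧
        θ (Submodule.Quotient.mk D) = idealClass F l a) ∧
      LinearMap.ker θ = ladicPart F l ∧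
      Function.Injective (ladicPart F l).subtype ∧
      Function.Exact (ladicPart F l).subtype θ ∧
      Function.Exact θ (LinearMap.range θ).mkQ ∧
      Function.Surjective (LinearMap.range θ).mkQ := by
  refine ⟨fun x => ⟨divisor l x, logDegree_divisor l x, rfl⟩, fun v hv => norm_indexRatio v l hv,
    logClassToIdealClass F l, fun D => ⟨scale F l D, fun v hv => ?_, fun v hv => ?_, rfl⟩,
    ker_logClassToIdealClass l, Submodule.subtype_injective _, ?_, ?_, Submodule.mkQ_surjective _⟩
  · rw [scale_apply, scaleCoeff_of_mem l hv, zero_mul]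
  · rw [scale_apply, PadicInt.coe_mul, coe_scaleCoeff_of_notMem l hv]
  · rw [LinearMap.exact_iff, ker_logClassToIdealClass, Submodule.range_subtype]
  · rw [LinearMap.exact_iff, Submodule.ker_mkQ]
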